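/- Let $(M,g_{ab})$ be a spacetime: a connected paracompact Hausdorff smooth $4$-manifold with a smooth Lorentzian metric of signature $(+,-,-,-)$ and a chosen time orientation (orientability is not needed). Let $T_{ab}$ be its energy-momentum tensor, so that $R_{ab}-\tfrac12 R\,g_{ab}=8\pi T_{ab}$, where the sign convention for $R_{ab}$ is the one for which the standard round sphere has positive Ricci tensor. Assume the dominant energy condition: for every future directed timelike vector $\xi^a$, the vector $T^a{}_b\xi^b$ is zero or a future directed timelike or null vector. Assume that $(M,g_{ab})$ is of class B, i.e. $M$ contains a compact smooth (embedded) null hypersurface $\mathcal N$ generated by closed null geodesics: through each point of $\mathcal N$ there passes a smooth periodic regular null curve, contained in $\mathcal N$, which is a geodesic up to reparametrization. Then the following hold. (a) The null geodesic generators of $\mathcal N$ are expansion-free and shear-free. That is, let $k^a$ be a smooth vector field on the domain of a chart of $M$ which at the points of $\mathcal N$ is nonzero, null and tangent to $\mathcal N$, let $p$ be a point of $\mathcal N$ in this domain, and let $X_1,X_2\in T_p\mathcal N$ be such that $k,X_1,X_2$ are linearly independent. Put $B_{AB}=g(\nabla_{X_A}k,X_B)$ and $q_{AB}=g(X_A,X_B)$,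 with inverse matrix $q^{AB}$. Then $$\theta:=q^{AB}B_{AB}=0,\qquad \sigma_{AB}:=B_{(AB)}-\tfrac12\theta\,q_{AB}=0 .$$ (b) For every elementary neighbourhood $\mathcal O$ with Gaussian null coordinates $(u,r,x^3,x^4)$, $$\frac{\partial g_{AB}}{\partial u}=0\quad\text{wherever } r=0 \qquad (A,B\in\{3,4\}).$$ Here an elementary neighbourhood is a region $\mathcal O=\{(u,r,x^3,x^4): u\in\mathbb R,\ |r|<\epsilon,\ (x^3,x^4)\in V\}$, with $\epsilon>0$ and $V\subset\mathbb R^2$ open and simply connected, together with a local diffeomorphism $\psi:\mathcal O\to M$ such that: $\psi$ maps the $u$-lines onto circles, as their universal coverings, and any two of these circles are equal or disjoint; $\psi^{-1}(\mathcal N)=\{r=0\}$; $\psi_*(\partial/\partial u)$ is future directed on $\{r=0\}$; and $$\psi^*g=r f\,\mathrm du^2+2\,\mathrm dr\,\mathrm du+2r\,h_A\,\mathrm du\,\mathrm dx^A+g_{AB}\,\mathrm dx^A\mathrm dx^B$$ with smooth functions $f,h_A,g_{AB}$ on $\mathcal O$ that are periodic in $u$ with a common period $P>0$, the matrix $(g_{AB})$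 being symmetric and negative definite. -/

import Mathlib

open Set Topology
open scoped Manifold ContDiff

noncomputable section

/-! ### Tensor calculus in coordinates

`Coord` is the coordinate space of a four-dimensional manifold. The first group of definitions
concerns a matrix `G x = (g_ij(x))` of metric components, depending on the coordinates `x`. -/

/-- The model space `ℝ⁴`, with coordinates `x 0, x 1, x 2, x 3`. -/
abbrev Coord : Type := EuclideanSpace ℝ (Fin 4)

/-- The `i`-th coordinate vector of `ℝ⁴`. -/
def coordVec (i : Fin 4) : Coord := EuclideanSpace.single i (1 : ℝ)

/-- The partial derivative `∂F/∂x^i` at `x`. -/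
def partialD (i : Fin 4) (F : Coord → ℝ) (x : Coord) : ℝ := fderiv ℝ F x (coordVec i)

/-- The Christoffel symbols
`Γ^i_{jk} = (1/2) g^{il} (∂_j g_{lk} + ∂_k g_{lj} - ∂_l g_{jk})`. -/
def christoffel (G : Coord → Matrix (Fin 4) (Fin 4) ℝ) (i j k : Fin 4) (x : Coord) : ℝ :=
  (1 / 2) * ∑ l, (G x)⁻¹ i l *
    (partialD j (fun y => G y l k) x + partialD k (fun y => G y l j) x
      - partialD l (fun y => G y j k) x)

/-- The Ricci tensor
`R_{jk} = ∂_i Γ^i_{jk} - ∂_k Γ^i_{ij} + Γ^i_{il} Γ^l_{jk} - Γ^i_{kl} Γ^l_{ij}`.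
It does not change when `g` is replaced by `-g`. -/
def ricci (G : Coord → Matrix (Fin 4) (Fin 4) ℝ) (j k : Fin 4) (x : Coord) : ℝ :=
  ∑ i, (partialD i (christoffel G i j k) x - partialD k (christoffel G i i j) x
    + ∑ l, (christoffel G i i l x * christoffel G l j k x
      - christoffel G i k l x * christoffel G l i j x))

/-- The scalar curvature `R = g^{jk} R_{jk}`. -/
def scalarCurv (G : Coord → Matrix (Fin 4) (Fin 4) ℝ) (x : Coord) : ℝ :=
  ∑ j, ∑ k, (G x)⁻¹ j k * ricci G j k x

/-- The Einstein tensor `G_{jk} = R_{jk} - (1/2) R g_{jk}`. -/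
def einstein (G : Coord → Matrix (Fin 4) (Fin 4) ℝ) (j k : Fin 4) (x : Coord) : ℝ :=
  ricci G j k x - (1 / 2) * scalarCurv G x * G x j k

section Manifold

variable (M : Type*) [TopologicalSpace M] [ChartedSpace Coord M]

/-- A (not necessarily smooth) field of bilinear forms on the tangent spaces of `M`. -/
abbrev BilinField : Type _ :=
  ∀ p : M, TangentSpace (𝓡 4) p →ₗ[ℝ] TangentSpace (𝓡 4) p →ₗ[ℝ] ℝ

/-- A (not necessarily smooth) vector field on `M`. -/
abbrev VecField : Type _ := ∀ p : M, TangentSpace (𝓡 4) p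

variable {M}

/-- A smooth chart of `M`, i.e. a member of the maximal smooth atlas. -/
def IsSmoothChart (e : OpenPartialHomeomorph M Coord) : Prop :=
  e ∈ IsManifold.maximalAtlas (𝓡 4) ∞ M

/-- The tangent vector at `e⁻¹(x)` whose components in the chart `e` are `v`. -/
def chartVec (e : OpenPartialHomeomorph M Coord) (x : Coord) (v : Coord) :
    TangentSpace (𝓡 4) (e.symm x) :=
  mfderiv (𝓡 4) (𝓡 4) e.symm x v

/-- The components in the chart `e` of the tangent vector `X` at `p`. -/
def vecComp (e : OpenPartialHomeomorph M Coord) (p : M) (X : TangentSpace (𝓡 4) p) : Coord :=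
  mfderiv (𝓡 4) (𝓡 4) e p X

/-- The components `B_ij` in the chart `e` of a field of bilinear forms. -/
def bilinComp (e : OpenPartialHomeomorph M Coord) (B : BilinField M) (x : Coord) :
    Matrix (Fin 4) (Fin 4) ℝ :=
  Matrix.of fun i j => B (e.symm x) (chartVec e x (coordVec i)) (chartVec e x (coordVec j))

/-- The components in the chart `e` of a vector field, as a function of the coordinates. -/
def fieldComp (e : OpenPartialHomeomorph M Coord) (K : VecField M) (x : Coord) : Coord :=
  vecComp e (e.symm x) (K (e.symm x))

/-! ### Spacetimes -/

variable (M) in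
/-- A smooth Lorentzian metric `g` of signature `(+,-,-,-)` on the 4-manifold `M`, with a time
orientation, given by a smooth timelike vector field `τ` which is future directed by decree. -/
structure Spacetime where
  g : BilinField M
  g_symm : ∀ (p : M) (X Y : TangentSpace (𝓡 4) p), g p X Y = g p Y X
  g_signature : ∀ p : M, ∃ b : Module.Basis (Fin 4) ℝ (TangentSpace (𝓡 4) p),
    ∀ i j, g p (b i) (b j) = if i = j then (if i = 0 then 1 else -1) else 0
  g_smooth : ∀ e : OpenPartialHomeomorph M Coord, IsSmoothChart e →
    ∀ i j, ContDiffOn ℝ ∞ (fun x => bilinComp e g x i j) e.target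
  τ : VecField M
  τ_timelike : ∀ p : M, 0 < g p (τ p) (τ p)
  τ_smooth : ∀ e : OpenPartialHomeomorph M Coord, IsSmoothChart e →
    ContDiffOn ℝ ∞ (fieldComp e τ) e.target

namespace Spacetime

variable (S : Spacetime M)

/-- Future directed timelike vectors. -/
def FutureTimelike (p : M) (X : TangentSpace (𝓡 4) p) : Prop :=
  0 < S.g p X X ∧ 0 < S.g p (S.τ p) X

/-- Future directed timelike or null (nonzero) vectors. -/
def FutureCausal (p : M) (X : TangentSpace (𝓡 4) p) : Prop :=
  0 ≤ S.g p X X ∧ 0 < S.g p (S.τ p) X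

/-- Einstein's equation `R_ab - (1/2) R g_ab = 8 π T_ab`. -/
def EinsteinEquation (T : BilinField M) : Prop :=
  ∀ e : OpenPartialHomeomorph M Coord, IsSmoothChart e → ∀ x ∈ e.target, ∀ i j,
    einstein (bilinComp e S.g) i j x = 8 * Real.pi * bilinComp e T x i j

/-- The dominant energy condition: for every future directed timelike `ξ`, the vector
`v^a = T^a_b ξ^b`, characterized by `g(v, w) = T(w, ξ)` for all `w`, is future directed
timelike or null; the zero vector is allowed (as it has to be, for vacuum). -/
def DominantEnergyCondition (T : BilinField M) : Prop :=
  ∀ (p : M) (ξ : TangentSpace (𝓡 4) p), S.FutureTimelike p ξ →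
    ∃ v : TangentSpace (𝓡 4) p, (∀ w, S.g p v w = T p w ξ) ∧ (v = 0 ∨ S.FutureCausal p v)

end Spacetime

/-! ### Null hypersurfaces generated by closed null geodesics -/

/-- A chart of `M` in whose domain `N` is the coordinate hyperplane `x⁰ = 0`. -/
def IsSliceChart (N : Set M) (e : OpenPartialHomeomorph M Coord) : Prop :=
  IsSmoothChart e ∧ ∀ q ∈ e.source, q ∈ N ↔ e q 0 = 0

/-- `N` is a smooth (embedded) hypersurface of `M`. -/
def IsSmoothHypersurface (N : Set M) : Prop :=
  ∀ p ∈ N, ∃ e : OpenPartialHomeomorph M Coord, IsSliceChart N e ∧ p ∈ e.source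

/-- `X ∈ T_p M` is tangent to the hypersurface `N`. -/
def IsTangentTo (N : Set M) (p : M) (X : TangentSpace (𝓡 4) p) : Prop :=
  ∃ e : OpenPartialHomeomorph M Coord, IsSliceChart N e ∧ p ∈ e.source ∧ vecComp e p X 0 = 0

namespace Spacetime

variable (S : Spacetime M)

/-- `N` is a smooth null hypersurface: at each point some nonzero tangent vector of `N` is
orthogonal to all tangent vectors of `N`. -/
def IsNullHypersurface (N : Set M) : Prop :=
  IsSmoothHypersurface N ∧ ∀ p ∈ N, ∃ k : TangentSpace (𝓡 4) p, k ≠ 0 ∧ IsTangentTo N p k ∧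
    ∀ X, IsTangentTo N p X → S.g p k X = 0

/-- `k` is a nonzero null vector tangent to `N`. If `N` is a null hypersurface this says that
`k` is tangent to the null geodesic generator of `N` through `p`. -/
def IsGeneratorVector (N : Set M) (p : M) (k : TangentSpace (𝓡 4) p) : Prop :=
  k ≠ 0 ∧ IsTangentTo N p k ∧ S.g p k k = 0

/-- The velocity of the curve `γ` at the parameter value `s`. -/
def velocity (γ : ℝ → M) (s : ℝ) : TangentSpace (𝓡 4) (γ s) :=
  mfderiv 𝓘(ℝ, ℝ) (𝓡 4) γ s (1 : ℝ)

/-- `γ` is a geodesic up to reparametrization: in every chart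
`γ''^i + Γ^i_{jk} γ'^j γ'^k` is proportional to `γ'^i`. -/
def IsPregeodesic (γ : ℝ → M) : Prop :=
  ∀ s : ℝ, ∃ c : ℝ, ∀ e : OpenPartialHomeomorph M Coord, IsSmoothChart e → γ s ∈ e.source →
    ∀ i, deriv (deriv fun t => e (γ t) i) s
      + ∑ j, ∑ k, christoffel (bilinComp e S.g) i j k (e (γ s))
          * deriv (fun t => e (γ t) j) s * deriv (fun t => e (γ t) k) s
      = c * deriv (fun t => e (γ t) i) s

/-- `γ` is a closed null geodesic contained in `N`. The curve returns to the same point with a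
proportional tangent, so it has a periodic regular parametrization; this need not be an affine
one, as the affine parameter may be incomplete. -/
def IsClosedNullGenerator (N : Set M) (γ : ℝ → M) : Prop :=
  ContMDiff 𝓘(ℝ, ℝ) (𝓡 4) ∞ γ ∧ (∃ P : ℝ, 0 < P ∧ ∀ s, γ (s + P) = γ s) ∧
    (∀ s, γ s ∈ N) ∧ (∀ s, S.IsGeneratorVector N (γ s) (velocity γ s)) ∧ S.IsPregeodesic γ

/-- The spacetime is of class B, with horizon `N`: a compact smooth null hypersurface generated
by closed null geodesics. (Orientability is not required.) -/
structure IsClassB (N : Set M) : Prop where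
  compact : IsCompact N
  null : S.IsNullHypersurface N
  closed_generators : ∀ p ∈ N, ∃ γ : ℝ → M, S.IsClosedNullGenerator N γ ∧ ∃ s, γ s = p

/-! ### Expansion and shear of the null generators -/

/-- The covariant derivative `∇_X K` at `p`, computed in the chart `e`:
`(∇_X K)^i = X^j ∂_j K^i + Γ^i_{jk} X^j K^k`. -/
def covDeriv (e : OpenPartialHomeomorph M Coord) (K : VecField M) (p : M)
    (X : TangentSpace (𝓡 4) p) : Coord :=
  WithLp.toLp 2 fun i => (fderiv ℝ (fieldComp e K) (e p) (vecComp e p X)) i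
    + ∑ j, ∑ k, christoffel (bilinComp e S.g) i j k (e p)
        * vecComp e p X j * fieldComp e K (e p) k

/-- `B(X, Y) = g(∇_X K, Y)` at `p`, computed in the chart `e`. -/
def nullForm (e : OpenPartialHomeomorph M Coord) (K : VecField M) (p : M)
    (X Y : TangentSpace (𝓡 4) p) : ℝ :=
  ∑ i, ∑ j, bilinComp e S.g (e p) i j * S.covDeriv e K p X i * vecComp e p Y j

/-- The metric `h_AB = g(X_A, X_B)` of a two-dimensional cross section of `T_p N`. -/
def crossMetric (p : M) (X : Fin 2 → TangentSpace (𝓡 4) p) : Matrix (Fin 2) (Fin 2) ℝ :=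
  Matrix.of fun A B => S.g p (X A) (X B)

/-- The expansion `θ = h^{AB} B_AB` of the generators with tangent `K`; here the `X_A` span a
complement of `K` in `T_p N`. -/
def expansion (e : OpenPartialHomeomorph M Coord) (K : VecField M) (p : M)
    (X : Fin 2 → TangentSpace (𝓡 4) p) : ℝ :=
  ∑ A, ∑ B, (S.crossMetric p X)⁻¹ A B * S.nullForm e K p (X A) (X B)

/-- The shear `σ_AB = B_(AB) - (1/2) θ h_AB` of the generators with tangent `K`. -/
def shear (e : OpenPartialHomeomorph M Coord) (K : VecField M) (p : M)
    (X : Fin 2 → TangentSpace (𝓡 4) p) (A B : Fin 2) : ℝ :=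
  (S.nullForm e K p (X A) (X B) + S.nullForm e K p (X B) (X A)) / 2
    - (1 / 2) * S.expansion e K p X * S.crossMetric p X A B

/-- At each point of `N`, the null generators of `N` have vanishing expansion and shear. Here `K`
is any smooth vector field, on the domain of a chart `e`, which is null and tangent to the
generators on `N`, and `K, X_0, X_1` is a basis of `T_p N`. -/
def GeneratorsExpansionShearFree (N : Set M) : Prop :=
  ∀ (e : OpenPartialHomeomorph M Coord) (K : VecField M), IsSmoothChart e →
    ContDiffOn ℝ ∞ (fieldComp e K) e.target →
    (∀ q ∈ N ∩ e.source, S.IsGeneratorVector N q (K q)) →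
    ∀ p ∈ N ∩ e.source, ∀ X : Fin 2 → TangentSpace (𝓡 4) p,
      (∀ A, IsTangentTo N p (X A)) → LinearIndependent ℝ ![K p, X 0, X 1] →
      S.expansion e K p X = 0 ∧ ∀ A B, S.shear e K p X A B = 0

end Spacetime

/-! ### Elementary neighbourhoods -/

/-- The range `u ∈ ℝ`, `r ∈ (-ε, ε)`, `(x³, x⁴) ∈ V` of Gaussian null coordinates
`(u, r, x³, x⁴) = (x 0, x 1, x 2, x 3)`. -/
def gaussDomain (ε : ℝ) (V : Set (ℝ × ℝ)) : Set Coord :=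
  {x | x 1 ∈ Ioo (-ε) ε ∧ (x 2, x 3) ∈ V}

/-- The matrix of `r f du² + 2 dr du + 2 r h_A du dx^A + q_AB dx^A dx^B`, where `r = x 1`. -/
def gaussMatrix (f : Coord → ℝ) (h : Fin 2 → Coord → ℝ)
    (q : Coord → Matrix (Fin 2) (Fin 2) ℝ) (x : Coord) : Matrix (Fin 4) (Fin 4) ℝ :=
  !![x 1 * f x,   1, x 1 * h 0 x, x 1 * h 1 x;
     1,           0, 0,           0;
     x 1 * h 0 x, 0, q x 0 0,     q x 0 1;
     x 1 * h 1 x, 0, q x 1 0,     q x 1 1]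

/-- An elementary neighbourhood of (a part of) the horizon `N`. The simply connected region `𝒪`
is identified with the range of its Gaussian null coordinates `(u, r, x³, x⁴)`, and it is mapped
by the fibre preserving local isometry `ψ` onto a tubular neighbourhood `ψ '' 𝒪` in `M`. -/
structure ElementaryNeighbourhood (S : Spacetime M) (N : Set M) where
  /-- half the width of the range of `r` -/
  ε : ℝ
  ε_pos : 0 < ε
  /-- the range of `(x³, x⁴)` -/
  V : Set (ℝ × ℝ)
  V_open : IsOpen V
  V_simplyConnected : SimplyConnectedSpace V
  ψ : Coord → M
  ψ_localDiffeo : IsLocalDiffeomorphOn (𝓡 4) (𝓡 4) ∞ ψ (gaussDomain ε V)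
  /-- each `u`-line is mapped onto a circle, as its universal covering -/
  fibre_circle : ∀ x ∈ gaussDomain ε V, ∃ Q : ℝ, 0 < Q ∧ ∀ s t : ℝ,
    ψ (x + s • coordVec 0) = ψ (x + t • coordVec 0) ↔ ∃ n : ℤ, t = s + n * Q
  /-- these circles are the fibres of the tubular neighbourhood: any two are equal or disjoint -/
  fibre_disjoint : ∀ x ∈ gaussDomain ε V, ∀ y ∈ gaussDomain ε V, ψ x = ψ y →
    ∀ s : ℝ, ∃ t : ℝ, ψ (x + s • coordVec 0) = ψ (y + t • coordVec 0)
  /-- the inverse image of the horizon is `r = 0` -/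
  horizon : ∀ x ∈ gaussDomain ε V, ψ x ∈ N ↔ x 1 = 0
  f : Coord → ℝ
  h : Fin 2 → Coord → ℝ
  /-- the block `g_AB` of the metric -/
  q : Coord → Matrix (Fin 2) (Fin 2) ℝ
  f_smooth : ContDiffOn ℝ ∞ f (gaussDomain ε V)
  h_smooth : ∀ A, ContDiffOn ℝ ∞ (h A) (gaussDomain ε V)
  q_smooth : ∀ A B, ContDiffOn ℝ ∞ (fun x => q x A B) (gaussDomain ε V)
  /-- `g_AB` is symmetric and negative definite -/
  q_negDef : ∀ x ∈ gaussDomain ε V, (-(q x)).PosDef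
  /-- the pulled back metric has the Gaussian null form -/
  metric : ∀ x ∈ gaussDomain ε V, ∀ i j,
    S.g (ψ x) (mfderiv (𝓡 4) (𝓡 4) ψ x (coordVec i)) (mfderiv (𝓡 4) (𝓡 4) ψ x (coordVec j))
      = gaussMatrix f h q x i j
  /-- on the horizon `∂/∂u` is future directed -/
  future : ∀ x ∈ gaussDomain ε V, x 1 = 0 →
    S.FutureCausal (ψ x) (mfderiv (𝓡 4) (𝓡 4) ψ x (coordVec 0))
  /-- the period of the metric functions -/
  P : ℝ
  P_pos : 0 < P
  f_periodic : ∀ x ∈ gaussDomain ε V, f (x + P • coordVec 0) = f x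
  h_periodic : ∀ x ∈ gaussDomain ε V, ∀ A, h A (x + P • coordVec 0) = h A x
  q_periodic : ∀ x ∈ gaussDomain ε V, q (x + P • coordVec 0) = q x

end Manifold

end

/-!
Both parts say that the transverse metric `g_AB` is constant along the generators of `N`. This is a
local assertion with a global reason.

*Local part.* Near each point of `N` there is a *flow box* (`IsFlowBox`, `exists_isFlowBox`): a
chart in which `N` is `x¹ = 0` and the generators in `N` are the `x⁰`-lines. In a flow box the `00`
component of the Ricci tensor gives Raychaudhuri's equation (`IsNullAdapted.ricci_null`), and by
Einstein's equation and the dominant energy condition this component is nonnegative on `N`. Hence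
along a closed generator the expansion `θ`, a periodic function, satisfies `θ' ≤ κ θ - σ²` with a
locally bounded `κ` and a quadratic term `σ²` that vanishes only if `∂g_AB/∂x⁰ = 0`. Once
nonpositive, `θ` stays nonpositive; so if `∮ θ = 0`, then `θ = 0` (`eq_zero_of_deriv_le`), hence
`σ² = 0` and `∂g_AB/∂x⁰ = 0` along this generator.

*Global part.* Following the generators once around a closed generator `γ` through `p` gives a local
diffeomorphism `φ` of a transversal disc at `p`, the holonomy (`exists_isHolonomy`), with
`(det Dφ)² = exp (2 ∮ θ)`. Each generator being closed, it meets a compact transversal disc in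
finitely many points (`finite_transversal_inter`). By Baire's theorem the number of these points is
bounded, by some `n`, on a subset `Q` of the disc whose closure has interior points, which can be
found in any given open subset of the disc. If `p` is such an interior point, points of `Q` near `p`
are periodic under `φ` with period at most `n`, so `φ^[n!]` is the identity on a set that is dense
near `p`; hence `(Dφ)^{n!} = 1` and `|det Dφ| = 1` (`det_sq_eq_one_of_finite_orbits`), i.e.
`∮ θ = 0`. So `∂g_AB/∂x⁰` vanishes at a dense set of points of `N`, and everywhere by continuity
(`IsFlowBox.partialD_eq_zero`).

*Conclusion.* Gaussian null coordinates are locally flow boxes, which gives (b). For (a), the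
symmetric part of `g(∇_X k, Y)` is half the Lie derivative of `g` along `k`
(`nullForm_add_nullForm`). It may be computed in a flow box, where it vanishes for `X`, `Y` tangent
to `N` because `k` is a multiple of `∂/∂x⁰` on `N` (`lieMetric_eq_zero`).

The smooth local flows needed for flow boxes are obtained from the inverse function theorem on a
Banach space of paths (`exists_smooth_flow`).
-/

/-! ### Smooth local flows -/

section Flow

variable {K : Type} [TopologicalSpace K] [CompactSpace K]
variable {E : Type} [NormedAddCommGroup E] [NormedSpace ℝ E]
variable {F : Type} [NormedAddCommGroup F] [NormedSpace ℝ F]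

/-- Pointwise application of a continuous family of operators to a continuous map, as a
continuous bilinear map. -/
noncomputable def pointwiseApply : C(K, E →L[ℝ] F) →L[ℝ] C(K, E) →L[ℝ] C(K, F) :=
  LinearMap.mkContinuous₂
    (LinearMap.mk₂ ℝ (fun (A : C(K, E →L[ℝ] F)) (h : C(K, E)) =>
        (⟨fun s => A s (h s), A.continuous.clm_apply h.continuous⟩ : C(K, F)))
      (by intros; ext; simp) (by intros; ext; simp) (by intros; ext; simp)
      (by intros; ext; simp)) 1 (by
    intro A h
    rw [one_mul, ContinuousMap.norm_le _ (by positivity)]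
    intro s
    exact ((A s).le_opNorm _).trans
      (mul_le_mul (A.norm_coe_le_norm s) (h.norm_coe_le_norm s) (norm_nonneg _)
        ((norm_nonneg _).trans (A.norm_coe_le_norm s))))

@[simp] theorem pointwiseApply_apply (A : C(K, E →L[ℝ] F)) (h : C(K, E)) (s : K) :
    pointwiseApply A h s = A s (h s) := rfl

/-- On the Banach space of continuous maps `K → E`, composition with a `C¹` map `v` is
differentiable, with derivative the pointwise application of `Dv ∘ α`. -/
theorem hasFDerivAt_postcomp {v : E → F} (hv : ContDiff ℝ 1 v) (α : C(K, E)) :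
    HasFDerivAt (fun β : C(K, E) => (⟨v, hv.continuous⟩ : C(E, F)).comp β)
      (pointwiseApply ((⟨fderiv ℝ v, hv.continuous_fderiv one_ne_zero⟩ : C(E, E →L[ℝ] F)).comp α))
      α := by
  rw [hasFDerivAt_iff_isLittleO_nhds_zero, Asymptotics.isLittleO_iff]
  intro ε hε
  obtain ⟨δ, hδ, hα⟩ := (Metric.continuous_iff (f := fun β : C(K, E) =>
      (⟨fderiv ℝ v, hv.continuous_fderiv one_ne_zero⟩ : C(E, E →L[ℝ] F)).comp β)).1
    (by exact ContinuousMap.continuous_postcomp (X := K) _) α ε hε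
  filter_upwards [Metric.ball_mem_nhds (0 : C(K, E)) hδ] with h hh
  rw [mem_ball_zero_iff] at hh
  rw [ContinuousMap.norm_le _ (by positivity)]
  intro s
  -- a constant shift of `α` turns continuity of `β ↦ Dv ∘ β` into an estimate at a single point
  have key : ∀ b ∈ segment ℝ (α s) (α s + h s), ‖fderiv ℝ v b - fderiv ℝ v (α s)‖ ≤ ε := by
    intro b hb
    have hb' : ‖b - α s‖ ≤ ‖h s‖ := by
      have := norm_sub_le_of_mem_segment hb
      simpa using this
    have h1 : dist (α + ContinuousMap.const K (b - α s)) α < δ := by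
      rw [dist_eq_norm, add_sub_cancel_left]
      refine lt_of_le_of_lt ?_ hh
      rw [ContinuousMap.norm_le _ (by positivity)]
      intro t
      exact hb'.trans (h.norm_coe_le_norm s)
    have h2 := hα _ h1
    have h3 := (ContinuousMap.dist_apply_le_dist s).trans h2.le
    rw [dist_eq_norm] at h3
    simpa using h3
  have := (convex_segment (𝕜 := ℝ) (α s) (α s + h s)).norm_image_sub_le_of_norm_hasFDerivWithin_le'
    (f := v) (f' := fderiv ℝ v) (φ := fderiv ℝ v (α s)) (C := ε)
    (fun x _ => ((hv.differentiable one_ne_zero) x).hasFDerivAt.hasFDerivWithinAt) key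
    (left_mem_segment ℝ _ _) (right_mem_segment ℝ _ _)
  simp only [add_sub_cancel_left] at this
  simp only [ContinuousMap.coe_sub, ContinuousMap.comp_apply, ContinuousMap.coe_mk, Pi.sub_apply,
    ContinuousMap.add_apply, pointwiseApply_apply]
  exact this.trans (mul_le_mul_of_nonneg_left (h.norm_coe_le_norm s) hε.le)

theorem contDiff_nat_postcomp (n : ℕ) : ∀ {F : Type} [NormedAddCommGroup F] [NormedSpace ℝ F]
    (v : C(E, F)), ContDiff ℝ n v → ContDiff ℝ n (fun β : C(K, E) => v.comp β) := by
  induction n with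
  | zero =>
    intro F _ _ v hv
    rw [Nat.cast_zero, contDiff_zero]
    exact ContinuousMap.continuous_postcomp v
  | succ n ih =>
    intro F _ _ v hv
    have h1 : ContDiff ℝ 1 v := hv.of_le (by exact_mod_cast Nat.le_add_left 1 n)
    rw [show ((n + 1 : ℕ) : WithTop ℕ∞) = (n : WithTop ℕ∞) + 1 by norm_cast] at hv ⊢
    rw [contDiff_succ_iff_hasFDerivAt]
    refine ⟨_, ?_, fun α => hasFDerivAt_postcomp h1 α⟩
    refine (pointwiseApply (K := K) (E := E) (F := F)).contDiff.comp (ih _ ?_)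
    exact hv.fderiv_right le_rfl

/-- Composition with a smooth map is smooth on spaces of continuous maps. -/
theorem contDiff_postcomp (v : C(E, F)) (hv : ContDiff ℝ ∞ v) :
    ContDiff ℝ ∞ (fun β : C(K, E) => v.comp β) :=
  contDiff_infty.2 fun n => contDiff_nat_postcomp n v (contDiff_infty.1 hv n)

/-- The primitive vanishing at `0` of a continuous map on `[0, 1]`. -/
noncomputable def primitive : C(Icc (0 : ℝ) 1, E) →L[ℝ] C(Icc (0 : ℝ) 1, E) :=
  LinearMap.mkContinuous
    { toFun := fun β => ⟨fun s => ∫ t in (0 : ℝ)..s, β (projIcc 0 1 zero_le_one t), by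
        have : Continuous fun t => β (projIcc 0 1 zero_le_one t) :=
          β.continuous.comp continuous_projIcc
        exact (intervalIntegral.continuous_primitive
          (fun a b => this.intervalIntegrable a b) 0).comp continuous_subtype_val⟩
      map_add' := fun β₁ β₂ => by
        ext s
        have h : ∀ β : C(Icc (0 : ℝ) 1, E), Continuous fun t => β (projIcc 0 1 zero_le_one t) :=
          fun β => β.continuous.comp continuous_projIcc
        exact intervalIntegral.integral_add ((h β₁).intervalIntegrable _ _)
          ((h β₂).intervalIntegrable _ _)
      map_smul' := fun c β => by
        ext s
        exact intervalIntegral.integral_smul c _ } 1 (by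
    intro β
    rw [one_mul, ContinuousMap.norm_le _ (norm_nonneg _)]
    intro s
    have := intervalIntegral.norm_integral_le_of_norm_le_const (a := (0 : ℝ)) (b := s)
      (f := fun t => β (projIcc 0 1 zero_le_one t)) (C := ‖β‖)
      (fun t _ => β.norm_coe_le_norm _)
    refine this.trans (mul_le_of_le_one_right (norm_nonneg _) ?_)
    rw [sub_zero, abs_of_nonneg s.2.1]
    exact s.2.2)

theorem primitive_apply (β : C(Icc (0 : ℝ) 1, E)) (s : Icc (0 : ℝ) 1) :
    primitive β s = ∫ t in (0 : ℝ)..s, β (projIcc 0 1 zero_le_one t) := rfl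

/-- A continuous `α : [0, 1] → E` solves `α' = t v(α)`, `α(0) = x` if and only if the second
component of `flowMap v ((t, x), α)` vanishes. -/
noncomputable def flowMap (v : C(E, E)) (z : (ℝ × E) × C(Icc (0 : ℝ) 1, E)) :
    (ℝ × E) × C(Icc (0 : ℝ) 1, E) :=
  (z.1, z.2 - ContinuousMap.const _ z.1.2 - z.1.1 • primitive (v.comp z.2))

/-- Constant maps, as a continuous linear map. -/
noncomputable def constL : E →L[ℝ] C(Icc (0 : ℝ) 1, E) :=
  LinearMap.mkContinuous
    { toFun := fun x => ContinuousMap.const _ x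
      map_add' := fun _ _ => rfl
      map_smul' := fun _ _ => rfl } 1 (by
    intro x
    rw [one_mul, ContinuousMap.norm_le _ (norm_nonneg _)]
    exact fun s => le_rfl)

theorem contDiff_flowMap (v : C(E, E)) (hv : ContDiff ℝ ∞ v) : ContDiff ℝ ∞ (flowMap v) := by
  unfold flowMap
  refine contDiff_fst.prodMk ((contDiff_snd.sub ?_).sub ?_)
  · exact (constL (E := E)).contDiff.comp (contDiff_snd.comp contDiff_fst)
  · exact (contDiff_fst.comp contDiff_fst).smul
      (primitive.contDiff.comp ((contDiff_postcomp v hv).comp contDiff_snd))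

/-- **Inverse function theorem**, with smoothness of the inverse on an open set: a smooth map with
invertible derivative at `a` is a diffeomorphism near `a`. -/
theorem exists_local_inverse [CompleteSpace E] {f : E → F} {U : Set E} (hU : IsOpen U)
    (hf : ContDiffOn ℝ ∞ f U) {a : E} (ha : a ∈ U) (f' : E ≃L[ℝ] F)
    (hf' : HasFDerivAt f (f' : E →L[ℝ] F) a) :
    ∃ R : OpenPartialHomeomorph E F, (R : E → F) = f ∧ R.source ⊆ U ∧ a ∈ R.source ∧
      ContDiffOn ℝ ∞ R.symm R.target := by
  have hfa : ContDiffAt ℝ ∞ f a := hf.contDiffAt (hU.mem_nhds ha)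
  -- the derivative stays invertible on an open neighbourhood of `a`
  have hV : IsOpen (U ∩ fderiv ℝ f ⁻¹' range ((↑) : (E ≃L[ℝ] F) → E →L[ℝ] F)) :=
    (hf.continuousOn_fderiv_of_isOpen hU (by simp)).isOpen_inter_preimage hU
      ContinuousLinearEquiv.isOpen
  set V := U ∩ fderiv ℝ f ⁻¹' range ((↑) : (E ≃L[ℝ] F) → E →L[ℝ] F)
  have haV : a ∈ V := ⟨ha, ⟨f', hf'.fderiv.symm⟩⟩
  set R₀ := hfa.toOpenPartialHomeomorph f hf' (by simp)
  refine ⟨R₀.restrOpen V hV, rfl, ?_, ?_, ?_⟩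
  · intro x hx
    rw [OpenPartialHomeomorph.restrOpen_source] at hx
    exact hx.2.1
  · rw [OpenPartialHomeomorph.restrOpen_source]
    exact ⟨hfa.mem_toOpenPartialHomeomorph_source hf' (by simp), haV⟩
  · intro y hy
    have hx := (R₀.restrOpen V hV).map_target hy
    rw [OpenPartialHomeomorph.restrOpen_source] at hx
    obtain ⟨-, hxU, L, hL⟩ := hx
    have hfx : ContDiffAt ℝ ∞ f ((R₀.restrOpen V hV).symm y) := hf.contDiffAt (hU.mem_nhds hxU)
    refine ((R₀.restrOpen V hV).contDiffAt_symm (f₀' := L) hy ?_ hfx).contDiffWithinAt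
    rw [hL]
    exact (hfx.differentiableAt (by simp)).hasFDerivAt

theorem flowMap_eq_iff {v : C(E, E)} {t : ℝ} {x : E} {α : C(Icc (0 : ℝ) 1, E)} :
    flowMap v ((t, x), α) = ((t, x), 0) ↔
      ∀ s : Icc (0 : ℝ) 1, α s = x + t • ∫ r in (0 : ℝ)..s, v (α (projIcc 0 1 zero_le_one r)) := by
  simp only [flowMap, Prod.mk.injEq, true_and, ContinuousMap.ext_iff]
  refine forall_congr' fun s => ?_
  simp only [ContinuousMap.coe_sub, ContinuousMap.coe_smul, Pi.sub_apply, Pi.smul_apply,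
    ContinuousMap.const_apply, primitive_apply, ContinuousMap.comp_apply, ContinuousMap.zero_apply]
  rw [sub_sub, sub_eq_zero]

/-- **Smooth dependence on initial conditions**: a smooth vector field has a smooth local flow.
The solution operator is obtained from the inverse function theorem for `flowMap` on the Banach
space of continuous maps `[0, 1] → E`, at time scale `t = 0`, where its derivative is a shear. -/
theorem exists_smooth_flow [CompleteSpace E] (v : E → E) (hv : ContDiff ℝ ∞ v) (x₀ : E) :
    ∃ (Φ : ℝ × E → E) (δ : ℝ), 0 < δ ∧ ContDiffOn ℝ ∞ Φ (Ioo (-δ) δ ×ˢ Metric.ball x₀ δ) ∧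
      (∀ x ∈ Metric.ball x₀ δ, Φ (0, x) = x) ∧
      ∀ t ∈ Ioo (-δ) δ, ∀ x ∈ Metric.ball x₀ δ, HasDerivAt (fun s => Φ (s, x)) (v (Φ (t, x))) t := by
  set w : C(E, E) := ⟨v, hv.continuous⟩ with hw
  set α₀ : C(Icc (0 : ℝ) 1, E) := ContinuousMap.const _ x₀ with hα₀
  have hsm : ContDiff ℝ ∞ (flowMap w) := contDiff_flowMap w hv
  -- the derivative of `flowMap` at time scale zero is a shear
  set S : (ℝ × E) →L[ℝ] C(Icc (0 : ℝ) 1, E) :=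
    constL.comp (ContinuousLinearMap.snd ℝ ℝ E) +
      (ContinuousLinearMap.fst ℝ ℝ E).smulRight (primitive (w.comp α₀)) with hS
  let P₁ := ContinuousLinearMap.fst ℝ (ℝ × E) C(Icc (0 : ℝ) 1, E)
  let P₂ := ContinuousLinearMap.snd ℝ (ℝ × E) C(Icc (0 : ℝ) 1, E)
  let D : ((ℝ × E) × C(Icc (0 : ℝ) 1, E)) ≃L[ℝ] ((ℝ × E) × C(Icc (0 : ℝ) 1, E)) :=
    ContinuousLinearEquiv.equivOfInverse (P₁.prod (P₂ - S.comp P₁)) (P₁.prod (P₂ + S.comp P₁))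
      (fun z => Prod.ext rfl (by simp [P₁, P₂])) (fun z => Prod.ext rfl (by simp [P₁, P₂]))
  have hD : HasFDerivAt (flowMap w) (D : _ →L[ℝ] ((ℝ × E) × C(Icc (0 : ℝ) 1, E)))
      ((0, x₀), α₀) := by
    have h1 : HasFDerivAt (fun z : (ℝ × E) × C(Icc (0 : ℝ) 1, E) => w.comp z.2)
        ((pointwiseApply ((⟨fderiv ℝ v, hv.continuous_fderiv (by simp)⟩ :
          C(E, E →L[ℝ] E)).comp α₀)).comp P₂) ((0, x₀), α₀) :=
      HasFDerivAt.comp (g := fun β : C(Icc (0 : ℝ) 1, E) => w.comp β) (f := P₂)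
        (((0, x₀), α₀) : (ℝ × E) × C(Icc (0 : ℝ) 1, E))
        (hasFDerivAt_postcomp (hv.of_le (by simp)) α₀) P₂.hasFDerivAt
    have h2 := (primitive (E := E)).hasFDerivAt.comp
      (((0, x₀), α₀) : (ℝ × E) × C(Icc (0 : ℝ) 1, E)) h1
    have h3 : HasFDerivAt (fun z : (ℝ × E) × C(Icc (0 : ℝ) 1, E) => z.1.1)
        ((ContinuousLinearMap.fst ℝ ℝ E).comp P₁) ((0, x₀), α₀) :=
      ((ContinuousLinearMap.fst ℝ ℝ E).comp P₁).hasFDerivAt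
    have h4 : HasFDerivAt (fun z : (ℝ × E) × C(Icc (0 : ℝ) 1, E) => constL z.1.2)
        (constL.comp ((ContinuousLinearMap.snd ℝ ℝ E).comp P₁)) ((0, x₀), α₀) :=
      (constL.comp ((ContinuousLinearMap.snd ℝ ℝ E).comp P₁)).hasFDerivAt
    have h5 := P₁.hasFDerivAt.prodMk
      (((P₂.hasFDerivAt (x := (((0, x₀), α₀) : (ℝ × E) × C(Icc (0 : ℝ) 1, E)))).sub h4).sub
        (h3.smul h2))
    refine h5.congr_fderiv ?_
    refine ContinuousLinearMap.ext fun z => Prod.ext rfl ?_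
    simp [D, P₁, P₂, hS, sub_sub]
  obtain ⟨R, hRf, -, haR, hRs⟩ := exists_local_inverse isOpen_univ hsm.contDiffOn
    (mem_univ (((0, x₀), α₀) : (ℝ × E) × C(Icc (0 : ℝ) 1, E))) D hD
  have h0 : flowMap w ((0, x₀), α₀) = ((0, x₀), 0) :=
    flowMap_eq_iff.2 fun s => by simp [hα₀]
  have hR0 : R ((0, x₀), α₀) = ((0, x₀), 0) := by rw [hRf, h0]
  -- `A p` is the solution with time scale and initial value `p`
  set A : ℝ × E → C(Icc (0 : ℝ) 1, E) := fun p => (R.symm (p, 0)).2 with hA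
  have hTopen : IsOpen ((fun p : ℝ × E => (p, (0 : C(Icc (0 : ℝ) 1, E)))) ⁻¹' R.target) :=
    R.open_target.preimage (by fun_prop)
  have hmemT : ((0, x₀) : ℝ × E) ∈
      (fun p : ℝ × E => (p, (0 : C(Icc (0 : ℝ) 1, E)))) ⁻¹' R.target := by
    rw [mem_preimage, ← hR0]; exact R.map_source haR
  have hAsm : ContDiffOn ℝ ∞ A
      ((fun p : ℝ × E => (p, (0 : C(Icc (0 : ℝ) 1, E)))) ⁻¹' R.target) :=
    contDiff_snd.comp_contDiffOn (hRs.comp (by fun_prop) (fun p hp => hp))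
  have hA0 : A (0, x₀) = α₀ := by
    rw [hA]
    simp only
    rw [← hR0, R.left_inv haR]
  have hAeq : ∀ p, (p, (0 : C(Icc (0 : ℝ) 1, E))) ∈ R.target →
      R.symm (p, 0) = (p, A p) ∧ flowMap w (p, A p) = (p, 0) := by
    intro p hp
    have h1 : flowMap w (R.symm (p, 0)) = (p, 0) := by rw [← hRf, R.right_inv hp]
    have h2 : (R.symm (p, 0)).1 = p := congrArg Prod.fst h1
    have h3 : R.symm (p, 0) = (p, A p) := Prod.ext h2 rfl
    exact ⟨h3, h3 ▸ h1⟩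
  -- a neighbourhood on which solutions are unique
  obtain ⟨η, hη, hball⟩ := Metric.isOpen_iff.1 R.open_source _ haR
  obtain ⟨δ₁, hδ₁, hT⟩ := Metric.isOpen_iff.1 hTopen _ hmemT
  have hAcont : ContinuousAt A (0, x₀) :=
    (hAsm.contDiffAt (hTopen.mem_nhds hmemT)).continuousAt
  obtain ⟨δ₂, hδ₂, hAnear⟩ := Metric.continuousAt_iff.1 hAcont η hη
  set δ := min (min δ₁ δ₂) η / 3 with hδdef
  have hδpos : 0 < δ := by positivity
  have hδ1 : 2 * δ < δ₁ := by
    have : min (min δ₁ δ₂) η ≤ δ₁ := (min_le_left _ _).trans (min_le_left _ _)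
    rw [hδdef] at hδpos ⊢; linarith
  have hδ2 : 2 * δ < δ₂ := by
    have : min (min δ₁ δ₂) η ≤ δ₂ := (min_le_left _ _).trans (min_le_right _ _)
    rw [hδdef] at hδpos ⊢; linarith
  have hδ3 : 2 * δ < η := by
    have : min (min δ₁ δ₂) η ≤ η := min_le_right _ _
    rw [hδdef] at hδpos ⊢; linarith
  have hdist : ∀ (t : ℝ) (x : E), |t| < 2 * δ → dist x x₀ < δ →
      dist ((t, x) : ℝ × E) (0, x₀) < 2 * δ := by
    intro t x ht hx
    rw [Prod.dist_eq, max_lt_iff]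
    refine ⟨?_, by simp only; linarith⟩
    simpa [Real.dist_eq] using ht
  -- rescaling of time: the path of time scale `t`, run up to `σ`, is the path of time scale `σ t`
  have hscale : ∀ (t : ℝ) (x : E) (σ : Icc (0 : ℝ) 1), |t| < 2 * δ → dist x x₀ < δ →
      A (t, x) σ = A (σ * t, x) ⟨1, by simp⟩ := by
    intro t x σ ht hx
    have hd := hdist t x ht hx
    have hσt : |(σ : ℝ) * t| < 2 * δ := by
      rw [abs_mul, abs_of_nonneg σ.2.1]
      exact (mul_le_of_le_one_left (abs_nonneg _) σ.2.2).trans_lt ht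
    have hd' := hdist _ x hσt hx
    have hp : ((t, x), (0 : C(Icc (0 : ℝ) 1, E))) ∈ R.target := hT (hd.trans hδ1)
    have hp' : (((σ : ℝ) * t, x), (0 : C(Icc (0 : ℝ) 1, E))) ∈ R.target := hT (hd'.trans hδ1)
    let m : C(Icc (0 : ℝ) 1, Icc (0 : ℝ) 1) :=
      ⟨fun s => ⟨σ * s, mul_nonneg σ.2.1 s.2.1, mul_le_one₀ σ.2.2 s.2.1 s.2.2⟩, by fun_prop⟩
    have hsol : flowMap w (((σ : ℝ) * t, x), (A (t, x)).comp m) = (((σ : ℝ) * t, x), 0) := by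
      rw [flowMap_eq_iff]
      intro s
      have h1 := flowMap_eq_iff.1 (hAeq _ hp).2 (m s)
      rw [ContinuousMap.comp_apply, h1]
      congr 1
      have h2 : ∫ r in (0 : ℝ)..s, w (((A (t, x)).comp m) (projIcc 0 1 zero_le_one r)) =
          ∫ r in (0 : ℝ)..s, w (A (t, x) (projIcc 0 1 zero_le_one (σ * r))) := by
        refine intervalIntegral.integral_congr fun r hr => ?_
        rw [uIcc_of_le s.2.1] at hr
        have hr1 : r ∈ Icc (0 : ℝ) 1 := ⟨hr.1, hr.2.trans s.2.2⟩
        have hr2 : (σ : ℝ) * r ∈ Icc (0 : ℝ) 1 :=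
          ⟨mul_nonneg σ.2.1 hr1.1, mul_le_one₀ σ.2.2 hr1.1 hr1.2⟩
        simp only [ContinuousMap.comp_apply]
        rw [projIcc_of_mem _ hr1, projIcc_of_mem _ hr2]
        rfl
      rw [h2, mul_comm (σ : ℝ) t, mul_smul, intervalIntegral.smul_integral_comp_mul_left
        (f := fun r => w (A (t, x) (projIcc 0 1 zero_le_one r)))]
      simp [m]
    have hclose : (((σ : ℝ) * t, x), (A (t, x)).comp m) ∈ R.source := by
      apply hball
      rw [Metric.mem_ball, Prod.dist_eq, max_lt_iff]
      refine ⟨hd'.trans hδ3, ?_⟩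
      have hAd : dist (A (t, x)) α₀ < η := by
        rw [← hA0]; exact hAnear (hd.trans hδ2)
      refine lt_of_le_of_lt ?_ hAd
      rw [ContinuousMap.dist_le dist_nonneg]
      intro s
      exact ContinuousMap.dist_apply_le_dist (f := A (t, x)) (g := α₀) (m s)
    have h3 : R (((σ : ℝ) * t, x), (A (t, x)).comp m) = (((σ : ℝ) * t, x), 0) := by rw [hRf, hsol]
    have h4 : (((σ : ℝ) * t, x), (A (t, x)).comp m) = (((σ : ℝ) * t, x), A ((σ : ℝ) * t, x)) := by
      rw [← (hAeq _ hp').1, ← h3, R.left_inv hclose]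
    have h5 : (A (t, x)).comp m = A ((σ : ℝ) * t, x) := congrArg Prod.snd h4
    rw [← h5, ContinuousMap.comp_apply]
    congr 1
    exact Subtype.ext (by simp [m])
  set Φ : ℝ × E → E := fun p => A p ⟨1, by simp⟩ with hΦ
  have hsub : Ioo (-δ) δ ×ˢ Metric.ball x₀ δ ⊆
      (fun p : ℝ × E => (p, (0 : C(Icc (0 : ℝ) 1, E)))) ⁻¹' R.target := by
    rintro ⟨t, x⟩ ⟨ht, hx⟩
    exact hT ((hdist t x (by have := abs_lt.2 ht; simp only at this; linarith) hx).trans hδ1)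
  have hev1 : ContDiff ℝ ∞ fun β : C(Icc (0 : ℝ) 1, E) => β ⟨1, by simp⟩ :=
    ContinuousLinearMap.contDiff
      (ContinuousMap.evalCLM ℝ (⟨1, by simp⟩ : Icc (0 : ℝ) 1) : C(Icc (0 : ℝ) 1, E) →L[ℝ] E)
  have hΦsm : ContDiffOn ℝ ∞ Φ (Ioo (-δ) δ ×ˢ Metric.ball x₀ δ) :=
    hev1.comp_contDiffOn (hAsm.mono hsub)
  have hnz : ∀ t ∈ Ioo (-δ) δ, t ≠ 0 → ∀ x ∈ Metric.ball x₀ δ,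
      HasDerivAt (fun s => Φ (s, x)) (v (Φ (t, x))) t := by
    intro t ht ht0 x hx
    have ht2 : |2 * t| < 2 * δ := by
      rw [abs_mul, abs_two]; have := abs_lt.2 ht; linarith
    have hp : ((2 * t, x), (0 : C(Icc (0 : ℝ) 1, E))) ∈ R.target :=
      hT ((hdist _ x ht2 hx).trans hδ1)
    have hint := flowMap_eq_iff.1 (hAeq _ hp).2
    have hc : Continuous fun r => w (A (2 * t, x) (projIcc 0 1 zero_le_one r)) :=
      w.continuous.comp ((A (2 * t, x)).continuous.comp continuous_projIcc)
    have hhalf : (1 / 2 : ℝ) ∈ Icc (0 : ℝ) 1 := by constructor <;> norm_num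
    have hd1 : HasDerivAt (fun σ : ℝ => x + (2 * t) •
        ∫ r in (0 : ℝ)..σ, w (A (2 * t, x) (projIcc 0 1 zero_le_one r)))
        ((2 * t) • v (Φ (t, x))) (t / (2 * t)) := by
      have h1 := ((hc.integral_hasStrictDerivAt 0 (t / (2 * t))).hasDerivAt.const_smul
        (2 * t)).const_add x
      have h2 : t / (2 * t) = 1 / 2 := by field_simp
      have h3 : w (A (2 * t, x) (projIcc 0 1 zero_le_one (t / (2 * t)))) = v (Φ (t, x)) := by
        rw [h2, projIcc_of_mem _ hhalf, hscale _ x ⟨1 / 2, hhalf⟩ ht2 hx]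
        simp only [hw, hΦ, ContinuousMap.coe_mk]
        congr 4
        ring
      rw [h3] at h1
      exact h1
    have hd2 := hd1.scomp t ((hasDerivAt_id t).div_const (2 * t))
    have h4 : (1 / (2 * t)) • (2 * t) • v (Φ (t, x)) = v (Φ (t, x)) := by
      rw [smul_smul, one_div_mul_cancel (by positivity), one_smul]
    rw [h4] at hd2
    refine hd2.congr_of_eventuallyEq ?_
    have hev : ∀ᶠ s in 𝓝 t, s / (2 * t) ∈ Icc (0 : ℝ) 1 := by
      have hcont : ContinuousAt (fun s : ℝ => s / (2 * t)) t := by fun_prop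
      refine hcont.eventually_mem (Icc_mem_nhds ?_ ?_)
      · rw [show t / (2 * t) = 1 / 2 by field_simp]; norm_num
      · rw [show t / (2 * t) = 1 / 2 by field_simp]; norm_num
    filter_upwards [hev] with s hs
    have h5 := hscale (2 * t) x ⟨s / (2 * t), hs⟩ ht2 hx
    rw [hint] at h5
    simp only [Function.comp_apply, id]
    rw [h5]
    simp only [hΦ]
    congr 3
    field_simp
  refine ⟨Φ, δ, hδpos, hΦsm, ?_, ?_⟩
  · intro x hx
    have hp : ((0, x), (0 : C(Icc (0 : ℝ) 1, E))) ∈ R.target :=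
      hsub ⟨⟨by simpa using hδpos, hδpos⟩, hx⟩
    have := flowMap_eq_iff.1 (hAeq _ hp).2 ⟨1, by simp⟩
    simpa [hΦ] using this
  · intro t ht x hx
    by_cases ht0 : t = 0
    · subst ht0
      -- at time zero the equation follows by continuity
      have hopen : IsOpen (Ioo (-δ) δ ×ˢ Metric.ball x₀ δ) := isOpen_Ioo.prod Metric.isOpen_ball
      have hcurve : ContDiffOn ℝ ∞ (fun s => Φ (s, x)) (Ioo (-δ) δ) :=
        hΦsm.comp (by fun_prop) fun s hs => ⟨hs, hx⟩
      have hdc : ContinuousAt (deriv fun s => Φ (s, x)) 0 :=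
        (hcurve.continuousOn_deriv_of_isOpen isOpen_Ioo (by simp)).continuousAt
          (isOpen_Ioo.mem_nhds ht)
      have hvc : ContinuousAt (fun s => v (Φ (s, x))) 0 :=
        hv.continuous.continuousAt.comp
          (hcurve.continuousOn.continuousAt (isOpen_Ioo.mem_nhds ht))
      have heq : (deriv fun s => Φ (s, x)) =ᶠ[𝓝[≠] 0] fun s => v (Φ (s, x)) := by
        filter_upwards [self_mem_nhdsWithin,
          nhdsWithin_le_nhds (isOpen_Ioo.mem_nhds ht)] with s hs hs'
        exact (hnz s hs' hs x hx).deriv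
      have h0 : deriv (fun s => Φ (s, x)) 0 = v (Φ (0, x)) :=
        tendsto_nhds_unique
          ((hdc.tendsto.mono_left nhdsWithin_le_nhds).congr' heq)
          (hvc.tendsto.mono_left nhdsWithin_le_nhds)
      rw [← h0]
      exact ((hcurve.contDiffAt (isOpen_Ioo.mem_nhds ht)).differentiableAt (by simp)).hasDerivAt
    · exact hnz t ht ht0 x hx

end Flow

/-! ### Tensors in charts -/

/-- The bilinear form with matrix `A`, evaluated on coordinate vectors. -/
def bil (A : Matrix (Fin 4) (Fin 4) ℝ) (v w : Coord) : ℝ := ∑ i, ∑ j, A i j * v i * w j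

theorem sum_coordVec (v : Coord) : ∑ i, v i • coordVec i = v := by
  ext k
  simp [coordVec, Pi.single_apply]

@[simp] theorem coordVec_apply (i j : Fin 4) : coordVec i j = if j = i then 1 else 0 := by
  simp [coordVec]

theorem bil_coordVec (A : Matrix (Fin 4) (Fin 4) ℝ) (i j : Fin 4) :
    bil A (coordVec i) (coordVec j) = A i j := by
  simp [bil]

section Charts

variable {M : Type*} [TopologicalSpace M] [ChartedSpace Coord M]

theorem bil_bilinComp (e : OpenPartialHomeomorph M Coord) (B : BilinField M) (x v w : Coord) :
    bil (bilinComp e B x) v w = B (e.symm x) (chartVec e x v) (chartVec e x w) := by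
  have h : ∀ v : Coord, chartVec e x v = ∑ i, v i • chartVec e x (coordVec i) := by
    intro v
    let L : Coord →L[ℝ] Coord := mfderiv (𝓡 4) (𝓡 4) e.symm x
    have h1 : L v = ∑ i, v i • L (coordVec i) := by
      conv_lhs => rw [← sum_coordVec v, map_sum]
      exact Finset.sum_congr rfl fun i _ => map_smul _ _ _
    exact h1
  rw [h v, h w]
  simp only [map_sum, map_smul, LinearMap.sum_apply, LinearMap.smul_apply, smul_eq_mul, bil,
    bilinComp, Matrix.of_apply, Finset.mul_sum]
  rw [Finset.sum_comm]
  refine Finset.sum_congr rfl fun i _ => Finset.sum_congr rfl fun j _ => ?_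
  ring

theorem IsSmoothChart.mdifferentiable {e : OpenPartialHomeomorph M Coord} (he : IsSmoothChart e) :
    e.MDifferentiable (𝓡 4) (𝓡 4) :=
  ⟨(contMDiffOn_of_mem_maximalAtlas he).mdifferentiableOn (by simp),
    (contMDiffOn_symm_of_mem_maximalAtlas he).mdifferentiableOn (by simp)⟩

theorem vecComp_chartVec {e : OpenPartialHomeomorph M Coord} (he : IsSmoothChart e) {x : Coord}
    (hx : x ∈ e.target) (v : Coord) : vecComp e (e.symm x) (chartVec e x v) = v := by
  have := he.mdifferentiable.comp_symm_deriv hx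
  exact congrArg (fun L : Coord →L[ℝ] Coord => L v) this

theorem chartVec_vecComp {e : OpenPartialHomeomorph M Coord} (he : IsSmoothChart e) {p : M}
    (hp : p ∈ e.source) (X : TangentSpace (𝓡 4) p) :
    (chartVec e (e p) (vecComp e p X) : Coord) = (X : Coord) := by
  have := he.mdifferentiable.symm_comp_deriv hp
  exact congrArg (fun L : Coord →L[ℝ] Coord => L X) this

theorem bilinField_congr (B : BilinField M) {p q : M} (h : q = p) (X Y : TangentSpace (𝓡 4) p)
    (X' Y' : TangentSpace (𝓡 4) q) (hX : (X' : Coord) = (X : Coord))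
    (hY : (Y' : Coord) = (Y : Coord)) : B q X' Y' = B p X Y := by
  subst h
  cases hX
  cases hY
  rfl

/-- A bilinear form evaluated through its components in a chart. -/
theorem bilinField_eq_bil {e : OpenPartialHomeomorph M Coord} (he : IsSmoothChart e)
    (B : BilinField M) {p : M} (hp : p ∈ e.source) (X Y : TangentSpace (𝓡 4) p) :
    B p X Y = bil (bilinComp e B (e p)) (vecComp e p X) (vecComp e p Y) := by
  rw [bil_bilinComp]
  exact (bilinField_congr B (e.left_inv hp) _ _ _ _ (chartVec_vecComp he hp X)
    (chartVec_vecComp he hp Y)).symm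

theorem vecComp_injective {e : OpenPartialHomeomorph M Coord} (he : IsSmoothChart e) {p : M}
    (hp : p ∈ e.source) {X : TangentSpace (𝓡 4) p} (hX : vecComp e p X = 0) : X = 0 := by
  have := chartVec_vecComp he hp X
  rw [hX] at this
  let L : Coord →L[ℝ] Coord := mfderiv (𝓡 4) (𝓡 4) e.symm (e p)
  exact this.symm.trans (map_zero L)

theorem contDiffOn_transition {e e' : OpenPartialHomeomorph M Coord} (he : IsSmoothChart e)
    (he' : IsSmoothChart e') :
    ContDiffOn ℝ ∞ (e' ∘ e.symm) (e.target ∩ e.symm ⁻¹' e'.source) := by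
  rw [← contMDiffOn_iff_contDiffOn]
  exact (contMDiffOn_of_mem_maximalAtlas he').comp'
    (contMDiffOn_symm_of_mem_maximalAtlas he)

omit [ChartedSpace Coord M] in
theorem isOpen_transition (e e' : OpenPartialHomeomorph M Coord) :
    IsOpen (e.target ∩ e.symm ⁻¹' e'.source) :=
  e.isOpen_inter_preimage_symm e'.open_source

theorem differentiableAt_transition {e e' : OpenPartialHomeomorph M Coord} (he : IsSmoothChart e)
    (he' : IsSmoothChart e') {p : M} (hp : p ∈ e.source) (hp' : p ∈ e'.source) :
    DifferentiableAt ℝ (e' ∘ e.symm) (e p) :=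
  ((contDiffOn_transition he he').contDiffAt ((isOpen_transition e e').mem_nhds
    ⟨e.map_source hp, by rwa [mem_preimage, e.left_inv hp]⟩)).differentiableAt (by simp)

/-- Transformation of the components of a vector under a change of chart. -/
theorem vecComp_transition {e e' : OpenPartialHomeomorph M Coord} (he : IsSmoothChart e)
    (he' : IsSmoothChart e') {p : M} (hp : p ∈ e.source) (hp' : p ∈ e'.source)
    (X : TangentSpace (𝓡 4) p) :
    vecComp e' p X = fderiv ℝ (e' ∘ e.symm) (e p) (vecComp e p X) := by
  have h1 : (e' : M → Coord) =ᶠ[𝓝 p] (e' ∘ e.symm) ∘ e := by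
    filter_upwards [e.open_source.mem_nhds hp] with q hq
    simp [e.left_inv hq]
  have h2 : MDifferentiableAt (𝓡 4) (𝓡 4) (e' ∘ e.symm) (e p) :=
    (differentiableAt_transition he he' hp hp').mdifferentiableAt
  have h3 := mfderiv_comp p h2 (he.mdifferentiable.mdifferentiableAt hp)
  have h4 : (mfderiv (𝓡 4) (𝓡 4) e' p : Coord →L[ℝ] Coord) =
      mfderiv (𝓡 4) (𝓡 4) ((e' ∘ e.symm) ∘ e) p := h1.mfderiv_eq
  have h5 : mfderiv (𝓡 4) (𝓡 4) (e' ∘ e.symm) (e p) = fderiv ℝ (e' ∘ e.symm) (e p) :=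
    mfderiv_eq_fderiv
  have h6 := h4.trans h3
  exact (congrArg (fun L : Coord →L[ℝ] Coord => L X) h6).trans
    (congrArg (fun L : Coord →L[ℝ] Coord => L (vecComp e p X)) h5)

/-- Transformation of the components of a bilinear form under a change of chart. -/
theorem bil_transition {e e' : OpenPartialHomeomorph M Coord} (he : IsSmoothChart e)
    (he' : IsSmoothChart e') (B : BilinField M) {x : Coord} (hx : x ∈ e.target)
    (hx' : e.symm x ∈ e'.source) (v w : Coord) :
    bil (bilinComp e B x) v w =
      bil (bilinComp e' B (e' (e.symm x))) (fderiv ℝ (e' ∘ e.symm) x v)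
        (fderiv ℝ (e' ∘ e.symm) x w) := by
  have hp := e.map_target hx
  have h := fun v => vecComp_transition he he' hp hx' (chartVec e x v)
  simp only [vecComp_chartVec he hx, e.right_inv hx] at h
  rw [bil_bilinComp, bilinField_eq_bil he' B hx', h, h]

/-! ### Lorentzian linear algebra -/

variable (S : Spacetime M)

theorem Spacetime.neg_of_orthogonal_timelike (p : M) (τ w : TangentSpace (𝓡 4) p)
    (hτ : 0 < S.g p τ τ) (h : S.g p τ w = 0) (hw : w ≠ 0) : S.g p w w < 0 := by
  obtain ⟨b, hb⟩ := S.g_signature p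
  have key : ∀ X Y, S.g p X Y = b.repr X 0 * b.repr Y 0 - b.repr X 1 * b.repr Y 1
      - b.repr X 2 * b.repr Y 2 - b.repr X 3 * b.repr Y 3 := by
    intro X Y
    conv_lhs => rw [← b.sum_repr X, ← b.sum_repr Y]
    simp only [map_add, map_smul, LinearMap.add_apply, LinearMap.smul_apply, smul_eq_mul, hb,
      Fin.sum_univ_four]
    simp
    ring
  rw [key] at hτ h ⊢
  have hw' : ¬ (b.repr w 0 = 0 ∧ b.repr w 1 = 0 ∧ b.repr w 2 = 0 ∧ b.repr w 3 = 0) := by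
    rintro ⟨h0, h1, h2, h3⟩
    apply hw
    apply b.repr.injective
    ext i
    fin_cases i <;> simp [h0, h1, h2, h3]
  generalize b.repr w 0 = w0 at *
  generalize b.repr w 1 = w1 at *
  generalize b.repr w 2 = w2 at *
  generalize b.repr w 3 = w3 at *
  generalize b.repr τ 0 = t0 at *
  generalize b.repr τ 1 = t1 at *
  generalize b.repr τ 2 = t2 at *
  generalize b.repr τ 3 = t3 at *
  by_contra hneg
  push Not at hneg
  have h1 : 0 < t0 * t0 := by nlinarith [mul_self_nonneg t1, mul_self_nonneg t2, mul_self_nonneg t3]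
  have h2 : (t0 * w0) ^ 2 ≤ (t1 * t1 + t2 * t2 + t3 * t3) * (w1 * w1 + w2 * w2 + w3 * w3) := by
    have : t0 * w0 = t1 * w1 + t2 * w2 + t3 * w3 := by linarith
    rw [this]
    nlinarith [sq_nonneg (t1 * w2 - t2 * w1), sq_nonneg (t1 * w3 - t3 * w1),
      sq_nonneg (t2 * w3 - t3 * w2)]
  have h3 : w1 * w1 + w2 * w2 + w3 * w3 = 0 := by
    by_contra hne
    have hpos : 0 < w1 * w1 + w2 * w2 + w3 * w3 := lt_of_le_of_ne
      (by nlinarith [mul_self_nonneg w1, mul_self_nonneg w2, mul_self_nonneg w3]) (Ne.symm hne)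
    have h5 : (t1 * t1 + t2 * t2 + t3 * t3) * (w1 * w1 + w2 * w2 + w3 * w3) <
        (t0 * t0) * (w1 * w1 + w2 * w2 + w3 * w3) :=
      mul_lt_mul_of_pos_right (by linarith) hpos
    have h6 : (t0 * t0) * (w1 * w1 + w2 * w2 + w3 * w3) ≤ (t0 * t0) * (w0 * w0) :=
      mul_le_mul_of_nonneg_left (by linarith) h1.le
    nlinarith
  have e1 : w1 = 0 := by nlinarith [mul_self_nonneg w1, mul_self_nonneg w2, mul_self_nonneg w3]
  have e2 : w2 = 0 := by nlinarith [mul_self_nonneg w1, mul_self_nonneg w2, mul_self_nonneg w3]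
  have e3 : w3 = 0 := by nlinarith [mul_self_nonneg w1, mul_self_nonneg w2, mul_self_nonneg w3]
  subst e1 e2 e3
  have e0 : t0 * w0 = 0 := by linarith
  rcases mul_eq_zero.1 e0 with h0 | h0
  · rw [h0] at h1; simp at h1
  · exact hw' ⟨h0, rfl, rfl, rfl⟩

theorem Spacetime.nondegenerate (p : M) (X : TangentSpace (𝓡 4) p)
    (h : ∀ Y, S.g p X Y = 0) : X = 0 := by
  by_contra hX
  have := S.neg_of_orthogonal_timelike p (S.τ p) X (S.τ_timelike p)
    (by rw [S.g_symm]; exact h _) hX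
  rw [h X] at this
  exact lt_irrefl _ this

theorem Spacetime.g_τ_ne_zero (p : M) (k : TangentSpace (𝓡 4) p) (hk : k ≠ 0)
    (hkk : 0 ≤ S.g p k k) : S.g p (S.τ p) k ≠ 0 := fun h =>
  absurd (S.neg_of_orthogonal_timelike p _ k (S.τ_timelike p) h hk) (not_lt.2 hkk)

/-- A vector orthogonal to a null vector `k` is spacelike unless it is a multiple of `k`. -/
theorem Spacetime.neg_of_orthogonal_null (p : M) (k X : TangentSpace (𝓡 4) p) (hk : k ≠ 0)
    (hkk : S.g p k k = 0) (h : S.g p k X = 0) (hX : ∀ c : ℝ, X ≠ c • k) : S.g p X X < 0 := by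
  have ht := S.g_τ_ne_zero p k hk hkk.ge
  set c := S.g p (S.τ p) X / S.g p (S.τ p) k with hc
  have h1 := S.neg_of_orthogonal_timelike p (S.τ p) (X - c • k) (S.τ_timelike p)
    (by rw [map_sub, map_smul, smul_eq_mul, hc, div_mul_cancel₀ _ ht, sub_self])
    (sub_ne_zero.2 (hX c))
  simpa [hkk, h, S.g_symm p X k] using h1

theorem Spacetime.g_nonneg_of_future (p : M) (ξ v : TangentSpace (𝓡 4) p)
    (hξ : S.FutureTimelike p ξ) (hv : S.FutureCausal p v) : 0 ≤ S.g p v ξ := by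
  set t := S.g p (S.τ p) v / S.g p (S.τ p) ξ with ht
  have htpos : 0 < t := div_pos hv.2 hξ.2
  have horth : S.g p (S.τ p) (v - t • ξ) = 0 := by
    rw [map_sub, map_smul, smul_eq_mul, ht, div_mul_cancel₀ _ hξ.2.ne', sub_self]
  have hle : S.g p (v - t • ξ) (v - t • ξ) ≤ 0 := by
    by_cases hz : v - t • ξ = 0
    · rw [hz]; simp
    · exact (S.neg_of_orthogonal_timelike p _ _ (S.τ_timelike p) horth hz).le
  simp only [map_sub, map_smul, LinearMap.sub_apply, LinearMap.smul_apply, smul_eq_mul,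
    S.g_symm p ξ v] at hle
  have h1 := hv.1
  have h2 := mul_pos (mul_pos htpos htpos) hξ.1
  nlinarith

/-! ### The dominant energy condition on null vectors -/

theorem Spacetime.DominantEnergyCondition.nonneg_timelike {S : Spacetime M} {T : BilinField M}
    (h : S.DominantEnergyCondition T) (p : M) (ξ : TangentSpace (𝓡 4) p)
    (hξ : S.FutureTimelike p ξ) : 0 ≤ T p ξ ξ := by
  obtain ⟨v, hv, hv'⟩ := h p ξ hξ
  rw [← hv]
  rcases hv' with rfl | hv'
  · simp
  · exact S.g_nonneg_of_future p ξ v hξ hv'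

theorem Spacetime.DominantEnergyCondition.nonneg_null {S : Spacetime M} {T : BilinField M}
    (h : S.DominantEnergyCondition T) (p : M) (k : TangentSpace (𝓡 4) p)
    (hk : S.g p k k = 0) : 0 ≤ T p k k := by
  by_cases hk0 : k = 0
  · subst hk0; simp
  have main : ∀ k : TangentSpace (𝓡 4) p, S.g p k k = 0 → 0 < S.g p (S.τ p) k →
      0 ≤ T p k k := by
    intro k hk hpos
    -- `k` is the limit of the future timelike vectors `k + ε τ`
    have hlim : Filter.Tendsto (fun ε : ℝ => T p (k + ε • S.τ p) (k + ε • S.τ p)) (𝓝[>] 0)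
        (𝓝 (T p k k)) := by
      have hc : Continuous fun ε : ℝ => T p (k + ε • S.τ p) (k + ε • S.τ p) := by
        simp only [map_add, map_smul, LinearMap.add_apply, LinearMap.smul_apply, smul_eq_mul]
        fun_prop
      have := (hc.tendsto 0).mono_left (nhdsWithin_le_nhds (s := Ioi 0))
      simpa using this
    refine ge_of_tendsto hlim ?_
    filter_upwards [self_mem_nhdsWithin] with ε hε
    have hε : 0 < ε := hε
    have hττ := S.τ_timelike p
    refine h.nonneg_timelike p _ ⟨?_, ?_⟩
    · simp only [map_add, map_smul, LinearMap.add_apply, LinearMap.smul_apply, smul_eq_mul, hk,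
        S.g_symm p k (S.τ p)]
      positivity
    · simp only [map_add, map_smul, smul_eq_mul]
      positivity
  rcases lt_or_gt_of_ne (S.g_τ_ne_zero p k hk0 hk.ge) with hneg | hpos
  · have := main (-k) (by simpa using hk) (by simpa using hneg)
    simpa using this
  · exact main k hk hpos

/-! ### The metric in a chart -/

theorem bilinComp_symm (e : OpenPartialHomeomorph M Coord) (x : Coord) (i j : Fin 4) :
    bilinComp e S.g x i j = bilinComp e S.g x j i := S.g_symm _ _ _

theorem bil_symm (e : OpenPartialHomeomorph M Coord) (x v w : Coord) :
    bil (bilinComp e S.g x) v w = bil (bilinComp e S.g x) w v := by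
  rw [bil_bilinComp, bil_bilinComp, S.g_symm]

theorem isUnit_det_bilinComp {e : OpenPartialHomeomorph M Coord} (he : IsSmoothChart e)
    {x : Coord} (hx : x ∈ e.target) : IsUnit (bilinComp e S.g x).det := by
  rw [isUnit_iff_ne_zero]
  intro hdet
  obtain ⟨v, hv, hGv⟩ := Matrix.exists_mulVec_eq_zero_iff.2 hdet
  apply hv
  set v' : Coord := WithLp.toLp 2 v with hv'
  have h0 : chartVec e x v' = 0 := by
    apply S.nondegenerate
    intro Y
    have h1 : bil (bilinComp e S.g x) (vecComp e (e.symm x) Y) v' = 0 := by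
      unfold bil
      refine Finset.sum_eq_zero fun i _ => ?_
      have h2 := congrFun hGv i
      simp only [Matrix.mulVec, dotProduct, Pi.zero_apply] at h2
      have h3 : ∀ j, bilinComp e S.g x i j * vecComp e (e.symm x) Y i * v' j =
          vecComp e (e.symm x) Y i * (bilinComp e S.g x i j * v j) := by
        intro j; simp only [hv']; ring
      simp only [h3]
      rw [← Finset.mul_sum, h2, mul_zero]
    rw [bil_symm] at h1
    rw [bilinField_eq_bil he S.g (e.map_target hx), vecComp_chartVec he hx, e.right_inv hx, h1]
  have h4 := vecComp_chartVec he hx v'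
  rw [h0, vecComp, map_zero] at h4
  exact congrArg (WithLp.ofLp) h4.symm

end Charts

/-! ### Partial derivatives -/

theorem partialD_add {F K : Coord → ℝ} {x : Coord} (i : Fin 4) (hF : DifferentiableAt ℝ F x)
    (hK : DifferentiableAt ℝ K x) :
    partialD i (fun y => F y + K y) x = partialD i F x + partialD i K x := by
  simp [partialD, fderiv_fun_add hF hK]

theorem partialD_sub {F K : Coord → ℝ} {x : Coord} (i : Fin 4) (hF : DifferentiableAt ℝ F x)
    (hK : DifferentiableAt ℝ K x) :
    partialD i (fun y => F y - K y) x = partialD i F x - partialD i K x := by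
  simp [partialD, fderiv_fun_sub hF hK]

theorem partialD_mul {F K : Coord → ℝ} {x : Coord} (i : Fin 4) (hF : DifferentiableAt ℝ F x)
    (hK : DifferentiableAt ℝ K x) :
    partialD i (fun y => F y * K y) x = F x * partialD i K x + partialD i F x * K x := by
  simp [partialD, fderiv_fun_mul hF hK, mul_comm]

theorem partialD_congr {F K : Coord → ℝ} {x : Coord} (i : Fin 4) (h : F =ᶠ[𝓝 x] K) :
    partialD i F x = partialD i K x := by
  simp [partialD, h.fderiv_eq]

theorem hasDerivAt_line {F : Coord → ℝ} {x : Coord} (v : Coord) (hF : DifferentiableAt ℝ F x) :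
    HasDerivAt (fun t : ℝ => F (x + t • v)) (fderiv ℝ F x v) 0 := by
  have h1 : HasDerivAt (fun t : ℝ => x + t • v) v 0 := by
    simpa using ((hasDerivAt_id (0 : ℝ)).smul_const v).const_add x
  have h2 : HasFDerivAt F (fderiv ℝ F x) (x + (0 : ℝ) • v) := by simpa using hF.hasFDerivAt
  exact h2.comp_hasDerivAt (0 : ℝ) h1

theorem continuous_line (x v : Coord) : Continuous fun t : ℝ => x + t • v := by fun_prop

theorem ContDiffOn.partialD {F : Coord → ℝ} {U : Set Coord} (hF : ContDiffOn ℝ ∞ F U)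
    (hU : IsOpen U) (i : Fin 4) : ContDiffOn ℝ ∞ (partialD i F) U :=
  (hF.fderiv_of_isOpen hU (by simp)).clm_apply contDiffOn_const

theorem partialD_comm {F : Coord → ℝ} {U : Set Coord} (hF : ContDiffOn ℝ ∞ F U)
    (hU : IsOpen U) {x : Coord} (hx : x ∈ U) (i j : Fin 4) :
    partialD i (partialD j F) x = partialD j (partialD i F) x := by
  have hFx := hF.contDiffAt (hU.mem_nhds hx)
  have hsymm : IsSymmSndFDerivAt ℝ F x := hFx.isSymmSndFDerivAt (by
    rw [minSmoothness_of_isRCLikeNormedField]; exact ENat.LEInfty.out)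
  have hd : DifferentiableAt ℝ (fderiv ℝ F) x :=
    ((hF.fderiv_of_isOpen hU (m := ∞) (by simp)).contDiffAt (hU.mem_nhds hx)).differentiableAt
      (by simp)
  have h : ∀ i j, partialD i (partialD j F) x = fderiv ℝ (fderiv ℝ F) x (coordVec i)
      (coordVec j) := by
    intro i j
    unfold partialD
    rw [fderiv_clm_apply hd (differentiableAt_const _)]
    simp
  rw [h, h]
  exact hsymm _ _

/-- A function vanishing on the hypersurface `x¹ = 0` has vanishing tangential derivatives
there. -/
theorem fderiv_eq_zero_of_tangent {F : Coord → ℝ} {U : Set Coord} (hU : IsOpen U) {x : Coord}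
    (hx : x ∈ U) (hx1 : x 1 = 0) (hF : DifferentiableAt ℝ F x)
    (h0 : ∀ y ∈ U, y 1 = 0 → F y = 0) {v : Coord} (hv : v 1 = 0) : fderiv ℝ F x v = 0 := by
  have h1 := hasDerivAt_line v hF
  have h2 : (fun t : ℝ => F (x + t • v)) =ᶠ[𝓝 0] fun _ => 0 := by
    have : ∀ᶠ t : ℝ in 𝓝 0, x + t • v ∈ U :=
      (continuous_line x v).continuousAt.eventually_mem (hU.mem_nhds (by simpa using hx))
    filter_upwards [this] with t ht
    exact h0 _ ht (by simp [hx1, hv])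
  exact h1.unique ((hasDerivAt_const (0 : ℝ) (0 : ℝ)).congr_of_eventuallyEq h2)

/-! ### Metric components adapted to a null hypersurface -/

/-- `G` is a smooth matrix of metric components on `U` for which `x¹ = 0` is a null hypersurface
with generators tangent to `∂/∂x⁰`. -/
structure IsNullAdapted (G : Coord → Matrix (Fin 4) (Fin 4) ℝ) (U : Set Coord) : Prop where
  isOpen : IsOpen U
  smooth : ∀ i j, ContDiffOn ℝ ∞ (fun x => G x i j) U
  symm : ∀ x i j, G x i j = G x j i
  det_isUnit : ∀ x ∈ U, IsUnit (G x).det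
  null : ∀ x ∈ U, x 1 = 0 → G x 0 0 = 0
  orth_two : ∀ x ∈ U, x 1 = 0 → G x 0 2 = 0
  orth_three : ∀ x ∈ U, x 1 = 0 → G x 0 3 = 0

theorem contDiffOn_det {G : Coord → Matrix (Fin 4) (Fin 4) ℝ} {U : Set Coord}
    (h : ∀ i j, ContDiffOn ℝ ∞ (fun x => G x i j) U) : ContDiffOn ℝ ∞ (fun x => (G x).det) U := by
  simp only [Matrix.det_apply]
  refine ContDiffOn.sum fun σ _ => ContDiffOn.const_smul _ ?_
  exact contDiffOn_prod fun i _ => h _ _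

theorem contDiffOn_matrix_inv {G : Coord → Matrix (Fin 4) (Fin 4) ℝ} {U : Set Coord}
    (h : ∀ i j, ContDiffOn ℝ ∞ (fun x => G x i j) U) (hdet : ∀ x ∈ U, IsUnit (G x).det)
    (i j : Fin 4) : ContDiffOn ℝ ∞ (fun x => (G x)⁻¹ i j) U := by
  simp only [Matrix.inv_def, Matrix.smul_apply, smul_eq_mul, Ring.inverse_eq_inv',
    Matrix.adjugate_apply]
  refine (contDiffOn_det h).inv (fun x hx => (hdet x hx).ne_zero) |>.mul ?_
  refine contDiffOn_det fun k l => ?_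
  by_cases hk : k = j
  · subst hk
    simpa using contDiffOn_const
  · simpa [Matrix.updateRow_ne hk] using h k l

theorem christoffel_symm {G : Coord → Matrix (Fin 4) (Fin 4) ℝ} (h : ∀ x i j, G x i j = G x j i)
    (i j k : Fin 4) (x : Coord) : christoffel G i j k x = christoffel G i k j x := by
  unfold christoffel
  congr 1
  refine Finset.sum_congr rfl fun l _ => ?_
  have : (fun y => G y j k) = fun y => G y k j := funext fun y => h y j k
  rw [this]
  ring

/-- The determinant of the block `g_AB` of the metric. -/
noncomputable def crossDet (G : Coord → Matrix (Fin 4) (Fin 4) ℝ) (x : Coord) : ℝ :=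
  G x 2 2 * G x 3 3 - G x 2 3 * G x 3 2

/-- The expansion `½ g^{AB} ∂g_AB/∂x⁰` of `∂/∂x⁰`, for metric components adapted to a null
hypersurface. -/
noncomputable def adaptedExpansion (G : Coord → Matrix (Fin 4) (Fin 4) ℝ) (x : Coord) : ℝ :=
  christoffel G 2 2 0 x + christoffel G 3 3 0 x

/-- The square of the second fundamental form of the null hypersurface in the direction of
`∂/∂x⁰`, for adapted metric components. -/
noncomputable def adaptedSquare (G : Coord → Matrix (Fin 4) (Fin 4) ℝ) (x : Coord) : ℝ :=
  christoffel G 2 2 0 x ^ 2 + 2 * christoffel G 2 3 0 x * christoffel G 3 2 0 x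
    + christoffel G 3 3 0 x ^ 2

namespace IsNullAdapted

variable {G : Coord → Matrix (Fin 4) (Fin 4) ℝ} {U : Set Coord} (h : IsNullAdapted G U)
include h

theorem inv_smooth (i j : Fin 4) : ContDiffOn ℝ ∞ (fun x => (G x)⁻¹ i j) U :=
  contDiffOn_matrix_inv h.smooth h.det_isUnit i j

theorem christoffel_smooth (i j k : Fin 4) : ContDiffOn ℝ ∞ (christoffel G i j k) U := by
  unfold christoffel
  refine contDiffOn_const.mul (ContDiffOn.sum fun l _ => (h.inv_smooth i l).mul ?_)
  exact (((h.smooth _ _).partialD h.isOpen _).add ((h.smooth _ _).partialD h.isOpen _)).sub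
    ((h.smooth _ _).partialD h.isOpen _)

theorem differentiableAt_of_smooth {F : Coord → ℝ} (hF : ContDiffOn ℝ ∞ F U) {x : Coord}
    (hx : x ∈ U) : DifferentiableAt ℝ F x :=
  (hF.contDiffAt (h.isOpen.mem_nhds hx)).differentiableAt (by simp)

theorem adaptedExpansion_smooth : ContDiffOn ℝ ∞ (adaptedExpansion G) U :=
  (h.christoffel_smooth 2 2 0).add (h.christoffel_smooth 3 3 0)

theorem crossDet_smooth : ContDiffOn ℝ ∞ (crossDet G) U :=
  ((h.smooth 2 2).mul (h.smooth 3 3)).sub ((h.smooth 2 3).mul (h.smooth 3 2))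

theorem partialD_eq_zero {F : Coord → ℝ} (hF : ContDiffOn ℝ ∞ F U)
    (h0 : ∀ y ∈ U, y 1 = 0 → F y = 0) {x : Coord} (hx : x ∈ U) (hx1 : x 1 = 0) {i : Fin 4}
    (hi : i ≠ 1) : partialD i F x = 0 :=
  fderiv_eq_zero_of_tangent h.isOpen hx hx1 (h.differentiableAt_of_smooth hF hx) h0
    (by simp [hi.symm])

theorem partialD_eq {F K : Coord → ℝ} (hF : ContDiffOn ℝ ∞ F U) (hK : ContDiffOn ℝ ∞ K U)
    (h0 : ∀ y ∈ U, y 1 = 0 → F y = K y) {x : Coord} (hx : x ∈ U) (hx1 : x 1 = 0) {i : Fin 4}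
    (hi : i ≠ 1) : partialD i F x = partialD i K x := by
  have := h.partialD_eq_zero (hF.sub hK) (fun y hy hy1 => sub_eq_zero.2 (h0 y hy hy1)) hx hx1 hi
  rwa [partialD_sub i (h.differentiableAt_of_smooth hF hx) (h.differentiableAt_of_smooth hK hx),
    sub_eq_zero] at this

theorem inv_mul (x : Coord) (hx : x ∈ U) (i k : Fin 4) :
    (G x)⁻¹ i 0 * G x 0 k + (G x)⁻¹ i 1 * G x 1 k + (G x)⁻¹ i 2 * G x 2 k + (G x)⁻¹ i 3 * G x 3 k
      = if i = k then 1 else 0 := by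
  have := congrFun (congrFun (Matrix.nonsing_inv_mul (G x) (h.det_isUnit x hx)) i) k
  rw [Matrix.mul_apply, Fin.sum_univ_four, Matrix.one_apply] at this
  exact this

theorem inv_symm (x : Coord) (i j : Fin 4) : (G x)⁻¹ i j = (G x)⁻¹ j i := by
  have h1 : (G x).transpose = G x := by ext a b; exact h.symm x b a
  have h2 := Matrix.transpose_nonsing_inv (G x)
  rw [h1] at h2
  exact congrFun (congrFun h2 j) i

section OnHypersurface

variable {x : Coord} (hx : x ∈ U) (hx1 : x 1 = 0)
include hx hx1

theorem inv_one (k : Fin 4) : (G x)⁻¹ 1 k * G x 0 1 = if k = 0 then 1 else 0 := by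
  have h0 := h.inv_mul x hx k 0
  rw [h.null x hx hx1, h.symm x 2 0, h.symm x 3 0, h.orth_two x hx hx1, h.orth_three x hx hx1,
    h.symm x 1 0] at h0
  rw [h.inv_symm]
  linarith

theorem g01_ne_zero : G x 0 1 ≠ 0 := by
  intro h0
  have := h.inv_one hx hx1 0
  simp [h0] at this

theorem inv_one_eq_zero {k : Fin 4} (hk : k ≠ 0) : (G x)⁻¹ 1 k = 0 := by
  have := h.inv_one hx hx1 k
  simp only [hk, if_false] at this
  exact (mul_eq_zero.1 this).resolve_right (h.g01_ne_zero hx hx1)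

theorem inv_eq_zero {k : Fin 4} (hk : k ≠ 0) : (G x)⁻¹ k 1 = 0 := by
  rw [h.inv_symm]; exact h.inv_one_eq_zero hx hx1 hk

theorem d_null {i : Fin 4} (hi : i ≠ 1) : partialD i (fun y => G y 0 0) x = 0 :=
  h.partialD_eq_zero (h.smooth 0 0) h.null hx hx1 hi

theorem d_orth_two {i : Fin 4} (hi : i ≠ 1) : partialD i (fun y => G y 0 2) x = 0 :=
  h.partialD_eq_zero (h.smooth 0 2) h.orth_two hx hx1 hi

theorem d_orth_three {i : Fin 4} (hi : i ≠ 1) : partialD i (fun y => G y 0 3) x = 0 :=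
  h.partialD_eq_zero (h.smooth 0 3) h.orth_three hx hx1 hi

theorem d_two_orth {i : Fin 4} (hi : i ≠ 1) : partialD i (fun y => G y 2 0) x = 0 := by
  simp only [h.symm _ 2 0]; exact h.d_orth_two hx hx1 hi

theorem d_three_orth {i : Fin 4} (hi : i ≠ 1) : partialD i (fun y => G y 3 0) x = 0 := by
  simp only [h.symm _ 3 0]; exact h.d_orth_three hx hx1 hi

theorem christoffel_one (j k : Fin 4) : christoffel G 1 j k x =
    (1 / 2) * (G x)⁻¹ 1 0 * (partialD j (fun y => G y 0 k) x + partialD k (fun y => G y 0 j) x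
      - partialD 0 (fun y => G y j k) x) := by
  unfold christoffel
  rw [Fin.sum_univ_four, h.inv_one_eq_zero hx hx1 (k := 1) (by decide),
    h.inv_one_eq_zero hx hx1 (k := 2) (by decide), h.inv_one_eq_zero hx hx1 (k := 3) (by decide)]
  ring

theorem christoffel_zero_zero (i : Fin 4) : christoffel G i 0 0 x =
    (1 / 2) * (G x)⁻¹ i 1 * (2 * partialD 0 (fun y => G y 1 0) x
      - partialD 1 (fun y => G y 0 0) x) := by
  unfold christoffel
  rw [Fin.sum_univ_four, h.d_null hx hx1 (i := 0) (by decide),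
    h.d_null hx hx1 (i := 2) (by decide), h.d_null hx hx1 (i := 3) (by decide),
    h.d_two_orth hx hx1 (i := 0) (by decide), h.d_three_orth hx hx1 (i := 0) (by decide)]
  ring

theorem christoffel_zero_zero_eq_zero {i : Fin 4} (hi : i ≠ 0) : christoffel G i 0 0 x = 0 := by
  rw [h.christoffel_zero_zero hx hx1, h.inv_eq_zero hx hx1 hi]
  ring

theorem christoffel_one_two : christoffel G 1 2 0 x = 0 := by
  rw [h.christoffel_one hx hx1, h.d_null hx hx1 (by decide), h.d_two_orth hx hx1 (by decide),
    h.d_orth_two hx hx1 (by decide)]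
  ring

theorem christoffel_one_three : christoffel G 1 3 0 x = 0 := by
  rw [h.christoffel_one hx hx1, h.d_null hx hx1 (by decide), h.d_three_orth hx hx1 (by decide),
    h.d_orth_three hx hx1 (by decide)]
  ring

theorem christoffel_one_one : christoffel G 1 1 0 x =
    (1 / 2) * (G x)⁻¹ 1 0 * partialD 1 (fun y => G y 0 0) x := by
  rw [h.christoffel_one hx hx1]
  simp only [h.symm _ 1 0]
  ring

/-- The transverse derivative of `Γ¹₀₀`, in which second derivatives of the metric enter. -/
theorem partialD_christoffel_one : partialD 1 (christoffel G 1 0 0) x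
    = partialD 0 (christoffel G 1 1 0) x - christoffel G 0 0 0 x * christoffel G 1 1 0 x
      + christoffel G 1 1 0 x ^ 2 := by
  set φ := partialD 1 (fun y => G y 0 0) x with hφ
  set b := partialD 0 (fun y => G y 1 0) x with hb
  set H := (G x)⁻¹ 1 0 with hH
  have hHa : H * G x 0 1 = 1 := by simpa using h.inv_one hx hx1 0
  have ha := h.g01_ne_zero hx hx1
  have dG : ∀ i j, DifferentiableAt ℝ (fun y => G y i j) x := fun i j =>
    h.differentiableAt_of_smooth (h.smooth i j) hx
  have dH : ∀ i j, DifferentiableAt ℝ (fun y => (G y)⁻¹ i j) x := fun i j =>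
    h.differentiableAt_of_smooth (h.inv_smooth i j) hx
  have sD : ∀ k i j, ContDiffOn ℝ ∞ (partialD k fun y => G y i j) U := fun k i j =>
    (h.smooth i j).partialD h.isOpen k
  have dD : ∀ k i j, DifferentiableAt ℝ (partialD k fun y => G y i j) x := fun k i j =>
    h.differentiableAt_of_smooth (sD k i j) hx
  -- the derivatives of the inverse metric that occur
  have hH11 : partialD 1 (fun y => (G y)⁻¹ 1 1) x * G x 0 1 + H * φ = 0 := by
    have h1 : partialD 1 (fun y => (G y)⁻¹ 1 0 * G y 0 0 + (G y)⁻¹ 1 1 * G y 1 0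
        + (G y)⁻¹ 1 2 * G y 2 0 + (G y)⁻¹ 1 3 * G y 3 0) x = 0 := by
      rw [partialD_congr (K := fun _ => 0)]
      · simp [partialD]
      · filter_upwards [h.isOpen.mem_nhds hx] with y hy
        simpa using h.inv_mul y hy 1 0
    have hm : ∀ j, DifferentiableAt ℝ (fun y => (G y)⁻¹ 1 j * G y j 0) x := fun j =>
      (dH 1 j).fun_mul (dG j 0)
    rw [partialD_add _ (((hm 0).fun_add (hm 1)).fun_add (hm 2)) (hm 3),
      partialD_add _ ((hm 0).fun_add (hm 1)) (hm 2), partialD_add _ (hm 0) (hm 1),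
      partialD_mul _ (dH 1 0) (dG 0 0), partialD_mul _ (dH 1 1) (dG 1 0),
      partialD_mul _ (dH 1 2) (dG 2 0), partialD_mul _ (dH 1 3) (dG 3 0),
      h.null x hx hx1, h.symm x 2 0, h.symm x 3 0, h.orth_two x hx hx1, h.orth_three x hx hx1,
      h.inv_one_eq_zero hx hx1 (k := 1) (by decide), h.inv_one_eq_zero hx hx1 (k := 2) (by decide),
      h.inv_one_eq_zero hx hx1 (k := 3) (by decide), h.symm x 1 0] at h1
    linarith
  have hH10 : partialD 0 (fun y => (G y)⁻¹ 1 0) x * G x 0 1 + H * b = 0 := by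
    have h1 : partialD 0 (fun y => (G y)⁻¹ 1 0 * G y 1 0) x = 0 := by
      rw [h.partialD_eq (K := fun _ => 1) ((h.inv_smooth 1 0).mul (h.smooth 1 0)) contDiffOn_const
        (fun y hy hy1 => by
          have := h.inv_one hy hy1 0
          rw [h.symm y 1 0]; simpa using this) hx hx1 (by decide)]
      simp [partialD]
    rw [partialD_mul _ (dH 1 0) (dG 1 0), h.symm x 1 0] at h1
    linarith
  have e1 : partialD 1 (christoffel G 1 0 0) x =
      (1 / 2) * (partialD 1 (fun y => (G y)⁻¹ 1 1) x * (2 * b - φ)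
        + H * partialD 1 (partialD 0 fun y => G y 0 0) x) := by
    have ht : ∀ l, DifferentiableAt ℝ (fun y => (partialD 0 (fun y => G y l 0) y
        + partialD 0 (fun y => G y l 0) y - partialD l (fun y => G y 0 0) y)) x := fun l =>
      ((dD _ _ _).fun_add (dD _ _ _)).fun_sub (dD _ _ _)
    have hm : ∀ l, DifferentiableAt ℝ (fun y => (G y)⁻¹ 1 l * (partialD 0 (fun y => G y l 0) y
        + partialD 0 (fun y => G y l 0) y - partialD l (fun y => G y 0 0) y)) x := fun l =>
      (dH 1 l).fun_mul (ht l)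
    unfold christoffel
    simp only [Fin.sum_univ_four]
    rw [partialD_mul _ (differentiableAt_const _) ((((hm 0).fun_add (hm 1)).fun_add (hm 2)).fun_add (hm 3)),
      partialD_add _ (((hm 0).fun_add (hm 1)).fun_add (hm 2)) (hm 3),
      partialD_add _ ((hm 0).fun_add (hm 1)) (hm 2), partialD_add _ (hm 0) (hm 1),
      partialD_mul _ (dH 1 0) (ht 0), partialD_mul _ (dH 1 1) (ht 1),
      partialD_mul _ (dH 1 2) (ht 2), partialD_mul _ (dH 1 3) (ht 3),
      partialD_sub _ ((dD _ _ _).fun_add (dD _ _ _)) (dD _ _ _),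
      partialD_add _ (dD _ _ _) (dD _ _ _),
      h.inv_one_eq_zero hx hx1 (k := 1) (by decide), h.inv_one_eq_zero hx hx1 (k := 2) (by decide),
      h.inv_one_eq_zero hx hx1 (k := 3) (by decide), h.d_null hx hx1 (i := 0) (by decide),
      h.d_null hx hx1 (i := 2) (by decide), h.d_null hx hx1 (i := 3) (by decide),
      h.d_two_orth hx hx1 (i := 0) (by decide), h.d_three_orth hx hx1 (i := 0) (by decide)]
    have hc : partialD 1 (fun _ : Coord => (1 / 2 : ℝ)) x = 0 := by simp [partialD]
    rw [hc]
    ring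
  have e2 : partialD 0 (christoffel G 1 1 0) x =
      (1 / 2) * (partialD 0 (fun y => (G y)⁻¹ 1 0) x * φ
        + H * partialD 0 (partialD 1 fun y => G y 0 0) x) := by
    have hm : ContDiffOn ℝ ∞ (fun y => (G y)⁻¹ 1 0 * partialD 1 (fun y => G y 0 0) y) U :=
      (h.inv_smooth 1 0).mul (sD _ _ _)
    rw [h.partialD_eq (K := fun y => (1 / 2) * ((G y)⁻¹ 1 0 * partialD 1 (fun y => G y 0 0) y))
      (h.christoffel_smooth 1 1 0) (contDiffOn_const.mul hm)
      (fun y hy hy1 => by rw [h.christoffel_one_one hy hy1]; ring) hx hx1 (by decide),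
      partialD_mul _ (differentiableAt_const _) (h.differentiableAt_of_smooth hm hx),
      partialD_mul _ (dH 1 0) (dD _ _ _)]
    have hc : partialD 0 (fun _ : Coord => (1 / 2 : ℝ)) x = 0 := by simp [partialD]
    rw [hc]
    ring
  have e3 : christoffel G 0 0 0 x = (1 / 2) * H * (2 * b - φ) := by
    rw [h.christoffel_zero_zero hx hx1, h.inv_symm x 0 1]
  have e4 : christoffel G 1 1 0 x = (1 / 2) * H * φ := h.christoffel_one_one hx hx1
  have e5 : partialD 1 (fun y => (G y)⁻¹ 1 1) x = - H ^ 2 * φ := by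
    apply mul_right_cancel₀ ha
    linear_combination hH11 + H * φ * hHa
  have e6 : partialD 0 (fun y => (G y)⁻¹ 1 0) x = - H ^ 2 * b := by
    apply mul_right_cancel₀ ha
    linear_combination hH10 + H * b * hHa
  rw [e1, e2, e3, e4, e5, e6, partialD_comm (h.smooth 0 0) h.isOpen hx 1 0]
  ring

/-- **Raychaudhuri's equation** for the generators of the null hypersurface `x¹ = 0`. -/
theorem ricci_null : ricci G 0 0 x = - partialD 0 (adaptedExpansion G) x
    + christoffel G 0 0 0 x * adaptedExpansion G x - adaptedSquare G x := by
  have dΓ : ∀ i j k, DifferentiableAt ℝ (christoffel G i j k) x := fun i j k =>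
    h.differentiableAt_of_smooth (h.christoffel_smooth i j k) hx
  have t : ∀ i, i ≠ 0 → i ≠ 1 → partialD i (christoffel G i 0 0) x = 0 := fun i h0 h1 =>
    h.partialD_eq_zero (h.christoffel_smooth i 0 0)
      (fun y hy hy1 => h.christoffel_zero_zero_eq_zero hy hy1 h0) hx hx1 h1
  unfold adaptedExpansion adaptedSquare
  rw [partialD_add _ (dΓ 2 2 0) (dΓ 3 3 0)]
  unfold ricci
  simp only [Fin.sum_univ_four]
  rw [h.partialD_christoffel_one hx hx1, t 2 (by decide) (by decide), t 3 (by decide) (by decide)]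
  simp only [christoffel_symm h.symm _ 0 1, christoffel_symm h.symm _ 0 2,
    christoffel_symm h.symm _ 0 3]
  rw [h.christoffel_zero_zero_eq_zero hx hx1 (i := 1) (by decide),
    h.christoffel_zero_zero_eq_zero hx hx1 (i := 2) (by decide),
    h.christoffel_zero_zero_eq_zero hx hx1 (i := 3) (by decide),
    h.christoffel_one_two hx hx1, h.christoffel_one_three hx hx1]
  ring

theorem christoffel_block {A B : Fin 4} (hA : A = 2 ∨ A = 3) (hB : B = 2 ∨ B = 3) :
    christoffel G A B 0 x = (1 / 2) * ((G x)⁻¹ A 2 * partialD 0 (fun y => G y 2 B) x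
      + (G x)⁻¹ A 3 * partialD 0 (fun y => G y 3 B) x) := by
  have hA0 : A ≠ 0 := by rcases hA with rfl | rfl <;> decide
  have hB1 : B ≠ 1 := by rcases hB with rfl | rfl <;> decide
  unfold christoffel
  rw [Fin.sum_univ_four, h.inv_eq_zero hx hx1 hA0, h.d_null hx hx1 hB1,
    h.d_two_orth hx hx1 hB1, h.d_three_orth hx hx1 hB1]
  have : partialD 2 (fun y => G y B 0) x = 0 ∧ partialD 3 (fun y => G y B 0) x = 0 := by
    rcases hB with rfl | rfl
    · exact ⟨h.d_two_orth hx hx1 (by decide), h.d_two_orth hx hx1 (by decide)⟩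
    · exact ⟨h.d_three_orth hx hx1 (by decide), h.d_three_orth hx hx1 (by decide)⟩
  rw [this.1, this.2]
  have h0 : (fun y => G y 0 B) = fun y => G y B 0 := funext fun y => h.symm y 0 B
  rw [h0]
  ring

theorem inv_block : (G x)⁻¹ 2 2 * crossDet G x = G x 3 3 ∧
    (G x)⁻¹ 2 3 * crossDet G x = - G x 2 3 ∧ (G x)⁻¹ 3 3 * crossDet G x = G x 2 2 := by
  have a := h.inv_mul x hx 2 2
  have b := h.inv_mul x hx 2 3
  have c := h.inv_mul x hx 3 2
  have d := h.inv_mul x hx 3 3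
  rw [h.inv_eq_zero hx hx1 (by decide)] at a b c d
  simp only [h.orth_two x hx hx1, h.orth_three x hx hx1, h.symm x 3 2, h.inv_symm x 3 2] at a b c d
  simp only [if_true, show (2 : Fin 4) ≠ 3 by decide, show (3 : Fin 4) ≠ 2 by decide,
    if_false] at a b c d
  unfold crossDet
  rw [h.symm x 3 2]
  refine ⟨?_, ?_, ?_⟩
  · linear_combination G x 3 3 * a - G x 2 3 * b
  · linear_combination G x 2 2 * b - G x 2 3 * a
  · linear_combination G x 2 2 * d - G x 2 3 * c

theorem crossDet_mul_adaptedExpansion :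
    2 * crossDet G x * adaptedExpansion G x = partialD 0 (crossDet G) x := by
  obtain ⟨a, b, c⟩ := h.inv_block hx hx1
  have dG : ∀ i j, DifferentiableAt ℝ (fun y => G y i j) x := fun i j =>
    h.differentiableAt_of_smooth (h.smooth i j) hx
  have e : partialD 0 (crossDet G) x = G x 2 2 * partialD 0 (fun y => G y 3 3) x
      + partialD 0 (fun y => G y 2 2) x * G x 3 3
      - 2 * G x 2 3 * partialD 0 (fun y => G y 2 3) x := by
    unfold crossDet
    rw [partialD_sub _ ((dG 2 2).fun_mul (dG 3 3)) ((dG 2 3).fun_mul (dG 3 2)),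
      partialD_mul _ (dG 2 2) (dG 3 3), partialD_mul _ (dG 2 3) (dG 3 2)]
    simp only [h.symm _ 3 2]
    ring
  rw [e, adaptedExpansion, h.christoffel_block hx hx1 (by simp) (by simp),
    h.christoffel_block hx hx1 (by simp) (by simp)]
  simp only [h.symm _ 3 2, h.inv_symm _ 3 2]
  linear_combination partialD 0 (fun y => G y 2 2) x * a
    + 2 * partialD 0 (fun y => G y 2 3) x * b + partialD 0 (fun y => G y 3 3) x * c

/-- With `p` the inverse of a definite block and `m = ∂g/∂x⁰`, the quantity `4 * adaptedSquare`
is `tr (p m p m)`, a sum of squares. -/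
theorem adaptedSquare_eq (hd : (G x)⁻¹ 2 2 ≠ 0) :
    4 * adaptedSquare G x =
      ((G x)⁻¹ 2 2 * (partialD 0 (fun y => G y 2 2) x
        + 2 * ((G x)⁻¹ 2 3 / (G x)⁻¹ 2 2) * partialD 0 (fun y => G y 2 3) x
        + ((G x)⁻¹ 2 3 / (G x)⁻¹ 2 2) ^ 2 * partialD 0 (fun y => G y 3 3) x)) ^ 2
      + 2 * ((G x)⁻¹ 2 2 * (G x)⁻¹ 3 3 - (G x)⁻¹ 2 3 ^ 2) * (partialD 0 (fun y => G y 2 3) x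
        + ((G x)⁻¹ 2 3 / (G x)⁻¹ 2 2) * partialD 0 (fun y => G y 3 3) x) ^ 2
      + (((G x)⁻¹ 2 2 * (G x)⁻¹ 3 3 - (G x)⁻¹ 2 3 ^ 2) / (G x)⁻¹ 2 2
        * partialD 0 (fun y => G y 3 3) x) ^ 2 := by
  rw [adaptedSquare, h.christoffel_block hx hx1 (by simp) (by simp),
    h.christoffel_block hx hx1 (by simp) (by simp), h.christoffel_block hx hx1 (by simp) (by simp),
    h.christoffel_block hx hx1 (by simp) (by simp)]
  simp only [h.symm _ 3 2, h.inv_symm _ 3 2]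
  field_simp
  ring

theorem inv_block_pos (hdet : 0 < crossDet G x) :
    (G x)⁻¹ 2 2 ≠ 0 ∧ 0 < (G x)⁻¹ 2 2 * (G x)⁻¹ 3 3 - (G x)⁻¹ 2 3 ^ 2 := by
  obtain ⟨a, b, c⟩ := h.inv_block hx hx1
  have hD : crossDet G x = G x 2 2 * G x 3 3 - G x 2 3 ^ 2 := by
    rw [crossDet, h.symm x 3 2]; ring
  have h1 : ((G x)⁻¹ 2 2 * (G x)⁻¹ 3 3 - (G x)⁻¹ 2 3 ^ 2) * crossDet G x ^ 2 = crossDet G x := by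
    have : ((G x)⁻¹ 2 2 * (G x)⁻¹ 3 3 - (G x)⁻¹ 2 3 ^ 2) * crossDet G x ^ 2 =
      ((G x)⁻¹ 2 2 * crossDet G x) * ((G x)⁻¹ 3 3 * crossDet G x)
        - ((G x)⁻¹ 2 3 * crossDet G x) ^ 2 := by ring
    rw [this, a, b, c, hD]; ring
  have h2 : 0 < (G x)⁻¹ 2 2 * (G x)⁻¹ 3 3 - (G x)⁻¹ 2 3 ^ 2 := by
    by_contra hn
    push Not at hn
    have := mul_nonpos_of_nonpos_of_nonneg hn (sq_nonneg (crossDet G x))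
    linarith
  refine ⟨fun h0 => ?_, h2⟩
  rw [h0] at h2
  nlinarith [sq_nonneg ((G x)⁻¹ 2 3)]

theorem adaptedSquare_nonneg (hdet : 0 < crossDet G x) : 0 ≤ adaptedSquare G x := by
  obtain ⟨h1, h2⟩ := h.inv_block_pos hx hx1 hdet
  have := h.adaptedSquare_eq hx hx1 h1
  have h3 : 0 ≤ 4 * adaptedSquare G x := by rw [this]; positivity
  linarith

theorem partialD_eq_zero_of_adaptedSquare (hdet : 0 < crossDet G x)
    (h0 : adaptedSquare G x ≤ 0) {A B : Fin 4} (hA : A = 2 ∨ A = 3) (hB : B = 2 ∨ B = 3) :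
    partialD 0 (fun y => G y A B) x = 0 := by
  obtain ⟨h1, h2⟩ := h.inv_block_pos hx hx1 hdet
  have e := h.adaptedSquare_eq hx hx1 h1
  set p := (G x)⁻¹ 2 2
  set c := (G x)⁻¹ 2 3 / p
  set d := p * (G x)⁻¹ 3 3 - (G x)⁻¹ 2 3 ^ 2
  set m := partialD 0 (fun y => G y 2 2) x
  set n := partialD 0 (fun y => G y 2 3) x
  set k := partialD 0 (fun y => G y 3 3) x
  have s1 := sq_nonneg (p * (m + 2 * c * n + c ^ 2 * k))
  have s2 : 0 ≤ 2 * d * (n + c * k) ^ 2 := by positivity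
  have s3 := sq_nonneg (d / p * k)
  have z3 : (d / p * k) ^ 2 = 0 := by linarith
  have z2 : 2 * d * (n + c * k) ^ 2 = 0 := by linarith
  have z1 : (p * (m + 2 * c * n + c ^ 2 * k)) ^ 2 = 0 := by linarith
  have k0 : k = 0 := by
    have := pow_eq_zero_iff (two_ne_zero) |>.1 z3
    exact (mul_eq_zero.1 this).resolve_left (div_ne_zero h2.ne' h1)
  have n0 : n = 0 := by
    have := (mul_eq_zero.1 z2).resolve_left (by positivity)
    have := pow_eq_zero_iff (two_ne_zero) |>.1 this
    rw [k0] at this; linarith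
  have m0 : m = 0 := by
    have := pow_eq_zero_iff (two_ne_zero) |>.1 z1
    have := (mul_eq_zero.1 this).resolve_left h1
    rw [k0, n0] at this; linarith
  rcases hA with rfl | rfl <;> rcases hB with rfl | rfl
  · exact m0
  · exact n0
  · simp only [h.symm _ 3 2]; exact n0
  · exact k0

end OnHypersurface

end IsNullAdapted

/-! ### Flow boxes of the null generators -/

section FlowBoxes

variable {M : Type*} [TopologicalSpace M] [ChartedSpace Coord M]

/-- A chart adapted to the null hypersurface `N`: in its domain `N` is the coordinate hyperplane
`x¹ = 0`, and on `N` the coordinate vector `∂/∂x⁰` is null and orthogonal to `N`, so that the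
`x⁰`-lines in `N` are the null generators. -/
structure IsFlowBox (S : Spacetime M) (N : Set M) (E : OpenPartialHomeomorph M Coord) : Prop where
  smooth : IsSmoothChart E
  mem_iff : ∀ q ∈ E.source, q ∈ N ↔ E q 1 = 0
  adapted : IsNullAdapted (bilinComp E S.g) E.target

/-- For a smooth chart in which `N` is a coordinate hyperplane, only the orthogonality of `∂/∂x⁰`
to `N` has to be checked. -/
theorem IsFlowBox.of_orthogonal {S : Spacetime M} {N : Set M} {E : OpenPartialHomeomorph M Coord}
    (smooth : IsSmoothChart E) (mem_iff : ∀ q ∈ E.source, q ∈ N ↔ E q 1 = 0)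
    (h : ∀ x ∈ E.target, x 1 = 0 → bilinComp E S.g x 0 0 = 0 ∧ bilinComp E S.g x 0 2 = 0 ∧
      bilinComp E S.g x 0 3 = 0) : IsFlowBox S N E where
  smooth := smooth
  mem_iff := mem_iff
  adapted :=
    { isOpen := E.open_target
      smooth := fun i j => S.g_smooth E smooth i j
      symm := fun x i j => bilinComp_symm S E x i j
      det_isUnit := fun _ hx => isUnit_det_bilinComp S smooth hx
      null := fun x hx hx1 => (h x hx hx1).1
      orth_two := fun x hx hx1 => (h x hx hx1).2.1
      orth_three := fun x hx hx1 => (h x hx hx1).2.2 }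

namespace IsFlowBox

variable {S : Spacetime M} {N : Set M} {E : OpenPartialHomeomorph M Coord} (h : IsFlowBox S N E)
include h

section

variable {x : Coord} (hx : x ∈ E.target)
include hx

theorem symm_mem_iff : E.symm x ∈ N ↔ x 1 = 0 := by
  rw [h.mem_iff _ (E.map_target hx), E.right_inv hx]

variable (hx1 : x 1 = 0)
include hx1

theorem bil_coordVec_zero (v : Coord) :
    bil (bilinComp E S.g x) (coordVec 0) v = bilinComp E S.g x 0 1 * v 1 := by
  simp [bil, Fin.sum_univ_four, h.adapted.null x hx hx1, h.adapted.orth_two x hx hx1,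
    h.adapted.orth_three x hx hx1]

/-- Tangent vectors of `N` are spacelike unless they are tangent to a generator. -/
theorem bil_neg {v : Coord} (hv1 : v 1 = 0) (hv : v 2 ≠ 0 ∨ v 3 ≠ 0) :
    bil (bilinComp E S.g x) v v < 0 := by
  have hL : ∀ (c : ℝ) (w : Coord), chartVec E x (c • w) = c • chartVec E x w := by
    intro c w
    exact map_smul (mfderiv (𝓡 4) (𝓡 4) E.symm x) c w
  rw [bil_bilinComp]
  refine S.neg_of_orthogonal_null _ (chartVec E x (coordVec 0)) _ ?_ ?_ ?_ ?_
  · intro h0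
    have h1 := vecComp_chartVec h.smooth hx (coordVec 0)
    rw [h0, vecComp] at h1
    have h2 : (0 : Coord) = coordVec 0 :=
      (map_zero (mfderiv (𝓡 4) (𝓡 4) E (E.symm x))).symm.trans h1
    have h3 := congrArg (fun w : Coord => w 0) h2
    simp at h3
  · rw [← bil_bilinComp, h.bil_coordVec_zero hx hx1]
    simp
  · rw [← bil_bilinComp, h.bil_coordVec_zero hx hx1, hv1, mul_zero]
  · intro c hc
    rw [← hL] at hc
    have h1 := congrArg (vecComp E (E.symm x)) hc
    rw [vecComp_chartVec h.smooth hx, vecComp_chartVec h.smooth hx] at h1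
    rw [h1] at hv
    simp at hv

theorem crossDet_pos : 0 < crossDet (bilinComp E S.g) x := by
  set G := bilinComp E S.g x with hG
  have hs := bilinComp_symm S E x
  have key : ∀ a b : ℝ, a ≠ 0 ∨ b ≠ 0 →
      a ^ 2 * G 2 2 + 2 * (a * b) * G 2 3 + b ^ 2 * G 3 3 < 0 := by
    intro a b hab
    have := h.bil_neg hx hx1 (v := a • coordVec 2 + b • coordVec 3) (by simp) (by simpa using hab)
    simp only [bil, Fin.sum_univ_four] at this
    simp at this
    rw [hs 3 2] at this
    linarith
  have h1 := key 1 0 (by simp)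
  have h2 : G 2 2 < 0 := by linarith
  have h3 := key (- G 2 3) (G 2 2) (Or.inr h2.ne)
  have h4 : G 2 2 * (G 2 2 * G 3 3 - G 2 3 * G 2 3) < 0 := by nlinarith
  have h5 := pos_of_mul_neg_right h4 h2.le
  simp only [crossDet]
  rw [hs 3 2]
  exact h5

theorem eq_of_null {v : Coord} (hv1 : v 1 = 0) (hv : bil (bilinComp E S.g x) v v = 0) :
    v 2 = 0 ∧ v 3 = 0 := by
  by_contra hc
  have := h.bil_neg hx hx1 hv1 (by tauto)
  exact this.ne hv

/-- The null convergence condition in a flow box. -/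
theorem ricci_nonneg {T : BilinField M} (hEinstein : S.EinsteinEquation T)
    (hDEC : S.DominantEnergyCondition T) : 0 ≤ ricci (bilinComp E S.g) 0 0 x := by
  have h1 := hEinstein E h.smooth x hx 0 0
  rw [einstein, h.adapted.null x hx hx1] at h1
  have h2 : S.g (E.symm x) (chartVec E x (coordVec 0)) (chartVec E x (coordVec 0)) = 0 :=
    h.adapted.null x hx hx1
  have h3 : 0 ≤ bilinComp E T x 0 0 := hDEC.nonneg_null _ _ h2
  have h4 : 0 ≤ 8 * Real.pi * bilinComp E T x 0 0 := by positivity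
  linarith

theorem partialD_expansion_le {T : BilinField M} (hEinstein : S.EinsteinEquation T)
    (hDEC : S.DominantEnergyCondition T) :
    partialD 0 (adaptedExpansion (bilinComp E S.g)) x ≤
      christoffel (bilinComp E S.g) 0 0 0 x * adaptedExpansion (bilinComp E S.g) x
        - adaptedSquare (bilinComp E S.g) x := by
  have h1 := h.adapted.ricci_null hx hx1
  have h2 := h.ricci_nonneg hx hx1 hEinstein hDEC
  linarith

end

end IsFlowBox

/-! ### Slice charts -/

omit [ChartedSpace Coord M] in
/-- A change of charts in which `N` is a coordinate hyperplane preserves tangency to `N`. -/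
theorem fderiv_transition_apply_eq_zero {N : Set M} {e e' : OpenPartialHomeomorph M Coord}
    {i j : Fin 4} (he : ∀ q ∈ e.source, q ∈ N ↔ e q i = 0) (he' : ∀ q ∈ e'.source, q ∈ N ↔ e' q j = 0)
    {p : M} (hp : p ∈ e.source) (hp' : p ∈ e'.source) (hpN : p ∈ N)
    (hd : DifferentiableAt ℝ (e' ∘ e.symm) (e p)) {v : Coord} (hv : v i = 0) :
    fderiv ℝ (e' ∘ e.symm) (e p) v j = 0 := by
  have h1 : HasDerivAt (fun t : ℝ => (e' ∘ e.symm) (e p + t • v))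
      (fderiv ℝ (e' ∘ e.symm) (e p) v) 0 := by
    have h1 : HasDerivAt (fun t : ℝ => e p + t • v) v 0 := by
      simpa using ((hasDerivAt_id (0 : ℝ)).smul_const v).const_add (e p)
    have h2 : HasFDerivAt (e' ∘ e.symm) (fderiv ℝ (e' ∘ e.symm) (e p)) (e p + (0 : ℝ) • v) := by
      simpa using hd.hasFDerivAt
    exact h2.comp_hasDerivAt (0 : ℝ) h1
  have h2 : HasDerivAt (fun t : ℝ => (e' ∘ e.symm) (e p + t • v) j)
      (fderiv ℝ (e' ∘ e.symm) (e p) v j) 0 :=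
    (EuclideanSpace.proj (𝕜 := ℝ) j).hasFDerivAt.comp_hasDerivAt (0 : ℝ) h1
  have h3 : (fun t : ℝ => (e' ∘ e.symm) (e p + t • v) j) =ᶠ[𝓝 0] fun _ => 0 := by
    have : ∀ᶠ t : ℝ in 𝓝 0, e p + t • v ∈ e.target ∩ e.symm ⁻¹' e'.source :=
      (continuous_line (e p) v).continuousAt.eventually_mem
        ((isOpen_transition e e').mem_nhds
          (by simpa [e.left_inv hp] using ⟨e.map_source hp, hp'⟩))
    filter_upwards [this] with t ht
    have hq := e.map_target ht.1
    refine (he' _ ht.2).1 ((he _ hq).2 ?_)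
    rw [e.right_inv ht.1]
    have := (he p hp).1 hpN
    simp [hv, this]
  exact h2.unique ((hasDerivAt_const (0 : ℝ) (0 : ℝ)).congr_of_eventuallyEq h3)

theorem vecComp_eq_zero_of_isTangentTo {N : Set M} {e : OpenPartialHomeomorph M Coord}
    (hes : IsSmoothChart e) {i : Fin 4} (he : ∀ q ∈ e.source, q ∈ N ↔ e q i = 0) {p : M}
    (hp : p ∈ e.source) (hpN : p ∈ N) {X : TangentSpace (𝓡 4) p} (hX : IsTangentTo N p X) :
    vecComp e p X i = 0 := by
  obtain ⟨e', he', hp', hX'⟩ := hX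
  rw [vecComp_transition he'.1 hes hp' hp X]
  exact fderiv_transition_apply_eq_zero he'.2 he hp' hp hpN
    (differentiableAt_transition he'.1 hes hp' hp) hX'

end FlowBoxes

/-! ### Existence of flow boxes -/

section FlowBoxExistence

/-- A smooth vector field `W` on `ℝ⁴` with vanishing `x⁰`-component can be straightened near any
point `a` at which it does not vanish, by a local diffeomorphism `Ψ` for which `x⁰ ∘ Ψ = a⁰ + z¹`:
the integral curves of `W` become the `z⁰`-lines. -/
theorem exists_straightening (W : Coord → Coord) (hW : ContDiff ℝ ∞ W) (hW0 : ∀ x, W x 0 = 0)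
    (a : Coord) (ha : W a ≠ 0) (V : Set Coord) (hV : IsOpen V) (haV : a ∈ V) :
    ∃ R : OpenPartialHomeomorph Coord Coord, 0 ∈ R.source ∧ R 0 = a ∧
      ContDiffOn ℝ ∞ R R.source ∧ ContDiffOn ℝ ∞ R.symm R.target ∧ R.target ⊆ V ∧
      (∀ z ∈ R.source, R z 0 = a 0 + z 1) ∧
      ∀ z ∈ R.source, fderiv ℝ R z (coordVec 0) = W (R z) := by
  obtain ⟨i, hi⟩ : ∃ i, W a i ≠ 0 := by
    by_contra hc
    push Not at hc
    exact ha (by ext i; simpa using hc i)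
  have hi0 : i ≠ 0 := fun h => hi (h ▸ hW0 a)
  obtain ⟨σ, hσ0, hσ1⟩ : ∃ σ : Equiv.Perm (Fin 4), σ 0 = i ∧ σ 1 = 0 := by
    revert hi0; clear hi; revert i; decide
  -- the hyperplane spanned by the coordinate directions other than the `i`-th one
  let J : Coord →L[ℝ] Coord := ∑ m : Fin 3,
    (EuclideanSpace.proj (𝕜 := ℝ) (m.succ : Fin 4)).smulRight (coordVec (σ m.succ))
  have hJ : ∀ z k, J z (σ k) = if k = 0 then 0 else z k := by
    intro z k
    have : ∀ m : Fin 3, coordVec (σ m.succ) (σ k) = if k = m.succ then 1 else 0 := by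
      intro m; simp [coordVec_apply]
    simp only [J, sum_apply, ContinuousLinearMap.smulRight_apply, smul_eq_mul, this,
      WithLp.ofLp_sum, Finset.sum_apply, WithLp.ofLp_smul, Pi.smul_apply]
    refine Fin.cases ?_ (fun k => ?_) k
    · simp [(Fin.succ_ne_zero _).symm]
    · simp
  have hJ0 : ∀ z, J z 0 = z 1 := by
    intro z
    have := hJ z 1
    rw [hσ1] at this
    simpa using this
  have hJe : J (coordVec 0) = 0 := by
    ext l
    obtain ⟨k, rfl⟩ := σ.surjective l
    rw [hJ]
    by_cases hk : k = 0 <;> simp [hk]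
  obtain ⟨Φ, δ, hδ, hΦs, hΦ0, hΦd⟩ := exists_smooth_flow W hW a
  set Ψ : Coord → Coord := fun z => Φ (z 0, a + J z) with hΨ
  set D := Ioo (-δ) δ ×ˢ Metric.ball a δ with hD
  have hDo : IsOpen D := isOpen_Ioo.prod Metric.isOpen_ball
  let A : Coord → ℝ × Coord := fun z => (z 0, a + J z)
  have hA : ContDiff ℝ ∞ A := by
    refine ContDiff.prodMk ?_ (contDiff_const.add J.contDiff)
    exact (EuclideanSpace.proj (𝕜 := ℝ) (0 : Fin 4)).contDiff
  have hA0 : A 0 = (0, a) := by simp [A]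
  have h0D : ((0, a) : ℝ × Coord) ∈ D := ⟨by simpa using hδ, Metric.mem_ball_self hδ⟩
  have hΨs : ContDiffOn ℝ ∞ Ψ (A ⁻¹' D) := hΦs.comp hA.contDiffOn fun z hz => hz
  have hUo : IsOpen (A ⁻¹' D ∩ Ψ ⁻¹' V) :=
    hΨs.continuousOn.isOpen_inter_preimage (hDo.preimage hA.continuous) hV
  have hΨ0 : Ψ 0 = a := by
    have := hΦ0 a (Metric.mem_ball_self hδ)
    simpa [hΨ] using this
  have h0U : (0 : Coord) ∈ A ⁻¹' D ∩ Ψ ⁻¹' V :=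
    ⟨by rw [mem_preimage, hA0]; exact h0D, by rw [mem_preimage, hΨ0]; exact haV⟩
  -- derivative along the flow direction
  have hflow : ∀ z ∈ A ⁻¹' D, fderiv ℝ Ψ z (coordVec 0) = W (Ψ z) := by
    intro z hz
    have hd : DifferentiableAt ℝ Ψ z :=
      (hΨs.contDiffAt ((hDo.preimage hA.continuous).mem_nhds hz)).differentiableAt (by simp)
    have h1 : HasDerivAt (fun t : ℝ => z + t • coordVec 0) (coordVec 0) 0 := by
      simpa using ((hasDerivAt_id (0 : ℝ)).smul_const (coordVec 0)).const_add z
    have h2 : HasFDerivAt Ψ (fderiv ℝ Ψ z) (z + (0 : ℝ) • coordVec 0) := by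
      simpa using hd.hasFDerivAt
    have h3 := h2.comp_hasDerivAt (0 : ℝ) h1
    have h4 : (Ψ ∘ fun t : ℝ => z + t • coordVec 0) = fun t => Φ (z 0 + t, a + J z) := by
      funext t
      simp [hΨ, hJe]
    rw [h4] at h3
    have h5 : HasDerivAt (fun s => Φ (s, a + J z)) (W (Φ (z 0, a + J z))) (z 0 + 0) := by
      rw [add_zero]; exact hΦd _ hz.1 _ hz.2
    exact h3.unique (h5.comp_const_add (z 0) 0)
  -- the `x⁰`-component is preserved by the flow
  have hfirst : ∀ z ∈ A ⁻¹' D, Ψ z 0 = a 0 + z 1 := by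
    intro z hz
    have hder : ∀ t ∈ Ioo (-δ) δ, HasDerivAt (fun s => Φ (s, a + J z) 0) 0 t := by
      intro t ht
      have := (EuclideanSpace.proj (𝕜 := ℝ) (0 : Fin 4)).hasFDerivAt.comp_hasDerivAt t
        (hΦd t ht _ hz.2)
      have h2 : EuclideanSpace.proj (𝕜 := ℝ) (0 : Fin 4) (W (Φ (t, a + J z))) = 0 := hW0 _
      rw [h2] at this
      exact this
    have hconst := isOpen_Ioo.is_const_of_deriv_eq_zero (𝕜 := ℝ) isPreconnected_Ioo
      (fun t ht => (hder t ht).differentiableAt.differentiableWithinAt)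
      (fun t ht => (hder t ht).deriv) hz.1 (⟨by simpa using hδ, hδ⟩ : (0 : ℝ) ∈ Ioo (-δ) δ)
    rw [hΦ0 _ hz.2] at hconst
    have : Ψ z 0 = (a + J z) 0 := hconst
    rw [this]
    simp [hJ0]
  -- the derivative at the origin
  have hdΦ : HasFDerivAt Φ (fderiv ℝ Φ (0, a)) (0, a) :=
    ((hΦs.contDiffAt (hDo.mem_nhds h0D)).differentiableAt (by simp)).hasFDerivAt
  have hdA : HasFDerivAt A ((EuclideanSpace.proj (𝕜 := ℝ) (0 : Fin 4)).prod J) 0 := by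
    refine HasFDerivAt.prodMk (EuclideanSpace.proj (𝕜 := ℝ) (0 : Fin 4)).hasFDerivAt ?_
    exact J.hasFDerivAt.const_add a
  have hdΨ : HasFDerivAt Ψ
      ((fderiv ℝ Φ (0, a)).comp ((EuclideanSpace.proj (𝕜 := ℝ) (0 : Fin 4)).prod J)) 0 := by
    have h1 : HasFDerivAt Φ (fderiv ℝ Φ (0, a)) (A 0) := by rw [hA0]; exact hdΦ
    exact h1.comp (0 : Coord) hdA
  have hspace : ∀ w, fderiv ℝ Φ (0, a) (0, w) = w := by
    intro w
    have h1 : HasFDerivAt (fun x : Coord => ((0 : ℝ), x)) (ContinuousLinearMap.inr ℝ ℝ Coord) a :=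
      (hasFDerivAt_const (0 : ℝ) a).prodMk (hasFDerivAt_id a)
    have h2 : HasFDerivAt (Φ ∘ fun x : Coord => ((0 : ℝ), x))
        ((fderiv ℝ Φ (0, a)).comp (ContinuousLinearMap.inr ℝ ℝ Coord)) a :=
      HasFDerivAt.comp a hdΦ h1
    have h3 : (Φ ∘ fun x : Coord => ((0 : ℝ), x)) =ᶠ[𝓝 a] id := by
      filter_upwards [Metric.ball_mem_nhds a hδ] with x hx
      exact hΦ0 x hx
    have h4 := h2.unique ((hasFDerivAt_id a).congr_of_eventuallyEq h3)
    exact congrArg (fun L : Coord →L[ℝ] Coord => L w) h4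
  set L := (fderiv ℝ Φ (0, a)).comp ((EuclideanSpace.proj (𝕜 := ℝ) (0 : Fin 4)).prod J) with hL
  have hLe : L (coordVec 0) = W a := by
    rw [← hdΨ.fderiv, hflow 0 h0U.1, hΨ0]
  have hLz : ∀ z, L z = z 0 • W a + J z := by
    intro z
    have h1 : L z = fderiv ℝ Φ (0, a) (z 0, J z) := rfl
    have h2 : ((z 0, J z) : ℝ × Coord) = z 0 • ((1 : ℝ), (0 : Coord)) + (0, J z) := by simp
    have h3 : L (coordVec 0) = fderiv ℝ Φ (0, a) (1, 0) := by
      have : L (coordVec 0) = fderiv ℝ Φ (0, a) (coordVec 0 0, J (coordVec 0)) := rfl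
      rw [this, hJe]; simp
    rw [h1, h2, map_add, map_smul, hspace, ← h3, hLe]
  have hinj : Function.Injective L := by
    rw [injective_iff_map_eq_zero]
    intro z hz
    rw [hLz] at hz
    have hc : ∀ k, z 0 * W a (σ k) + J z (σ k) = 0 := by
      intro k
      have := congrArg (fun w : Coord => w (σ k)) hz
      simpa using this
    have hz0 : z 0 = 0 := by
      have := hc 0
      rw [hJ, hσ0] at this
      simpa [hi] using this
    ext k
    by_cases hk : k = 0
    · rw [hk]; exact hz0
    · have := hc k
      rw [hJ, hz0] at this
      simpa [hk] using this
  let L' : Coord ≃L[ℝ] Coord :=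
    (LinearEquiv.ofInjectiveEndo (L : Coord →ₗ[ℝ] Coord) hinj).toContinuousLinearEquiv
  have hL' : (L' : Coord →L[ℝ] Coord) = L := by ext z; rfl
  obtain ⟨R, hR, hRU, h0R, hRs⟩ := exists_local_inverse hUo (hΨs.mono inter_subset_left) h0U L'
    (by rw [hL']; exact hdΨ)
  refine ⟨R, h0R, by rw [hR, hΨ0], ?_, hRs, ?_, ?_, ?_⟩
  · rw [hR]; exact hΨs.mono (hRU.trans inter_subset_left)
  · intro y hy
    have := (hRU (R.map_target hy)).2
    rw [mem_preimage, ← hR, R.right_inv hy] at this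
    exact this
  · intro z hz
    rw [hR]; exact hfirst z (hRU hz).1
  · intro z hz
    rw [hR]; exact hflow z (hRU hz).1

variable {M : Type*} [TopologicalSpace M] [ChartedSpace Coord M] [IsManifold (𝓡 4) ∞ M]

/-- Composition of a chart with the inverse of a local diffeomorphism of `ℝ⁴`. -/
theorem IsSmoothChart.trans_symm {e : OpenPartialHomeomorph M Coord} (he : IsSmoothChart e)
    {R : OpenPartialHomeomorph Coord Coord} (hR : ContDiffOn ℝ ∞ R R.source)
    (hR' : ContDiffOn ℝ ∞ R.symm R.target) : IsSmoothChart (e ≫ₕ R.symm) := by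
  refine OpenPartialHomeomorph.mem_maximalAtlas_of_contMDiffOn _ ?_ ?_
  · have h1 : ContMDiffOn (𝓡 4) (𝓡 4) ∞ R.symm R.target := hR'.contMDiffOn
    have h2 := h1.comp' (contMDiffOn_of_mem_maximalAtlas he)
    refine h2.mono ?_
    rw [OpenPartialHomeomorph.trans_source]
    exact subset_rfl
  · have h1 : ContMDiffOn (𝓡 4) (𝓡 4) ∞ R R.source := hR.contMDiffOn
    have h2 := (contMDiffOn_symm_of_mem_maximalAtlas he).comp' h1
    refine h2.mono ?_
    rw [OpenPartialHomeomorph.trans_target]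
    exact subset_rfl

omit [IsManifold (𝓡 4) ∞ M] in
/-- In a slice chart the conormal `dx⁰` of a null hypersurface is null: `g^{00} = 0`. Equivalently,
the raised conormal `g^{i0}` is tangent to `N`. -/
theorem inv_zero_zero_eq_zero {S : Spacetime M} {N : Set M} (hN : S.IsNullHypersurface N)
    {e : OpenPartialHomeomorph M Coord} (he : IsSliceChart N e) {x : Coord} (hx : x ∈ e.target)
    (hx0 : x 0 = 0) : (bilinComp e S.g x)⁻¹ 0 0 = 0 := by
  have hp := e.map_target hx
  have hpN : e.symm x ∈ N := (he.2 _ hp).2 (by rw [e.right_inv hx, hx0])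
  obtain ⟨k, hk, hkt, hort⟩ := hN.2 _ hpN
  set v := vecComp e (e.symm x) k with hv
  have hv0 : v 0 = 0 := vecComp_eq_zero_of_isTangentTo he.1 he.2 hp hpN hkt
  have hvne : v ≠ 0 := fun h => hk (vecComp_injective he.1 hp h)
  set G := bilinComp e S.g x with hG
  have hGv : ∀ w : Coord, w 0 = 0 → bil G v w = 0 := by
    intro w hw
    have h1 := hort (chartVec e x w) ⟨e, he, hp, by rw [vecComp_chartVec he.1 hx]; exact hw⟩
    rwa [bilinField_eq_bil he.1 S.g hp, vecComp_chartVec he.1 hx, e.right_inv hx] at h1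
  have hGvi : ∀ i, i ≠ 0 → (G.mulVec v) i = 0 := by
    intro i hi
    have h1 := hGv (coordVec i) (by simp [hi.symm])
    rw [hG, bil_symm] at h1
    simpa [bil, Matrix.mulVec, dotProduct] using h1
  have hdet : IsUnit G.det := isUnit_det_bilinComp S he.1 hx
  have hvi : ∀ i, v i = G⁻¹ i 0 * (G.mulVec v) 0 := by
    intro i
    have h1 : G⁻¹.mulVec (G.mulVec v) = v := by
      rw [Matrix.mulVec_mulVec, Matrix.nonsing_inv_mul _ hdet, Matrix.one_mulVec]
    have h2 := congrFun h1 i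
    rw [Matrix.mulVec, dotProduct, Fin.sum_univ_four, hGvi 1 (by decide), hGvi 2 (by decide),
      hGvi 3 (by decide)] at h2
    rw [← h2]; ring
  have hc : (G.mulVec v) 0 ≠ 0 := by
    intro h0
    apply hvne
    ext i
    rw [hvi i, h0, mul_zero]; rfl
  have := hvi 0
  rw [hv0] at this
  exact (mul_eq_zero.1 this.symm).resolve_right hc

/-- Flow boxes exist: straighten a vector field that equals the raised conormal on `N`, inside
the leaves `x⁰ = const` of a slice chart. -/
theorem exists_isFlowBox {S : Spacetime M} {N : Set M} (hN : S.IsNullHypersurface N) {p : M}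
    (hp : p ∈ N) : ∃ E : OpenPartialHomeomorph M Coord, IsFlowBox S N E ∧ p ∈ E.source := by
  obtain ⟨e, he, hpe⟩ := hN.1 p hp
  have hx := e.map_source hpe
  have hx0 : e p 0 = 0 := (he.2 p hpe).1 hp
  set G := bilinComp e S.g with hG
  have hHs : ∀ i j, ContDiffOn ℝ ∞ (fun x => (G x)⁻¹ i j) e.target := fun i j =>
    contDiffOn_matrix_inv (S.g_smooth e he.1) (fun x hx => isUnit_det_bilinComp S he.1 hx) i j
  -- the raised conormal of `N`, without its component transverse to `N`
  set K : Coord → Coord := fun x =>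
    WithLp.toLp 2 fun i => if i = 0 then 0 else (G x)⁻¹ i 0 with hK
  have hKs : ContDiffOn ℝ ∞ K e.target := by
    rw [contDiffOn_euclidean]
    intro i
    by_cases hi : i = 0
    · simpa [hK, hi] using contDiffOn_const
    · simpa [hK, hi] using hHs i 0
  have hKN : ∀ x ∈ e.target, x 0 = 0 → ∀ i, K x i = (G x)⁻¹ i 0 := by
    intro x hx hx0 i
    by_cases hi : i = 0
    · rw [hi, inv_zero_zero_eq_zero hN he hx hx0]; simp [hK]
    · simp [hK, hi]
  have hbilK : ∀ x ∈ e.target, x 0 = 0 → ∀ w, bil (G x) (K x) w = w 0 := by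
    intro x hx hx0 w
    have hdet : IsUnit (G x).det := isUnit_det_bilinComp S he.1 hx
    have h1 : ∀ j, ∑ i, G x i j * (G x)⁻¹ i 0 = if j = 0 then 1 else 0 := by
      intro j
      have := congrFun (congrFun (Matrix.mul_nonsing_inv (G x) hdet) j) 0
      rw [Matrix.mul_apply, Matrix.one_apply] at this
      rw [← this]
      exact Finset.sum_congr rfl fun i _ => by rw [hG, bilinComp_symm]
    unfold bil
    rw [Finset.sum_comm]
    simp only [hKN x hx hx0, ← Finset.sum_mul, h1]
    simp
  obtain ⟨ρ, hρ, hρU⟩ := Metric.isOpen_iff.1 e.open_target _ hx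
  -- cut off, to get a vector field on all of `ℝ⁴`
  let χ : ContDiffBump (e p) := ⟨ρ / 3, ρ / 2, by positivity, by linarith⟩
  set W : Coord → Coord := fun x => χ x • K x with hWdef
  have hW : ContDiff ℝ ∞ W := by
    rw [contDiff_iff_contDiffAt]
    intro x
    by_cases hxs : x ∈ tsupport χ
    · have hxU : x ∈ e.target := by
        apply hρU
        rw [χ.tsupport_eq] at hxs
        exact Metric.closedBall_subset_ball (by simp only [χ]; linarith) hxs
      exact χ.contDiff.contDiffAt.smul (hKs.contDiffAt (e.open_target.mem_nhds hxU))
    · have hev : W =ᶠ[𝓝 x] fun _ => 0 := by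
        filter_upwards [notMem_tsupport_iff_eventuallyEq.1 hxs] with y hy
        simp [hWdef, hy]
      exact contDiffAt_const.congr_of_eventuallyEq hev
  have hWK : ∀ x ∈ Metric.ball (e p) (ρ / 3), W x = K x := by
    intro x hx
    have : χ x = 1 := χ.one_of_mem_closedBall (Metric.ball_subset_closedBall hx)
    simp [hWdef, this]
  have hW0 : ∀ x, W x 0 = 0 := by intro x; simp [hWdef, hK]
  have hpb : e p ∈ Metric.ball (e p) (ρ / 3) := Metric.mem_ball_self (by positivity)
  have hWp : W (e p) ≠ 0 := by
    rw [hWK _ hpb]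
    intro h0
    have := hbilK (e p) hx hx0 (coordVec 0)
    rw [h0] at this
    simp [bil] at this
  obtain ⟨R, h0R, hR0, hRs, hRs', hRV, hRfst, hRflow⟩ := exists_straightening W hW hW0 (e p) hWp
    (Metric.ball (e p) (ρ / 3)) Metric.isOpen_ball hpb
  have hE : IsSmoothChart (e ≫ₕ R.symm) := he.1.trans_symm hRs hRs'
  refine ⟨e ≫ₕ R.symm, IsFlowBox.of_orthogonal hE ?_ ?_, ?_⟩
  · intro q hq
    rw [OpenPartialHomeomorph.trans_source] at hq
    have h1 := hRfst _ (R.map_target hq.2)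
    rw [R.right_inv hq.2, hx0, zero_add] at h1
    rw [he.2 q hq.1, h1]
    rfl
  · intro z hz hz1
    have hz' : z ∈ R.source ∧ R z ∈ e.target := by
      rw [OpenPartialHomeomorph.trans_target] at hz; exact hz
    have hsy : (e ≫ₕ R.symm).symm z = e.symm (R z) := rfl
    have hT : e ∘ (e ≫ₕ R.symm).symm =ᶠ[𝓝 z] R := by
      filter_upwards [(e ≫ₕ R.symm).open_target.mem_nhds hz] with y hy
      rw [OpenPartialHomeomorph.trans_target] at hy
      exact e.right_inv hy.2
    have hy0 : R z 0 = 0 := by rw [hRfst z hz'.1, hx0, hz1, add_zero]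
    have hW1 : W (R z) = K (R z) := hWK _ (hRV (R.map_source hz'.1))
    have hmain : ∀ j, bilinComp (e ≫ₕ R.symm) S.g z 0 j = if j = 1 then 1 else 0 := by
      intro j
      rw [← bil_coordVec (bilinComp (e ≫ₕ R.symm) S.g z) 0 j, bil_transition hE he.1 S.g hz
        (by rw [hsy]; exact e.map_target hz'.2), hT.fderiv_eq, hsy, e.right_inv hz'.2,
        hRflow z hz'.1, hW1, hbilK _ hz'.2 hy0]
      have hd : DifferentiableAt ℝ R z :=
        (hRs.contDiffAt (R.open_source.mem_nhds hz'.1)).differentiableAt (by simp)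
      have h1 : HasFDerivAt (fun y => R y 0)
          ((EuclideanSpace.proj (𝕜 := ℝ) (0 : Fin 4)).comp (fderiv ℝ R z)) z :=
        (EuclideanSpace.proj (𝕜 := ℝ) (0 : Fin 4)).hasFDerivAt.comp z hd.hasFDerivAt
      have h2 : HasFDerivAt (fun y : Coord => e p 0 + y 1)
          (EuclideanSpace.proj (𝕜 := ℝ) (1 : Fin 4)) z :=
        (EuclideanSpace.proj (𝕜 := ℝ) (1 : Fin 4)).hasFDerivAt.const_add _
      have h3 : (fun y => R y 0) =ᶠ[𝓝 z] fun y : Coord => e p 0 + y 1 := by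
        filter_upwards [R.open_source.mem_nhds hz'.1] with y hy
        exact hRfst y hy
      have h4 := h1.unique (h2.congr_of_eventuallyEq h3)
      have h5 := congrArg (fun L : Coord →L[ℝ] ℝ => L (coordVec j)) h4
      have h6 : fderiv ℝ R z (coordVec j) 0 = coordVec j 1 := h5
      rw [h6]
      simp [eq_comm]
    simp [hmain]
  · rw [OpenPartialHomeomorph.trans_source]
    refine ⟨hpe, ?_⟩
    have := R.map_source h0R
    rwa [hR0] at this

end FlowBoxExistence

/-! ### Closed generators in flow boxes -/

/-- The transverse coordinates `(x², x³)`. -/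
noncomputable def cross : Coord →L[ℝ] (Fin 2 → ℝ) :=
  ContinuousLinearMap.pi fun A => EuclideanSpace.proj (𝕜 := ℝ) (Fin.natAdd 2 A : Fin 4)

/-- The vector with transverse components `y` and vanishing components `x⁰`, `x¹`. -/
noncomputable def crossEmb : (Fin 2 → ℝ) →L[ℝ] Coord :=
  ∑ A : Fin 2, (ContinuousLinearMap.proj (R := ℝ) (φ := fun _ : Fin 2 => ℝ) A).smulRight
    (coordVec (Fin.natAdd 2 A))

/-- The point with coordinates `(u, 0, y)` of the hypersurface `x¹ = 0`. -/
noncomputable def onN (u : ℝ) (y : Fin 2 → ℝ) : Coord := u • coordVec 0 + crossEmb y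

@[simp] theorem cross_zero (x : Coord) : cross x 0 = x 2 := rfl
@[simp] theorem cross_one (x : Coord) : cross x 1 = x 3 := rfl

theorem crossEmb_apply (y : Fin 2 → ℝ) (i : Fin 4) :
    crossEmb y i = (![0, 0, y 0, y 1] : Fin 4 → ℝ) i := by
  have h0 : (Fin.natAdd 2 (0 : Fin 2) : Fin 4) = 2 := rfl
  have h1 : (Fin.natAdd 2 (1 : Fin 2) : Fin 4) = 3 := rfl
  simp only [crossEmb, Fin.sum_univ_two, h0, h1, add_apply,
    ContinuousLinearMap.smulRight_apply, ContinuousLinearMap.proj_apply, PiLp.add_apply,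
    PiLp.smul_apply, coordVec_apply, smul_eq_mul]
  fin_cases i <;> simp

@[simp] theorem crossEmb_apply_zero (y : Fin 2 → ℝ) : crossEmb y 0 = 0 := crossEmb_apply y 0
@[simp] theorem crossEmb_apply_one (y : Fin 2 → ℝ) : crossEmb y 1 = 0 := crossEmb_apply y 1
@[simp] theorem crossEmb_apply_two (y : Fin 2 → ℝ) : crossEmb y 2 = y 0 := crossEmb_apply y 2
@[simp] theorem crossEmb_apply_three (y : Fin 2 → ℝ) : crossEmb y 3 = y 1 := crossEmb_apply y 3

@[simp] theorem onN_zero (u : ℝ) (y : Fin 2 → ℝ) : onN u y 0 = u := by simp [onN]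
@[simp] theorem onN_one (u : ℝ) (y : Fin 2 → ℝ) : onN u y 1 = 0 := by simp [onN]
@[simp] theorem onN_two (u : ℝ) (y : Fin 2 → ℝ) : onN u y 2 = y 0 := by simp [onN]
@[simp] theorem onN_three (u : ℝ) (y : Fin 2 → ℝ) : onN u y 3 = y 1 := by simp [onN]

@[simp] theorem cross_onN (u : ℝ) (y : Fin 2 → ℝ) : cross (onN u y) = y := by
  ext A; fin_cases A <;> simp

theorem onN_cross {x : Coord} (hx : x 1 = 0) : onN (x 0) (cross x) = x := by
  ext i; fin_cases i <;> simp [hx]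

theorem continuous_onN : Continuous fun p : ℝ × (Fin 2 → ℝ) => onN p.1 p.2 := by
  unfold onN; fun_prop

theorem onN_add (u t : ℝ) (y : Fin 2 → ℝ) : onN (u + t) y = onN u y + t • coordVec 0 := by
  simp only [onN, add_smul]; abel

section ClosedGenerators

variable {M : Type*} [TopologicalSpace M] [ChartedSpace Coord M]

namespace Spacetime.IsClosedNullGenerator

variable {S : Spacetime M} {N : Set M} {γ : ℝ → M} (hγ : S.IsClosedNullGenerator N γ)
include hγ

theorem continuous : Continuous γ := hγ.1.continuous

theorem isCompact_range : IsCompact (range γ) := by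
  obtain ⟨P, hP, hper⟩ := hγ.2.1
  have hp : Function.Periodic γ P := hper
  rw [← hp.image_Icc hP 0]
  exact isCompact_Icc.image hγ.continuous

/-- Shift of the parameter of a closed generator. -/
theorem comp_add (a : ℝ) : S.IsClosedNullGenerator N fun s => γ (s + a) := by
  obtain ⟨P, hP, hper⟩ := hγ.2.1
  have hcomp : ∀ s, (velocity (fun s => γ (s + a)) s : Coord) = (velocity γ (s + a) : Coord) := by
    intro s
    have h1 : MDifferentiableAt 𝓘(ℝ, ℝ) (𝓡 4) γ (s + a) :=
      (hγ.1 (s + a)).mdifferentiableAt (by simp)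
    have h2 : HasMFDerivAt 𝓘(ℝ, ℝ) 𝓘(ℝ, ℝ) (fun s : ℝ => s + a) s (ContinuousLinearMap.id ℝ ℝ) :=
      ((hasFDerivAt_id s).add_const a).hasMFDerivAt
    have h3 := (h1.hasMFDerivAt.comp s h2).mfderiv
    have h4 : (mfderiv 𝓘(ℝ, ℝ) (𝓡 4) (fun s => γ (s + a)) s : ℝ →L[ℝ] Coord) =
        mfderiv 𝓘(ℝ, ℝ) (𝓡 4) γ (s + a) := h3
    exact congrArg (fun L : ℝ →L[ℝ] Coord => L 1) h4
  refine ⟨hγ.1.comp (contDiff_id.add contDiff_const).contMDiff, ⟨P, hP, fun s => ?_⟩,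
    fun s => hγ.2.2.1 _, fun s => ?_, fun s => ?_⟩
  · simp only [add_right_comm s P a]
    exact hper _
  · have h := hγ.2.2.2.1 (s + a)
    have e : velocity (fun s => γ (s + a)) s = velocity γ (s + a) := hcomp s
    exact e ▸ h
  · obtain ⟨c, hc⟩ := hγ.2.2.2.2 (s + a)
    refine ⟨c, fun e he hs i => ?_⟩
    have h1 : ∀ j, (deriv fun t => e (γ (t + a)) j) = fun t => deriv (fun t => e (γ t) j) (t + a) :=
      fun j => funext fun t => deriv_comp_add_const (f := fun t => e (γ t) j) a t
    have h2 := hc e he hs i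
    simp only [h1]
    rw [deriv_comp_add_const (f := deriv fun t => e (γ t) i)]
    exact h2

section InFlowBox

variable {E : OpenPartialHomeomorph M Coord} (h : IsFlowBox S N E)
include h

omit h in
theorem isOpen_preimage_source : IsOpen (γ ⁻¹' E.source) :=
  E.open_source.preimage hγ.continuous

theorem contDiffOn_coord : ContDiffOn ℝ ∞ (fun t => E (γ t)) (γ ⁻¹' E.source) := by
  rw [← contMDiffOn_iff_contDiffOn]
  exact (contMDiffOn_of_mem_maximalAtlas h.smooth).comp hγ.1.contMDiffOn fun t ht => ht

theorem contDiffOn_coord_zero : ContDiffOn ℝ ∞ (fun t => E (γ t) 0) (γ ⁻¹' E.source) :=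
  (EuclideanSpace.proj (𝕜 := ℝ) (0 : Fin 4)).contDiff.comp_contDiffOn (hγ.contDiffOn_coord h)

variable {s : ℝ} (hs : γ s ∈ E.source)
include hs

theorem coord_one : E (γ s) 1 = 0 := (h.mem_iff _ hs).1 (hγ.2.2.1 s)

/-- In a flow box a closed generator moves along the `x⁰`-lines, at nonzero speed. -/
theorem hasDerivAt_coord : ∃ c : ℝ, c ≠ 0 ∧ HasDerivAt (fun t => E (γ t)) (c • coordVec 0) s := by
  have hd : DifferentiableAt ℝ (fun t => E (γ t)) s :=
    ((hγ.contDiffOn_coord h).contDiffAt ((hγ.isOpen_preimage_source).mem_nhds hs)).differentiableAt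
      (by simp)
  obtain ⟨hk, -, hkk⟩ := hγ.2.2.2.1 s
  set v := vecComp E (γ s) (velocity γ s) with hv
  have hder : HasDerivAt (fun t => E (γ t)) v s := by
    have h1 := mfderiv_comp s (h.smooth.mdifferentiable.mdifferentiableAt hs)
      ((hγ.1 s).mdifferentiableAt (by simp))
    have h2 : mfderiv 𝓘(ℝ, ℝ) (𝓡 4) (E ∘ γ) s = fderiv ℝ (fun t => E (γ t)) s := mfderiv_eq_fderiv
    have h3 : (fderiv ℝ (fun t => E (γ t)) s) 1 = v :=
      congrArg (fun L : ℝ →L[ℝ] Coord => L 1) (h2.symm.trans h1)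
    have h4 := hd.hasDerivAt
    rwa [← fderiv_apply_one_eq_deriv, h3] at h4
  have hv1 : v 1 = 0 := by
    have h1 : HasDerivAt (fun t => E (γ t) 1) (v 1) s :=
      (EuclideanSpace.proj (𝕜 := ℝ) (1 : Fin 4)).hasFDerivAt.comp_hasDerivAt s hder
    have h2 : (fun t => E (γ t) 1) =ᶠ[𝓝 s] fun _ => 0 := by
      filter_upwards [hγ.isOpen_preimage_source.mem_nhds hs] with t ht
      exact hγ.coord_one h ht
    exact h1.unique ((hasDerivAt_const s (0 : ℝ)).congr_of_eventuallyEq h2)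
  have hvv : bil (bilinComp E S.g (E (γ s))) v v = 0 := by
    rw [hv, ← bilinField_eq_bil h.smooth S.g hs]; exact hkk
  obtain ⟨hv2, hv3⟩ := h.eq_of_null (E.map_source hs) (hγ.coord_one h hs) hv1 hvv
  have hve : v = v 0 • coordVec 0 := by
    ext i; fin_cases i <;> simp [hv1, hv2, hv3]
  refine ⟨v 0, fun h0 => ?_, hve ▸ hder⟩
  rw [h0, zero_smul] at hve
  exact hk (vecComp_injective h.smooth hs hve)

theorem deriv_coord_ne_zero : deriv (fun t => E (γ t) 0) s ≠ 0 ∧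
    HasDerivAt (fun t => E (γ t)) (deriv (fun t => E (γ t) 0) s • coordVec 0) s := by
  obtain ⟨c, hc, hder⟩ := hγ.hasDerivAt_coord h hs
  have h1 : HasDerivAt (fun t => E (γ t) 0) ((c • coordVec 0 : Coord) 0) s :=
    (EuclideanSpace.proj (𝕜 := ℝ) (0 : Fin 4)).hasFDerivAt.comp_hasDerivAt s hder
  have h2 : deriv (fun t => E (γ t) 0) s = c := by rw [h1.deriv]; simp
  rw [h2]
  exact ⟨hc, hder⟩

/-- In a flow box the transverse coordinates of a closed generator are locally constant. -/
theorem eventually_coord_eq : ∀ᶠ t in 𝓝 s, γ t ∈ E.source ∧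
    E (γ t) = onN (E (γ t) 0) (cross (E (γ s))) := by
  obtain ⟨ε, hε, hball⟩ := Metric.isOpen_iff.1 hγ.isOpen_preimage_source s hs
  have hcross : ∀ t ∈ Metric.ball s ε, HasDerivAt (fun t => cross (E (γ t))) 0 t := by
    intro t ht
    obtain ⟨c, -, hder⟩ := hγ.hasDerivAt_coord h (hball ht)
    have h1 : HasDerivAt (fun t => cross (E (γ t))) (cross (c • coordVec 0)) t :=
      cross.hasFDerivAt.comp_hasDerivAt t hder
    have h2 : cross (c • coordVec 0) = 0 := by
      ext A; fin_cases A <;> simp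
    rwa [h2] at h1
  filter_upwards [Metric.ball_mem_nhds s hε] with t ht
  have hconst := Metric.isOpen_ball.is_const_of_deriv_eq_zero (𝕜 := ℝ)
    (convex_ball s ε).isPreconnected
    (fun t ht => (hcross t ht).differentiableAt.differentiableWithinAt)
    (fun t ht => (hcross t ht).deriv) ht (Metric.mem_ball_self hε)
  refine ⟨hball ht, ?_⟩
  rw [← hconst, onN_cross (hγ.coord_one h (hball ht))]

theorem map_nhds_coord_zero : Filter.map (fun t => E (γ t) 0) (𝓝 s) = 𝓝 (E (γ s) 0) := by
  have h1 : ContDiffAt ℝ ∞ (fun t => E (γ t) 0) s :=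
    (hγ.contDiffOn_coord_zero h).contDiffAt (hγ.isOpen_preimage_source.mem_nhds hs)
  exact (h1.hasStrictDerivAt (by simp)).map_nhds_eq (hγ.deriv_coord_ne_zero h hs).1

end InFlowBox

end Spacetime.IsClosedNullGenerator

/-- `A` is saturated: with a point of `N` it contains every generator segment through this point
that lies in a flow box. -/
def IsSaturated (S : Spacetime M) (N A : Set M) : Prop :=
  ∀ E : OpenPartialHomeomorph M Coord, IsFlowBox S N E → ∀ (u₁ u₂ : ℝ) (y : Fin 2 → ℝ),
    (∀ u ∈ uIcc u₁ u₂, onN u y ∈ E.target) → E.symm (onN u₁ y) ∈ A → E.symm (onN u₂ y) ∈ A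

/-- A closed generator contains every generator segment that it meets, since along such a segment
the set of its points is open and closed. -/
theorem Spacetime.IsClosedNullGenerator.isSaturated_range [T2Space M] {S : Spacetime M} {N : Set M}
    {γ : ℝ → M} (hγ : S.IsClosedNullGenerator N γ) : IsSaturated S N (range γ) := by
  intro E h u₁ u₂ y hseg h₁
  have hcont : ContinuousOn (fun u => E.symm (onN u y)) (uIcc u₁ u₂) :=
    E.continuousOn_symm.comp (by unfold onN; fun_prop) hseg
  refine isPreconnected_uIcc.induction₂'
    (fun u v => E.symm (onN u y) ∈ range γ → E.symm (onN v y) ∈ range γ) ?_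
    (fun u v w _ _ _ huv hvw hu => hvw (huv hu)) left_mem_uIcc right_mem_uIcc h₁
  intro u hu
  by_cases hA : E.symm (onN u y) ∈ range γ
  · obtain ⟨s, hs⟩ := hA
    have hsrc : γ s ∈ E.source := by rw [hs]; exact E.map_target (hseg u hu)
    have hEs : E (γ s) = onN u y := by rw [hs, E.right_inv (hseg u hu)]
    have h1 := hγ.eventually_coord_eq h hsrc
    have h2 : ∀ᶠ v in 𝓝 u, E.symm (onN v y) ∈ range γ := by
      have h3 := hγ.map_nhds_coord_zero h hsrc
      rw [hEs, onN_zero] at h3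
      rw [← h3, Filter.eventually_map]
      filter_upwards [h1] with t ht
      rw [hEs, cross_onN] at ht
      rw [← ht.2, E.left_inv ht.1]
      exact mem_range_self t
    filter_upwards [nhdsWithin_le_nhds h2] with v hv
    exact ⟨fun _ => hv, fun _ => hs ▸ mem_range_self s⟩
  · have h1 : ∀ᶠ v in 𝓝[uIcc u₁ u₂] u, E.symm (onN v y) ∉ range γ :=
      (hcont u hu).eventually_mem
        (hγ.isCompact_range.isClosed.isOpen_compl.mem_nhds hA)
    filter_upwards [h1] with v hv
    exact ⟨fun h => absurd h hA, fun h => absurd h hv⟩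

/-- Sliding along a generator inside a ball of a flow box. -/
theorem IsSaturated.slide {S : Spacetime M} {N A : Set M} (hA : IsSaturated S N A)
    {E : OpenPartialHomeomorph M Coord} (h : IsFlowBox S N E) {x : Coord} {r : ℝ}
    (hball : Metric.ball x r ⊆ E.target) {u₁ u₂ : ℝ} {y : Fin 2 → ℝ}
    (h₁ : onN u₁ y ∈ Metric.ball x r) (h₂ : onN u₂ y ∈ Metric.ball x r)
    (hmem : E.symm (onN u₁ y) ∈ A) : E.symm (onN u₂ y) ∈ A := by
  refine hA E h u₁ u₂ y (fun u hu => hball ?_) hmem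
  rw [← segment_eq_uIcc] at hu
  obtain ⟨a, b, ha, hb, hab, rfl⟩ := hu
  have : onN (a • u₁ + b • u₂) y = a • onN u₁ y + b • onN u₂ y := by
    have hy : crossEmb y = a • crossEmb y + b • crossEmb y := by
      rw [← add_smul, hab, one_smul]
    simp only [onN, smul_eq_mul, smul_add, smul_smul, add_smul]
    conv_lhs => rw [hy]
    abel
  rw [this]
  exact (convex_ball x r) h₁ h₂ ha hb hab

end ClosedGenerators

/-! ### Transitions between flow boxes -/

section TransitionsAndExpansion

variable {M : Type*} [TopologicalSpace M] [ChartedSpace Coord M]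

theorem bil_tangent {G : Matrix (Fin 4) (Fin 4) ℝ} (h00 : G 0 0 = 0) (h02 : G 0 2 = 0)
    (h03 : G 0 3 = 0) (hsymm : ∀ i j, G i j = G j i) {v w : Coord} (hv : v 1 = 0) (hw : w 1 = 0) :
    bil G v w = G 2 2 * v 2 * w 2 + G 2 3 * v 2 * w 3 + G 3 2 * v 3 * w 2 + G 3 3 * v 3 * w 3 := by
  simp only [bil, Fin.sum_univ_four, hsymm 2 0, hsymm 3 0, h00, h02, h03, hv, hw]
  ring

/-- The transverse part of the derivative of a transition map `T`. -/
noncomputable def crossDeriv (T : Coord → Coord) (x : Coord) : (Fin 2 → ℝ) →L[ℝ] (Fin 2 → ℝ) :=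
  (cross.comp (fderiv ℝ T x)).comp crossEmb

theorem det_fin_two_pi (L : (Fin 2 → ℝ) →L[ℝ] (Fin 2 → ℝ)) :
    L.det = L (Pi.single 0 1) 0 * L (Pi.single 1 1) 1 - L (Pi.single 1 1) 0 * L (Pi.single 0 1) 1 := by
  rw [ContinuousLinearMap.det, ← LinearMap.det_toMatrix', Matrix.det_fin_two]
  simp [LinearMap.toMatrix'_apply]

section Transition

variable {S : Spacetime M} {N : Set M} {E E' : OpenPartialHomeomorph M Coord}
  (h : IsFlowBox S N E) (h' : IsFlowBox S N E') {x : Coord} (hx : x ∈ E.target)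
  (hx' : E.symm x ∈ E'.source) (hx1 : x 1 = 0)
include h h' hx hx' hx1

theorem transition_one : E' (E.symm x) 1 = 0 :=
  (h'.mem_iff _ hx').1 ((h.symm_mem_iff hx).2 hx1)

theorem fderiv_transition_one {v : Coord} (hv : v 1 = 0) :
    fderiv ℝ (E' ∘ E.symm) x v 1 = 0 := by
  have hp := E.map_target hx
  have h1 := fderiv_transition_apply_eq_zero h.mem_iff h'.mem_iff hp hx'
    ((h.symm_mem_iff hx).2 hx1) (differentiableAt_transition h.smooth h'.smooth hp hx') hv
  rwa [E.right_inv hx] at h1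

/-- Changes of flow boxes preserve the direction of the generators, the only null direction
tangent to `N`. -/
theorem cross_fderiv_transition : cross (fderiv ℝ (E' ∘ E.symm) x (coordVec 0)) = 0 := by
  have h1 := bil_transition h.smooth h'.smooth S.g hx hx' (coordVec 0) (coordVec 0)
  rw [h.bil_coordVec_zero hx hx1] at h1
  have h2 := h'.eq_of_null (E'.map_source hx') (transition_one h h' hx hx' hx1)
    (fderiv_transition_one h h' hx hx' hx1 (v := coordVec 0) (by simp)) (by rw [← h1]; simp)
  ext A; fin_cases A
  · exact h2.1
  · exact h2.2

/-- The determinants of the transverse metrics of two flow boxes differ by the square of the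
Jacobian of the transverse transition map. -/
theorem crossDet_transition : crossDet (bilinComp E S.g) x =
    (crossDeriv (E' ∘ E.symm) x).det ^ 2 * crossDet (bilinComp E' S.g) (E' (E.symm x)) := by
  set G := bilinComp E S.g x with hG
  set G' := bilinComp E' S.g (E' (E.symm x)) with hG'
  set L := fderiv ℝ (E' ∘ E.symm) x with hL
  have hy := E'.map_source hx'
  have hy1 := transition_one h h' hx hx' hx1
  have hs' : ∀ i j, G' i j = G' j i := bilinComp_symm S E' _
  have key : ∀ a b : Fin 2 → ℝ, bil G (crossEmb a) (crossEmb b) =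
      bil G' (L (crossEmb a)) (L (crossEmb b)) := fun a b =>
    bil_transition h.smooth h'.smooth S.g hx hx' _ _
  have h1 : ∀ a : Fin 2 → ℝ, L (crossEmb a) 1 = 0 := fun a =>
    fderiv_transition_one h h' hx hx' hx1 (by simp)
  have key2 : ∀ a b : Fin 2 → ℝ, G 2 2 * a 0 * b 0 + G 2 3 * a 0 * b 1 + G 3 2 * a 1 * b 0
      + G 3 3 * a 1 * b 1 = G' 2 2 * L (crossEmb a) 2 * L (crossEmb b) 2
        + G' 2 3 * L (crossEmb a) 2 * L (crossEmb b) 3 + G' 3 2 * L (crossEmb a) 3 * L (crossEmb b) 2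
        + G' 3 3 * L (crossEmb a) 3 * L (crossEmb b) 3 := by
    intro a b
    have := key a b
    rw [bil_tangent (h.adapted.null x hx hx1) (h.adapted.orth_two x hx hx1)
      (h.adapted.orth_three x hx hx1) (bilinComp_symm S E x) (by simp) (by simp),
      bil_tangent (h'.adapted.null _ hy hy1) (h'.adapted.orth_two _ hy hy1)
      (h'.adapted.orth_three _ hy hy1) hs' (h1 a) (h1 b)] at this
    simpa using this
  have k00 := key2 (Pi.single 0 1) (Pi.single 0 1)
  have k01 := key2 (Pi.single 0 1) (Pi.single 1 1)
  have k10 := key2 (Pi.single 1 1) (Pi.single 0 1)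
  have k11 := key2 (Pi.single 1 1) (Pi.single 1 1)
  simp only [Pi.single_eq_same, Pi.single_eq_of_ne (show (1 : Fin 2) ≠ 0 by decide),
    Pi.single_eq_of_ne (show (0 : Fin 2) ≠ 1 by decide), mul_one, mul_zero, add_zero,
    zero_add] at k00 k01 k10 k11
  rw [det_fin_two_pi]
  have c : ∀ a : Fin 2 → ℝ, crossDeriv (E' ∘ E.symm) x a 0 = L (crossEmb a) 2 ∧
      crossDeriv (E' ∘ E.symm) x a 1 = L (crossEmb a) 3 := fun a => ⟨rfl, rfl⟩
  rw [(c _).1, (c _).2, (c _).1, (c _).2]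
  simp only [crossDet, ← hG, ← hG', k00, k01, k10, k11]
  ring

/-- The transverse transition map does not depend on the coordinate along the generators. -/
theorem eventually_cross_transition : ∀ᶠ p : ℝ × (Fin 2 → ℝ) in 𝓝 (0, 0),
    cross (E' (E.symm (x + p.1 • coordVec 0 + crossEmb p.2))) =
      cross (E' (E.symm (x + crossEmb p.2))) := by
  have hO := isOpen_transition E E'
  have hcont : Continuous fun p : ℝ × (Fin 2 → ℝ) => x + p.1 • coordVec 0 + crossEmb p.2 := by
    fun_prop
  have hpre : ∀ᶠ p : ℝ × (Fin 2 → ℝ) in 𝓝 (0, 0),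
      x + p.1 • coordVec 0 + crossEmb p.2 ∈ E.target ∩ E.symm ⁻¹' E'.source :=
    hcont.continuousAt.eventually_mem (hO.mem_nhds (by simpa using ⟨hx, hx'⟩))
  obtain ⟨δ, hδ, hδball⟩ := Metric.eventually_nhds_iff_ball.1 hpre
  filter_upwards [Metric.ball_mem_nhds _ hδ] with p hp
  have hp1 : p.1 ∈ Metric.ball (0 : ℝ) δ := by
    rw [Metric.mem_ball, Prod.dist_eq, max_lt_iff] at hp; exact hp.1
  have hp2 : p.2 ∈ Metric.ball (0 : Fin 2 → ℝ) δ := by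
    rw [Metric.mem_ball, Prod.dist_eq, max_lt_iff] at hp; exact hp.2
  have hin : ∀ t ∈ Metric.ball (0 : ℝ) δ, x + t • coordVec 0 + crossEmb p.2 ∈
      E.target ∩ E.symm ⁻¹' E'.source := by
    intro t ht
    have hmem : (t, p.2) ∈ Metric.ball ((0 : ℝ), (0 : Fin 2 → ℝ)) δ := by
      rw [Metric.mem_ball, Prod.dist_eq, max_lt_iff]
      exact ⟨ht, hp2⟩
    exact hδball (t, p.2) hmem
  have hder : ∀ t ∈ Metric.ball (0 : ℝ) δ, HasDerivAt
      (fun t : ℝ => cross ((E' ∘ E.symm) (x + t • coordVec 0 + crossEmb p.2))) 0 t := by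
    intro t ht
    obtain ⟨ht1, ht2⟩ := hin t ht
    set z := x + t • coordVec 0 + crossEmb p.2 with hz
    have hd := differentiableAt_transition h.smooth h'.smooth (E.map_target ht1) ht2
    rw [E.right_inv ht1] at hd
    have h1 : HasDerivAt (fun t : ℝ => x + t • coordVec 0 + crossEmb p.2) (coordVec 0) t := by
      simpa using (((hasDerivAt_id t).smul_const (coordVec 0)).const_add x).add_const (crossEmb p.2)
    have h2 := cross.hasFDerivAt.comp_hasDerivAt t (hd.hasFDerivAt.comp_hasDerivAt t h1)
    rw [cross_fderiv_transition h h' ht1 ht2 (by simp [hz, hx1])] at h2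
    exact h2
  have := Metric.isOpen_ball.is_const_of_deriv_eq_zero (𝕜 := ℝ)
    (convex_ball (0 : ℝ) δ).isPreconnected
    (fun t ht => (hder t ht).differentiableAt.differentiableWithinAt)
    (fun t ht => (hder t ht).deriv) hp1 (Metric.mem_ball_self hδ)
  simpa using this

omit hx1 in
theorem hasFDerivAt_cross_transition : HasFDerivAt
    (fun a : Fin 2 → ℝ => cross (E' (E.symm (x + crossEmb a)))) (crossDeriv (E' ∘ E.symm) x) 0 := by
  have hd := differentiableAt_transition h.smooth h'.smooth (E.map_target hx) hx'
  rw [E.right_inv hx] at hd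
  have h1 : HasFDerivAt (fun a : Fin 2 → ℝ => x + crossEmb a) crossEmb 0 :=
    crossEmb.hasFDerivAt.const_add x
  have h2 : HasFDerivAt (E' ∘ E.symm) (fderiv ℝ (E' ∘ E.symm) x) (x + crossEmb 0) := by
    simpa using hd.hasFDerivAt
  exact cross.hasFDerivAt.comp (0 : Fin 2 → ℝ) (h2.comp (0 : Fin 2 → ℝ) h1)

theorem eventually_crossDeriv_eq : ∀ᶠ t : ℝ in 𝓝 0,
    crossDeriv (E' ∘ E.symm) (x + t • coordVec 0) = crossDeriv (E' ∘ E.symm) x := by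
  have hO : ∀ᶠ t : ℝ in 𝓝 0, x + t • coordVec 0 ∈ E.target ∩ E.symm ⁻¹' E'.source :=
    (continuous_line x (coordVec 0)).continuousAt.eventually_mem
      ((isOpen_transition E E').mem_nhds (by simpa using ⟨hx, hx'⟩))
  have hev := eventually_cross_transition h h' hx hx' hx1
  rw [nhds_prod_eq] at hev
  filter_upwards [hO, hev.curry] with t ht hta
  have h1 := hasFDerivAt_cross_transition h h' ht.1 ht.2
  exact h1.unique ((hasFDerivAt_cross_transition h h' hx hx').congr_of_eventuallyEq hta)

end Transition

/-! ### The expansion along a closed generator -/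

section Expansion

variable {S : Spacetime M} {N : Set M} {γ : ℝ → M}

/-- The expansion of a generator with respect to its own parameter, computed in a flow box. -/
noncomputable def expansionRate (S : Spacetime M) (E : OpenPartialHomeomorph M Coord) (γ : ℝ → M)
    (s : ℝ) : ℝ :=
  adaptedExpansion (bilinComp E S.g) (E (γ s)) * deriv (fun t => E (γ t) 0) s

theorem hasDerivAt_along (hγ : S.IsClosedNullGenerator N γ) {E : OpenPartialHomeomorph M Coord}
    (h : IsFlowBox S N E) {s : ℝ} (hs : γ s ∈ E.source) {F : Coord → ℝ}
    (hF : DifferentiableAt ℝ F (E (γ s))) :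
    HasDerivAt (fun t => F (E (γ t))) (partialD 0 F (E (γ s)) * deriv (fun t => E (γ t) 0) s) s := by
  have h1 := hF.hasFDerivAt.comp_hasDerivAt s (hγ.deriv_coord_ne_zero h hs).2
  rw [map_smul, smul_eq_mul, mul_comm] at h1
  exact h1

/-- The expansion is the logarithmic growth rate of the area of the cross sections, which is the
square root of `crossDet`. -/
theorem hasDerivAt_log_crossDet (hγ : S.IsClosedNullGenerator N γ)
    {E : OpenPartialHomeomorph M Coord} (h : IsFlowBox S N E) {s : ℝ} (hs : γ s ∈ E.source) :
    HasDerivAt (fun t => Real.log (crossDet (bilinComp E S.g) (E (γ t))))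
      (2 * expansionRate S E γ s) s := by
  have hx := E.map_source hs
  have hx1 := hγ.coord_one h hs
  have hpos := h.crossDet_pos hx hx1
  have h1 := (hasDerivAt_along hγ h hs
    (h.adapted.differentiableAt_of_smooth h.adapted.crossDet_smooth hx)).log hpos.ne'
  have h2 := h.adapted.crossDet_mul_adaptedExpansion hx hx1
  convert h1 using 1
  rw [← h2, expansionRate]
  field_simp

/-- The expansion does not depend on the flow box: the area densities of two flow boxes have a
constant ratio along a generator. -/
theorem expansionRate_eq (hγ : S.IsClosedNullGenerator N γ)
    {E E' : OpenPartialHomeomorph M Coord} (h : IsFlowBox S N E) (h' : IsFlowBox S N E') {s : ℝ}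
    (hs : γ s ∈ E.source) (hs' : γ s ∈ E'.source) :
    expansionRate S E γ s = expansionRate S E' γ s := by
  have hx := E.map_source hs
  have hx1 := hγ.coord_one h hs
  have hsy : E.symm (E (γ s)) ∈ E'.source := by rwa [E.left_inv hs]
  set c := (crossDeriv (E' ∘ E.symm) (E (γ s))).det ^ 2 with hc
  have hcne : c ≠ 0 := by
    intro h0
    have h1 := crossDet_transition h h' hx hsy hx1
    rw [← hc, h0, zero_mul] at h1
    exact (h.crossDet_pos hx hx1).ne' h1
  have hev : (fun t => Real.log (crossDet (bilinComp E S.g) (E (γ t)))) =ᶠ[𝓝 s]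
      fun t => Real.log c + Real.log (crossDet (bilinComp E' S.g) (E' (γ t))) := by
    have hcont : ContinuousAt (fun t => E (γ t) 0 - E (γ s) 0) s :=
      ((hγ.contDiffOn_coord_zero h).continuousOn.continuousAt
        (hγ.isOpen_preimage_source.mem_nhds hs)).sub continuousAt_const
    have hten : Filter.Tendsto (fun t => E (γ t) 0 - E (γ s) 0) (𝓝 s) (𝓝 0) := by
      have := hcont.tendsto; simpa using this
    have hpre : ∀ᶠ t in 𝓝 s, γ t ∈ E'.source :=
      hγ.continuous.continuousAt.eventually_mem (E'.open_source.mem_nhds hs')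
    filter_upwards [hγ.eventually_coord_eq h hs, hpre,
      hten.eventually (eventually_crossDeriv_eq h h' hx hsy hx1)] with t ht ht' htd
    have hline : E (γ s) + (E (γ t) 0 - E (γ s) 0) • coordVec 0 = E (γ t) := by
      conv_lhs => rw [← onN_cross hx1]
      rw [onN_zero, ← onN_add, add_sub_cancel, ← ht.2]
    rw [hline] at htd
    have hty : E.symm (E (γ t)) ∈ E'.source := by rwa [E.left_inv ht.1]
    have h1 := crossDet_transition h h' (E.map_source ht.1) hty (hγ.coord_one h ht.1)
    rw [htd, ← hc, E.left_inv ht.1] at h1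
    rw [h1, Real.log_mul hcne]
    exact (h'.crossDet_pos (E'.map_source ht') (hγ.coord_one h' ht')).ne'
  have h1 := hasDerivAt_log_crossDet hγ h hs
  have h2 := ((hasDerivAt_log_crossDet hγ h' hs').const_add (Real.log c)).congr_of_eventuallyEq hev
  have := h1.unique h2
  linarith

theorem contDiffOn_expansionRate (hγ : S.IsClosedNullGenerator N γ)
    {E : OpenPartialHomeomorph M Coord} (h : IsFlowBox S N E) :
    ContDiffOn ℝ ∞ (expansionRate S E γ) (γ ⁻¹' E.source) := by
  refine ContDiffOn.mul ?_ ?_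
  · exact h.adapted.adaptedExpansion_smooth.comp (hγ.contDiffOn_coord h)
      fun t ht => E.map_source ht
  · exact (hγ.contDiffOn_coord_zero h).deriv_of_isOpen hγ.isOpen_preimage_source (by simp)

/-- Raychaudhuri's inequality `θ' ≤ κ θ` along a closed generator, with locally bounded `κ`. -/
theorem eventually_deriv_expansionRate_le (hγ : S.IsClosedNullGenerator N γ)
    {E : OpenPartialHomeomorph M Coord} (h : IsFlowBox S N E) {T : BilinField M}
    (hEinstein : S.EinsteinEquation T) (hDEC : S.DominantEnergyCondition T) {s : ℝ}
    (hs : γ s ∈ E.source) : ∃ C : ℝ, ∀ᶠ t in 𝓝 s, ∃ k : ℝ, |k| ≤ C ∧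
      deriv (expansionRate S E γ) t ≤ k * expansionRate S E γ t := by
  set c : ℝ → ℝ := fun t => E (γ t) 0 with hc
  have hO := hγ.isOpen_preimage_source (E := E)
  have hcs : ContDiffOn ℝ ∞ c (γ ⁻¹' E.source) := hγ.contDiffOn_coord_zero h
  have hc1 : ContDiffOn ℝ ∞ (deriv c) (γ ⁻¹' E.source) := hcs.deriv_of_isOpen hO (by simp)
  have hc2 : ContDiffOn ℝ ∞ (deriv (deriv c)) (γ ⁻¹' E.source) := hc1.deriv_of_isOpen hO (by simp)
  set k : ℝ → ℝ := fun t => christoffel (bilinComp E S.g) 0 0 0 (E (γ t)) * deriv c t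
    + deriv (deriv c) t / deriv c t with hk
  have hkc : ContinuousOn k (γ ⁻¹' E.source) := by
    refine ContinuousOn.add (ContinuousOn.mul ?_ hc1.continuousOn)
      (hc2.continuousOn.div hc1.continuousOn fun t ht => (hγ.deriv_coord_ne_zero h ht).1)
    exact (h.adapted.christoffel_smooth 0 0 0).continuousOn.comp
      (hγ.contDiffOn_coord h).continuousOn fun t ht => E.map_source ht
  have hbd : ∀ᶠ t in 𝓝 s, |k t| < |k s| + 1 :=
    (hkc.continuousAt (hO.mem_nhds hs)).abs.eventually_lt continuousAt_const (by simp)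
  refine ⟨|k s| + 1, ?_⟩
  filter_upwards [hbd, hO.mem_nhds hs] with t ht hts
  refine ⟨k t, ht.le, ?_⟩
  have hx := E.map_source hts
  have hx1 := hγ.coord_one h hts
  have hne := (hγ.deriv_coord_ne_zero h hts).1
  have h1 := (hasDerivAt_along hγ h hts
    (h.adapted.differentiableAt_of_smooth h.adapted.adaptedExpansion_smooth hx)).mul
    ((hc1.contDiffAt (hO.mem_nhds hts)).differentiableAt (by simp)).hasDerivAt
  have h2 : deriv (expansionRate S E γ) t = _ := h1.deriv
  rw [h2]
  have h3 := h.partialD_expansion_le hx hx1 hEinstein hDEC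
  have h4 := h.adapted.adaptedSquare_nonneg hx hx1 (h.crossDet_pos hx hx1)
  have h5 : 0 ≤ deriv c t * deriv c t := mul_self_nonneg _
  have h6 : partialD 0 (adaptedExpansion (bilinComp E S.g)) (E (γ t)) * (deriv c t * deriv c t) ≤
      christoffel (bilinComp E S.g) 0 0 0 (E (γ t)) * adaptedExpansion (bilinComp E S.g) (E (γ t))
        * (deriv c t * deriv c t) :=
    mul_le_mul_of_nonneg_right (by linarith) h5
  have h7 : k t * expansionRate S E γ t =
      christoffel (bilinComp E S.g) 0 0 0 (E (γ t)) * adaptedExpansion (bilinComp E S.g) (E (γ t))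
        * (deriv c t * deriv c t)
      + adaptedExpansion (bilinComp E S.g) (E (γ t)) * deriv (deriv c) t := by
    have hne' : deriv c t ≠ 0 := hne
    simp only [hk, expansionRate]
    change (_ + _) * (_ * deriv c t) = _
    field_simp
  rw [h7]
  linarith

end Expansion

end TransitionsAndExpansion

/-! ### A differential inequality on the circle -/

/-- A periodic function of zero mean with `f' ≤ k f`, for some locally bounded `k`, vanishes. -/
theorem eq_zero_of_deriv_le {f : ℝ → ℝ} (hf : Differentiable ℝ f)
    (hk : ∀ s, ∃ C : ℝ, ∀ᶠ t in 𝓝 s, ∃ k : ℝ, |k| ≤ C ∧ deriv f t ≤ k * f t)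
    {P : ℝ} (hP : 0 < P) (hper : ∀ s, f (s + P) = f s) (hmean : ∫ s in (0 : ℝ)..P, f s = 0) :
    ∀ s, f s = 0 := by
  have hfp : Function.Periodic f P := hper
  -- once nonpositive, `f` stays nonpositive
  have hstay : ∀ z, f z ≤ 0 → ∀ s, z ≤ s → f s ≤ 0 := by
    intro z hz s₁ hs₁
    by_contra hpos
    push Not at hpos
    set K := {t ∈ Icc z s₁ | f t ≤ 0} with hK
    have hKc : IsCompact K := by
      have : K = Icc z s₁ ∩ f ⁻¹' Iic 0 := rfl
      rw [this]
      exact isCompact_Icc.inter_right (isClosed_Iic.preimage hf.continuous)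
    obtain ⟨t₁, ht₁, hmax⟩ := hKc.exists_isGreatest ⟨z, ⟨le_rfl, hs₁⟩, hz⟩
    have hlt : t₁ < s₁ := lt_of_le_of_ne ht₁.1.2 fun h => by
      rw [h] at ht₁; exact absurd ht₁.2 (not_le.2 hpos)
    have hposafter : ∀ t, t₁ < t → t ≤ s₁ → 0 < f t := by
      intro t h1 h2
      by_contra hn
      exact absurd (hmax ⟨⟨ht₁.1.1.trans h1.le, h2⟩, not_lt.1 hn⟩) (not_le.2 h1)
    obtain ⟨C, hC⟩ := hk t₁
    obtain ⟨δ, hδ, hball⟩ := Metric.eventually_nhds_iff.1 hC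
    set t₂ := min s₁ (t₁ + δ / 2) with ht₂
    have h12 : t₁ < t₂ := lt_min hlt (by linarith)
    have hanti : AntitoneOn (fun t => f t * Real.exp (-(C * t))) (Icc t₁ t₂) := by
      have hd : ∀ t, HasDerivAt (fun t => f t * Real.exp (-(C * t)))
          (deriv f t * Real.exp (-(C * t)) + f t * (Real.exp (-(C * t)) * -(C * 1))) t := fun t =>
        (hf t).hasDerivAt.mul (((hasDerivAt_id t).const_mul C).neg.exp)
      refine antitoneOn_of_deriv_nonpos (convex_Icc _ _)
        (fun t _ => (hd t).continuousAt.continuousWithinAt)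
        (fun t _ => (hd t).differentiableAt.differentiableWithinAt) fun t ht => ?_
      rw [interior_Icc] at ht
      rw [(hd t).deriv]
      have hts : t ≤ s₁ := ht.2.le.trans (min_le_left _ _)
      have htδ : dist t t₁ < δ := by
        rw [Real.dist_eq, abs_of_pos (by linarith [ht.1])]
        have := ht.2.le.trans (min_le_right s₁ (t₁ + δ / 2))
        linarith
      obtain ⟨k, hk1, hk2⟩ := hball htδ
      have hft := hposafter t ht.1 hts
      have h3 : deriv f t ≤ C * f t :=
        hk2.trans (mul_le_mul_of_nonneg_right ((le_abs_self k).trans hk1) hft.le)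
      have h4 : deriv f t * Real.exp (-(C * t)) + f t * (Real.exp (-(C * t)) * -(C * 1)) =
          (deriv f t - C * f t) * Real.exp (-(C * t)) := by ring
      rw [h4]
      exact mul_nonpos_of_nonpos_of_nonneg (by linarith) (Real.exp_pos _).le
    have h5 := hanti (left_mem_Icc.2 h12.le) (right_mem_Icc.2 h12.le) h12.le
    have h6 := hposafter t₂ h12 (min_le_left _ _)
    have h7 := mul_pos h6 (Real.exp_pos (-(C * t₂)))
    have h8 := mul_nonpos_of_nonpos_of_nonneg ht₁.2 (Real.exp_pos (-(C * t₁))).le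
    simp only at h5
    linarith
  obtain ⟨z, hz⟩ : ∃ z, f z ≤ 0 := by
    by_contra hc
    push Not at hc
    have := intervalIntegral.intervalIntegral_pos_of_pos (hf.continuous.intervalIntegrable 0 P) hc hP
    rw [hmean] at this
    exact lt_irrefl _ this
  have hle : ∀ s, f s ≤ 0 := by
    intro s
    obtain ⟨n, hn⟩ := exists_nat_gt ((z - s) / P)
    have h1 : z ≤ s + n * P := by
      rw [div_lt_iff₀ hP] at hn; linarith
    have h2 : f (s + n * P) = f s := hfp.nat_mul n s
    rw [← h2]
    exact hstay z hz _ h1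
  have hIcc : ∀ s ∈ Icc 0 P, f s = 0 := by
    intro s hs
    by_contra hne
    have hneg : f s < 0 := lt_of_le_of_ne (hle s) hne
    have := intervalIntegral.integral_pos (f := fun t => - f t) hP (hf.continuous.neg.continuousOn)
      (fun t _ => by have := hle t; linarith) ⟨s, hs, by simpa using hneg⟩
    rw [intervalIntegral.integral_neg, hmean] at this
    simp at this
  intro s
  obtain ⟨y, hy, hys⟩ := hfp.exists_mem_Ico₀ hP s
  rw [hys]
  exact hIcc y ⟨hy.1, hy.2.le⟩

/-! ### Holonomy of the generators -/

section Holonomy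

variable {M : Type*} [TopologicalSpace M] [ChartedSpace Coord M]

/-- The area density `crossDet` of the cross sections of `N` at `γ s`, in the flow box `E`,
divided by its growth `exp (2 L)` along `γ`, where `L` is a primitive of the expansion. -/
noncomputable def normalizedDensity (S : Spacetime M) (γ : ℝ → M) (L : ℝ → ℝ)
    (E : OpenPartialHomeomorph M Coord) (s : ℝ) : ℝ :=
  crossDet (bilinComp E S.g) (E (γ s)) * Real.exp (-(2 * L s))

/-- `φ` describes the displacement of the generators near `γ` from the transversal disc
`x⁰ = const` of the flow box `E` at `γ s` to that of the flow box `E'` at `γ s'`. The generators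
themselves enter only through saturated sets. The Jacobian of `φ` is recorded in terms of the
expansion. -/
structure IsHolonomy (S : Spacetime M) (N : Set M) (γ : ℝ → M) (L : ℝ → ℝ)
    (E : OpenPartialHomeomorph M Coord) (s : ℝ) (E' : OpenPartialHomeomorph M Coord) (s' : ℝ)
    (φ : (Fin 2 → ℝ) → (Fin 2 → ℝ)) : Prop where
  map_eq : φ (cross (E (γ s))) = cross (E' (γ s'))
  contDiffAt : ContDiffAt ℝ 1 φ (cross (E (γ s)))
  saturated : ∀ᶠ z in 𝓝 (cross (E (γ s))), ∀ A, IsSaturated S N A →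
    E.symm (onN (E (γ s) 0) z) ∈ A → E'.symm (onN (E' (γ s') 0) (φ z)) ∈ A
  density : normalizedDensity S γ L E s =
    (fderiv ℝ φ (cross (E (γ s)))).det ^ 2 * normalizedDensity S γ L E' s'

theorem ContinuousLinearMap.det_comp {V : Type*} [NormedAddCommGroup V] [NormedSpace ℝ V]
    (f g : V →L[ℝ] V) : (f.comp g).det = f.det * g.det :=
  LinearMap.det_comp (f : V →ₗ[ℝ] V) (g : V →ₗ[ℝ] V)

variable {S : Spacetime M} {N : Set M} {γ : ℝ → M} {L : ℝ → ℝ}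

theorem IsHolonomy.comp {E E' E'' : OpenPartialHomeomorph M Coord} {s s' s'' : ℝ}
    {φ φ' : (Fin 2 → ℝ) → (Fin 2 → ℝ)} (hφ' : IsHolonomy S N γ L E' s' E'' s'' φ')
    (hφ : IsHolonomy S N γ L E s E' s' φ) : IsHolonomy S N γ L E s E'' s'' (φ' ∘ φ) := by
  have hd' : ContDiffAt ℝ 1 φ' (φ (cross (E (γ s)))) := hφ.map_eq ▸ hφ'.contDiffAt
  refine ⟨?_, hd'.comp _ hφ.contDiffAt, ?_, ?_⟩
  · rw [Function.comp_apply, hφ.map_eq, hφ'.map_eq]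
  · have h1 : Filter.Tendsto φ (𝓝 (cross (E (γ s)))) (𝓝 (cross (E' (γ s')))) := by
      have := hφ.contDiffAt.continuousAt.tendsto
      rwa [hφ.map_eq] at this
    filter_upwards [hφ.saturated, h1.eventually hφ'.saturated] with z hz hz' A hA hzA
    exact hz' A hA (hz A hA hzA)
  · rw [fderiv_comp _ (hd'.differentiableAt one_ne_zero)
      (hφ.contDiffAt.differentiableAt one_ne_zero), ContinuousLinearMap.det_comp, hφ.map_eq,
      hφ.density, hφ'.density]
    ring

variable (hγ : S.IsClosedNullGenerator N γ)
include hγ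

/-- Change of the flow box at a fixed point of the generator. -/
theorem exists_isHolonomy_change {E E' : OpenPartialHomeomorph M Coord} (h : IsFlowBox S N E)
    (h' : IsFlowBox S N E') {s : ℝ} (hs : γ s ∈ E.source) (hs' : γ s ∈ E'.source) :
    ∃ φ, IsHolonomy S N γ L E s E' s φ := by
  set x := E (γ s) with hxdef
  have hx : x ∈ E.target := E.map_source hs
  have hx1 : x 1 = 0 := hγ.coord_one h hs
  have hinv : E.symm x = γ s := E.left_inv hs
  have hsy : E.symm x ∈ E'.source := by rwa [hinv]
  have hshift : ∀ z, x + crossEmb (z - cross x) = onN (x 0) z := by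
    intro z
    ext i; fin_cases i <;> simp [hx1]
  have hself : onN (x 0) (cross x) = x := onN_cross hx1
  have hcontN : Continuous fun z => onN (x 0) z := by unfold onN; fun_prop
  have hmem : ∀ᶠ z in 𝓝 (cross x), onN (x 0) z ∈ E.target ∩ E.symm ⁻¹' E'.source :=
    hcontN.continuousAt.eventually_mem
      ((isOpen_transition E E').mem_nhds (by rw [hself]; exact ⟨hx, hsy⟩))
  have hT : ContDiffAt ℝ 1 (E' ∘ E.symm) (onN (x 0) (cross x)) := by
    rw [hself]
    exact (((contDiffOn_transition h.smooth h'.smooth).contDiffAt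
      ((isOpen_transition E E').mem_nhds ⟨hx, hsy⟩))).of_le (by simp)
  have honN : ContDiff ℝ 1 fun z => onN (x 0) z := by unfold onN; fun_prop
  have hTc : ContDiffAt ℝ 1 (fun z => (E' ∘ E.symm) (onN (x 0) z)) (cross x) :=
    hT.comp _ honN.contDiffAt
  set φ : (Fin 2 → ℝ) → (Fin 2 → ℝ) := fun z => cross ((E' ∘ E.symm) (onN (x 0) z)) with hφ
  have hφd : HasFDerivAt φ (crossDeriv (E' ∘ E.symm) x) (cross x) := by
    have h1 := hasFDerivAt_cross_transition h h' hx hsy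
    have h2 : HasFDerivAt (fun z : Fin 2 → ℝ => z - cross x) (ContinuousLinearMap.id ℝ _)
      (cross x) := (hasFDerivAt_id _).sub_const _
    have h3 : HasFDerivAt (fun a : Fin 2 → ℝ => cross (E' (E.symm (x + crossEmb a))))
        (crossDeriv (E' ∘ E.symm) x) (cross x - cross x) := by rwa [sub_self]
    have h4 := HasFDerivAt.comp (f := fun z : Fin 2 → ℝ => z - cross x) (cross x) h3 h2
    rw [ContinuousLinearMap.comp_id] at h4
    refine h4.congr_of_eventuallyEq (Filter.Eventually.of_forall fun z => ?_)
    simp only [hφ, Function.comp_apply, hshift]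
  refine ⟨φ, ?_, cross.contDiff.contDiffAt.comp _ hTc, ?_, ?_⟩
  · simp only [hφ, ← hxdef, hself, Function.comp_apply, hinv]
  · have hy : E' (γ s) ∈ E'.target := E'.map_source hs'
    have hy1 : E' (γ s) 1 = 0 := hγ.coord_one h' hs'
    obtain ⟨r, hr, hball⟩ := Metric.isOpen_iff.1 E'.open_target _ hy
    have c1 : ∀ᶠ z in 𝓝 (cross x), (E' ∘ E.symm) (onN (x 0) z) ∈ Metric.ball (E' (γ s)) r := by
      refine hTc.continuousAt.eventually_mem (Metric.isOpen_ball.mem_nhds ?_)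
      simp only [hself, Function.comp_apply, hinv]
      exact Metric.mem_ball_self hr
    have c2 : ∀ᶠ z in 𝓝 (cross x), onN (E' (γ s) 0) (φ z) ∈ Metric.ball (E' (γ s)) r := by
      have hc : ContinuousAt (fun z => onN (E' (γ s) 0) (φ z)) (cross x) := by
        have : Continuous fun z => onN (E' (γ s) 0) z := by unfold onN; fun_prop
        exact this.continuousAt.comp hφd.continuousAt
      refine hc.eventually_mem (Metric.isOpen_ball.mem_nhds ?_)
      simp only [hφ, hself, Function.comp_apply, hinv]
      rw [onN_cross hy1]
      exact Metric.mem_ball_self hr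
    filter_upwards [hmem, c1, c2] with z hz hz1 hz2 A hA hzA
    have hone : E' (E.symm (onN (x 0) z)) 1 = 0 := transition_one h h' hz.1 hz.2 (by simp)
    have heq : onN (E' (E.symm (onN (x 0) z)) 0) (φ z) = E' (E.symm (onN (x 0) z)) :=
      onN_cross hone
    refine hA.slide h' hball (u₁ := E' (E.symm (onN (x 0) z)) 0) ?_ hz2 ?_
    · rw [heq]; exact hz1
    · rw [heq, E'.left_inv hz.2]; exact hzA
  · rw [hφd.fderiv]
    have h1 := crossDet_transition h h' hx hsy hx1
    simp only [normalizedDensity, ← hxdef]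
    rw [h1, hinv]
    ring

/-- Displacement along the generator inside a flow box. -/
theorem eventually_isHolonomy_id (hL : ∀ (E : OpenPartialHomeomorph M Coord) (s : ℝ),
      IsFlowBox S N E → γ s ∈ E.source → HasDerivAt L (expansionRate S E γ s) s)
    {E : OpenPartialHomeomorph M Coord} (h : IsFlowBox S N E) {s : ℝ} (hs : γ s ∈ E.source) :
    ∀ᶠ t in 𝓝 s, γ t ∈ E.source ∧ IsHolonomy S N γ L E s E t id ∧
      IsHolonomy S N γ L E t E s id := by
  have hx : E (γ s) ∈ E.target := E.map_source hs
  have hx1 : E (γ s) 1 = 0 := hγ.coord_one h hs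
  obtain ⟨r, hr, hball⟩ := Metric.isOpen_iff.1 E.open_target _ hx
  have hnear : ∀ᶠ p : ℝ × (Fin 2 → ℝ) in 𝓝 (E (γ s) 0, cross (E (γ s))),
      onN p.1 p.2 ∈ Metric.ball (E (γ s)) r := by
    refine continuous_onN.continuousAt.eventually_mem (Metric.isOpen_ball.mem_nhds ?_)
    simp only [onN_cross hx1]
    exact Metric.mem_ball_self hr
  rw [nhds_prod_eq] at hnear
  have hnear' := hnear.curry
  have hcont : Filter.Tendsto (fun t => E (γ t) 0) (𝓝 s) (𝓝 (E (γ s) 0)) :=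
    (hγ.map_nhds_coord_zero h hs).le
  -- in the flow box, the logarithmic area density is a primitive of twice the expansion
  obtain ⟨δ, hδ, hδball⟩ := Metric.isOpen_iff.1 (hγ.isOpen_preimage_source (E := E)) s hs
  have hconst : ∀ t ∈ Metric.ball s δ, normalizedDensity S γ L E t = normalizedDensity S γ L E s := by
    have hlog : ∀ t ∈ Metric.ball s δ, HasDerivAt
        (fun t => Real.log (crossDet (bilinComp E S.g) (E (γ t))) - 2 * L t) 0 t := by
      intro t ht
      have h1 := (hasDerivAt_log_crossDet hγ h (hδball ht)).sub
        ((hL E t h (hδball ht)).const_mul 2)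
      rwa [sub_self] at h1
    intro t ht
    have h1 := Metric.isOpen_ball.is_const_of_deriv_eq_zero (𝕜 := ℝ)
      (convex_ball s δ).isPreconnected
      (fun t ht => (hlog t ht).differentiableAt.differentiableWithinAt)
      (fun t ht => (hlog t ht).deriv) ht (Metric.mem_ball_self hδ)
    have hexp : ∀ t ∈ Metric.ball s δ, normalizedDensity S γ L E t =
        Real.exp (Real.log (crossDet (bilinComp E S.g) (E (γ t))) - 2 * L t) := by
      intro t ht
      have hpos := h.crossDet_pos (E.map_source (hδball ht)) (hγ.coord_one h (hδball ht))
      rw [sub_eq_add_neg, Real.exp_add, Real.exp_log hpos, normalizedDensity]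
    rw [hexp t ht, hexp s (Metric.mem_ball_self hδ), h1]
  filter_upwards [hγ.eventually_coord_eq h hs, hcont.eventually hnear',
    Metric.ball_mem_nhds s hδ] with t ht htn htδ
  have hcr : cross (E (γ t)) = cross (E (γ s)) := by rw [ht.2, cross_onN]
  have hsn := hnear'.self_of_nhds
  have hdet : (fderiv ℝ (id : (Fin 2 → ℝ) → (Fin 2 → ℝ)) (cross (E (γ s)))).det = 1 := by
    rw [fderiv_id]; exact LinearMap.det_id
  refine ⟨ht.1, ⟨hcr.symm, contDiffAt_id, ?_, ?_⟩, ⟨hcr, contDiffAt_id, ?_, ?_⟩⟩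
  · filter_upwards [htn, hsn] with z hz hz' A hA hzA
    exact hA.slide h hball hz' hz hzA
  · rw [hdet, hconst t htδ]; ring
  · rw [hcr]
    filter_upwards [htn, hsn] with z hz hz' A hA hzA
    exact hA.slide h hball hz hz' hzA
  · rw [hcr, hdet, hconst t htδ]; ring

/-- The holonomy along a closed generator. -/
theorem exists_isHolonomy [IsManifold (𝓡 4) ∞ M] (hN : S.IsNullHypersurface N)
    (hL : ∀ (E : OpenPartialHomeomorph M Coord) (s : ℝ),
      IsFlowBox S N E → γ s ∈ E.source → HasDerivAt L (expansionRate S E γ s) s)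
    {E E' : OpenPartialHomeomorph M Coord} (h : IsFlowBox S N E) (h' : IsFlowBox S N E')
    {s s' : ℝ} (hs : γ s ∈ E.source) (hs' : γ s' ∈ E'.source) :
    ∃ φ, IsHolonomy S N γ L E s E' s' φ := by
  refine isPreconnected_univ.induction₂' (fun s s' => ∀ E E', IsFlowBox S N E →
    IsFlowBox S N E' → γ s ∈ E.source → γ s' ∈ E'.source → ∃ φ, IsHolonomy S N γ L E s E' s' φ)
    ?_ ?_ (mem_univ s) (mem_univ s') E E' h h' hs hs'
  · intro s _
    obtain ⟨E₀, h₀, hs₀⟩ := exists_isFlowBox hN (hγ.2.2.1 s)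
    filter_upwards [nhdsWithin_le_nhds (eventually_isHolonomy_id hγ hL h₀ hs₀)] with t ht
    constructor
    · intro E E' h h' hs ht'
      obtain ⟨φ₁, h₁⟩ := exists_isHolonomy_change (L := L) hγ h h₀ hs hs₀
      obtain ⟨φ₂, h₂⟩ := exists_isHolonomy_change (L := L) hγ h₀ h' ht.1 ht'
      exact ⟨_, h₂.comp (ht.2.1.comp h₁)⟩
    · intro E E' h h' ht' hs
      obtain ⟨φ₁, h₁⟩ := exists_isHolonomy_change (L := L) hγ h h₀ ht' ht.1
      obtain ⟨φ₂, h₂⟩ := exists_isHolonomy_change (L := L) hγ h₀ h' hs₀ hs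
      exact ⟨_, h₂.comp (ht.2.2.comp h₁)⟩
  · intro s t w _ _ _ hst htw E E' h h' hs hw
    obtain ⟨E₀, h₀, ht₀⟩ := exists_isFlowBox hN (hγ.2.2.1 t)
    obtain ⟨φ₁, h₁⟩ := hst E E₀ h h₀ hs ht₀
    obtain ⟨φ₂, h₂⟩ := htw E₀ E' h₀ h' ht₀ hw
    exact ⟨_, h₂.comp h₁⟩

/-- The expansion of a closed generator has a global primitive. -/
theorem exists_expansion_primitive [IsManifold (𝓡 4) ∞ M] (hN : S.IsNullHypersurface N) :
    ∃ θ L : ℝ → ℝ, Differentiable ℝ θ ∧ (∀ s, HasDerivAt L (θ s) s) ∧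
      ∀ (E : OpenPartialHomeomorph M Coord) (s : ℝ), IsFlowBox S N E → γ s ∈ E.source →
        θ =ᶠ[𝓝 s] expansionRate S E γ := by
  choose E h hs using fun s => exists_isFlowBox hN (hγ.2.2.1 s)
  set θ : ℝ → ℝ := fun s => expansionRate S (E s) γ s with hθ
  have hloc : ∀ (E : OpenPartialHomeomorph M Coord) (s : ℝ), IsFlowBox S N E → γ s ∈ E.source →
      θ =ᶠ[𝓝 s] expansionRate S E γ := by
    intro E' s h' hs'
    filter_upwards [hγ.isOpen_preimage_source.mem_nhds hs'] with t ht
    exact expansionRate_eq hγ (h t) h' (hs t) ht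
  have hdiff : Differentiable ℝ θ := fun s =>
    (((contDiffOn_expansionRate hγ (h s)).contDiffAt
      (hγ.isOpen_preimage_source.mem_nhds (hs s))).differentiableAt (by simp)).congr_of_eventuallyEq
      (hloc _ s (h s) (hs s))
  exact ⟨θ, fun s => ∫ t in (0 : ℝ)..s, θ t, hdiff, fun s =>
    intervalIntegral.integral_hasDerivAt_right (hdiff.continuous.intervalIntegrable _ _)
      (hdiff.continuous.stronglyMeasurableAtFilter _ _) hdiff.continuous.continuousAt, hloc⟩

end Holonomy

/-! ### Recurrence of the closed generators -/

/-- A local diffeomorphism `φ` fixing `y` has Jacobian `±1` at `y` if, for a set of points `z` that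
is dense near `y`, `φ` maps the part near `y` of a finite set `A z ∋ z` of at most `n` points into
`A z`: then `φ^[n!]` fixes a set dense near `y`, so that its derivative at `y` is the identity. -/
theorem det_sq_eq_one_of_finite_orbits {V : Type*} [NormedAddCommGroup V] [NormedSpace ℝ V]
    [FiniteDimensional ℝ V] {φ : V → V} {y : V} (hy : φ y = y) (hφ : ContDiffAt ℝ 1 φ y)
    (hdet : (fderiv ℝ φ y).det ≠ 0) {A : V → Set V} {F : Set V} {n : ℕ}
    (hyF : y ∈ interior (closure F)) (hfin : ∀ z ∈ F, (A z).Finite ∧ (A z).ncard ≤ n)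
    (hself : ∀ᶠ z in 𝓝 y, z ∈ A z) (hmap : ∀ᶠ w in 𝓝 y, ∀ z ∈ F, w ∈ A z → φ w ∈ A z) :
    (fderiv ℝ φ y).det ^ 2 = 1 := by
  have hstrict := hφ.hasStrictFDerivAt one_ne_zero
  obtain ⟨U, hU, hinj⟩ : ∃ U ∈ 𝓝 y, InjOn φ U := by
    have h1 : HasStrictFDerivAt φ
        (((fderiv ℝ φ y).toContinuousLinearEquivOfDetNeZero hdet : V ≃L[ℝ] V) : V →L[ℝ] V) y := by
      rwa [ContinuousLinearMap.coe_toContinuousLinearEquivOfDetNeZero]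
    refine ⟨_, (h1.toOpenPartialHomeomorph φ).open_source.mem_nhds
      h1.mem_toOpenPartialHomeomorph_source, ?_⟩
    have := (h1.toOpenPartialHomeomorph φ).injOn
    rwa [h1.toOpenPartialHomeomorph_coe] at this
  have hcont : ContinuousAt φ y := hφ.continuousAt
  have hiter : ∀ k, ∀ᶠ z in 𝓝 y, φ^[k] z ∈ U ∧ ∀ x ∈ F, φ^[k] z ∈ A x → φ (φ^[k] z) ∈ A x := by
    intro k
    have h1 : ContinuousAt φ^[k] y := hcont.iterate hy k
    have h2 : φ^[k] y = y := Function.iterate_fixed hy k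
    have h3 : Filter.Tendsto φ^[k] (𝓝 y) (𝓝 y) := by simpa [h2] using h1.tendsto
    exact h3.eventually (Filter.Eventually.and hU hmap)
  have hall : ∀ᶠ z in 𝓝 y, ∀ k ∈ Finset.range (n + 1), φ^[k] z ∈ U ∧
      ∀ x ∈ F, φ^[k] z ∈ A x → φ (φ^[k] z) ∈ A x :=
    (Filter.eventually_all_finset _).2 fun k _ => hiter k
  -- by the pigeonhole principle, points of `F` near `y` are periodic
  have hper : ∀ᶠ z in 𝓝[F] y, φ^[n.factorial] z = z := by
    filter_upwards [nhdsWithin_le_nhds hall, nhdsWithin_le_nhds hself, self_mem_nhdsWithin]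
      with z hz hzA hzF
    obtain ⟨hAf, hAn⟩ := hfin z hzF
    have horb : ∀ k ≤ n, φ^[k] z ∈ A z := by
      intro k
      induction k with
      | zero => intro _; exact hzA
      | succ k ih =>
        intro hk
        rw [Function.iterate_succ_apply']
        exact (hz k (Finset.mem_range.2 (by omega))).2 z hzF (ih (by omega))
    obtain ⟨i, hi, j, hj, hij, heq⟩ := exists_ne_map_eq_of_ncard_lt_of_maps_to
      (s := (Finset.range (n + 1) : Set ℕ)) (t := A z) (f := fun k => φ^[k] z)
      (by rw [ncard_coe_finset, Finset.card_range]; omega)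
      (fun k hk => horb k (by simpa [Nat.lt_succ_iff] using hk)) hAf
    have hcancel : ∀ i d, i + d ≤ n → φ^[i] z = φ^[i + d] z → φ^[d] z = z := by
      intro i
      induction i with
      | zero => intro d _ h; simpa using h.symm
      | succ i ih =>
        intro d hd h
        refine ih d (by omega) (hinj (hz i (Finset.mem_range.2 (by omega))).1
          (hz (i + d) (Finset.mem_range.2 (by omega))).1 ?_)
        rw [← Function.iterate_succ_apply' φ, ← Function.iterate_succ_apply' φ, h]
        congr 2
        omega
    have hi' : i ≤ n := by simpa [Nat.lt_succ_iff] using hi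
    have hj' : j ≤ n := by simpa [Nat.lt_succ_iff] using hj
    obtain ⟨d, hd0, hdn, hd⟩ : ∃ d, 0 < d ∧ d ≤ n ∧ φ^[d] z = z := by
      rcases lt_or_gt_of_ne hij with h | h
      · exact ⟨j - i, by omega, by omega, hcancel i (j - i) (by omega)
          (by rw [Nat.add_sub_cancel' h.le]; exact heq)⟩
      · exact ⟨i - j, by omega, by omega, hcancel j (i - j) (by omega)
          (by rw [Nat.add_sub_cancel' h.le]; exact heq.symm)⟩
    have hp : Function.IsPeriodicPt φ d z := hd
    exact hp.trans_dvd (Nat.dvd_factorial hd0 hdn)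
  have hu : UniqueDiffWithinAt ℝ F y :=
    uniqueDiffWithinAt_closure.1 (uniqueDiffWithinAt_of_mem_nhds (mem_interior_iff_mem_nhds.1 hyF))
  have h1 : HasFDerivWithinAt φ^[n.factorial] ((fderiv ℝ φ y) ^ n.factorial) F y :=
    (hstrict.hasFDerivAt.iterate hy _).hasFDerivWithinAt
  have h2 : HasFDerivWithinAt φ^[n.factorial] (ContinuousLinearMap.id ℝ V) F y :=
    (hasFDerivWithinAt_id y F).congr_of_eventuallyEq hper (Function.iterate_fixed hy _)
  have h3 := hu.eq h1 h2
  have h4 : (fderiv ℝ φ y).det ^ n.factorial = 1 := by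
    have h5 : ((fderiv ℝ φ y : V →ₗ[ℝ] V)) ^ n.factorial = LinearMap.id := by
      rw [← ContinuousLinearMap.toLinearMap_pow, h3]; rfl
    rw [ContinuousLinearMap.det, ← map_pow, h5, LinearMap.det_id]
  refine (pow_eq_one_iff_of_nonneg (sq_nonneg _) n.factorial_ne_zero).1 ?_
  rw [← pow_mul, mul_comm, pow_mul, h4, one_pow]

section Vanishing

variable {M : Type*} [TopologicalSpace M] [ChartedSpace Coord M] [T2Space M]
  {S : Spacetime M} {N : Set M}

/-- A closed generator meets a compact transversal disc in finitely many points. -/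
theorem finite_transversal_inter {γ : ℝ → M} (hγ : S.IsClosedNullGenerator N γ)
    {E : OpenPartialHomeomorph M Coord} (h : IsFlowBox S N E) {u : ℝ} {K : Set (Fin 2 → ℝ)}
    (hK : IsCompact K) (hKE : ∀ z ∈ K, onN u z ∈ E.target) :
    {w ∈ K | E.symm (onN u w) ∈ range γ}.Finite := by
  obtain ⟨P, hP, hper⟩ := hγ.2.1
  have hperiodic : Function.Periodic γ P := hper
  have hcontN : Continuous fun z => onN u z := by unfold onN; fun_prop
  set D : Set M := (fun z => E.symm (onN u z)) '' K with hD
  have hDc : IsCompact D := hK.image_of_continuousOn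
    (E.continuousOn_symm.comp hcontN.continuousOn hKE)
  set Θ : Set ℝ := Icc 0 P ∩ γ ⁻¹' D with hΘ
  have hΘc : IsCompact Θ := isCompact_Icc.inter_right (hDc.isClosed.preimage hγ.continuous)
  have hD0 : ∀ q ∈ D, q ∈ E.source ∧ E q 0 = u := by
    rintro _ ⟨z, hz, rfl⟩
    refine ⟨E.map_target (hKE z hz), ?_⟩
    change E (E.symm (onN u z)) 0 = u
    rw [E.right_inv (hKE z hz), onN_zero]
  have hdisc : IsDiscrete Θ := by
    refine IsDiscrete.of_nhdsWithin fun t ht => ?_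
    obtain ⟨hts, htu⟩ := hD0 _ ht.2
    have h1 : HasDerivAt (fun t => E (γ t) 0) (deriv (fun t => E (γ t) 0) t) t :=
      (((hγ.contDiffOn_coord_zero h).contDiffAt
        (hγ.isOpen_preimage_source.mem_nhds hts)).differentiableAt (by simp)).hasDerivAt
    have h2 := h1.eventually_ne (c := u) (hγ.deriv_coord_ne_zero h hts).1
    rw [Filter.le_pure_iff, mem_nhdsWithin_iff_eventually]
    rw [eventually_nhdsWithin_iff] at h2
    filter_upwards [h2] with t' ht' hmem
    by_contra hne
    exact ht' hne (hD0 _ hmem.2).2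
  refine ((hΘc.finite hdisc).image fun t => cross (E (γ t))).subset ?_
  rintro w ⟨hwK, hw⟩
  rw [← hperiodic.image_Icc hP 0, zero_add] at hw
  obtain ⟨t, ht, htw⟩ := hw
  refine ⟨t, ⟨ht, w, hwK, htw.symm⟩, ?_⟩
  change cross (E (γ t)) = w
  rw [htw, E.right_inv (hKE w hwK), cross_onN]

variable [IsManifold (𝓡 4) ∞ M] {T : BilinField M}

omit [T2Space M] in
/-- If the holonomy around a closed generator preserves area, the transverse metric is constant
along this generator. -/
theorem partialD_eq_zero_of_det_holonomy (hN : S.IsNullHypersurface N)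
    (hEinstein : S.EinsteinEquation T) (hDEC : S.DominantEnergyCondition T)
    {γ : ℝ → M} (hγ : S.IsClosedNullGenerator N γ) {P : ℝ} (hP : 0 < P)
    (hper : ∀ s, γ (s + P) = γ s) {E : OpenPartialHomeomorph M Coord} (h : IsFlowBox S N E)
    (hs : γ 0 ∈ E.source)
    (hdet : ∀ L φ, IsHolonomy S N γ L E 0 E P φ → (fderiv ℝ φ (cross (E (γ 0)))).det ^ 2 = 1)
    {A B : Fin 4} (hA : A = 2 ∨ A = 3) (hB : B = 2 ∨ B = 3) :
    partialD 0 (fun y => bilinComp E S.g y A B) (E (γ 0)) = 0 := by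
  obtain ⟨θ, L, hθd, hL, hloc⟩ := exists_expansion_primitive hγ hN
  have hP0 : γ P = γ 0 := by simpa using hper 0
  have hL' : ∀ (E : OpenPartialHomeomorph M Coord) (s : ℝ), IsFlowBox S N E → γ s ∈ E.source →
      HasDerivAt L (expansionRate S E γ s) s := fun E s h hs => by
    rw [← (hloc E s h hs).eq_of_nhds]; exact hL s
  have hx := E.map_source hs
  have hx1 := hγ.coord_one h hs
  have hpos := h.crossDet_pos hx hx1
  obtain ⟨φ, hφ⟩ := exists_isHolonomy hγ hN hL' h h hs (s' := P) (by rw [hP0]; exact hs)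
  have hdens := hφ.density
  rw [hdet L φ hφ, one_mul, normalizedDensity, normalizedDensity, hP0] at hdens
  have hLP : L P = L 0 := by
    have := Real.exp_injective (mul_left_cancel₀ hpos.ne' hdens)
    linarith
  have hmean : ∫ s in (0 : ℝ)..P, θ s = 0 := by
    rw [intervalIntegral.integral_eq_sub_of_hasDerivAt (fun s _ => hL s)
      (hθd.continuous.intervalIntegrable 0 P), hLP, sub_self]
  have hθper : ∀ s, θ (s + P) = θ s := by
    intro s
    obtain ⟨E', h', hs'⟩ := exists_isFlowBox hN (hγ.2.2.1 s)
    rw [(hloc E' s h' hs').eq_of_nhds, (hloc E' (s + P) h' (by rw [hper]; exact hs')).eq_of_nhds]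
    simp only [expansionRate, hper]
    congr 1
    rw [← deriv_comp_add_const]
    simp only [hper]
  have hθ0 : ∀ s, θ s = 0 := by
    refine eq_zero_of_deriv_le hθd (fun s => ?_) hP hθper hmean
    obtain ⟨E', h', hs'⟩ := exists_isFlowBox hN (hγ.2.2.1 s)
    obtain ⟨C, hC⟩ := eventually_deriv_expansionRate_le hγ h' hEinstein hDEC hs'
    refine ⟨C, ?_⟩
    filter_upwards [hC, (hloc E' s h' hs').eventuallyEq_nhds] with t ht hte
    rw [hte.deriv_eq, hte.eq_of_nhds]
    exact ht
  -- the expansion of the flow box vanishes along the generator, hence so does its derivative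
  have hexp : (fun t => adaptedExpansion (bilinComp E S.g) (E (γ t))) =ᶠ[𝓝 0] fun _ => 0 := by
    filter_upwards [hloc E 0 h hs, hγ.isOpen_preimage_source.mem_nhds hs] with t ht hts
    rw [hθ0, expansionRate] at ht
    exact (mul_eq_zero.1 ht.symm).resolve_right (hγ.deriv_coord_ne_zero h hts).1
  have h1 := (hasDerivAt_along hγ h hs
    (h.adapted.differentiableAt_of_smooth h.adapted.adaptedExpansion_smooth hx)).unique
    ((hasDerivAt_const (0 : ℝ) (0 : ℝ)).congr_of_eventuallyEq hexp)
  have h2 := (mul_eq_zero.1 h1).resolve_right (hγ.deriv_coord_ne_zero h hs).1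
  have h3 := h.partialD_expansion_le hx hx1 hEinstein hDEC
  have h4 : adaptedExpansion (bilinComp E S.g) (E (γ 0)) = 0 := hexp.eq_of_nhds
  have h5 := h.adapted.adaptedSquare_nonneg hx hx1 hpos
  rw [h2, h4, mul_zero] at h3
  exact h.adapted.partialD_eq_zero_of_adaptedSquare hx hx1 hpos (by linarith) hA hB

/-- On a horizon generated by closed null geodesics, the transverse metric is constant along the
generators. By Baire's theorem the number of intersections of the closed generators with a
transversal disc is bounded on a set that is dense in some open subset of any given one; there the
holonomy preserves area. -/
theorem IsFlowBox.partialD_eq_zero {E : OpenPartialHomeomorph M Coord} (h : IsFlowBox S N E)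
    (hB : S.IsClassB N) (hEinstein : S.EinsteinEquation T) (hDEC : S.DominantEnergyCondition T)
    {x : Coord} (hx : x ∈ E.target) (hx1 : x 1 = 0)
    {A B : Fin 4} (hA : A = 2 ∨ A = 3) (hB' : B = 2 ∨ B = 3) :
    partialD 0 (fun y => bilinComp E S.g y A B) x = 0 := by
  by_contra hne
  set u := x 0 with hu
  set F : (Fin 2 → ℝ) → ℝ := fun z => partialD 0 (fun y => bilinComp E S.g y A B) (onN u z) with hF
  have hcontN : Continuous fun z => onN u z := by unfold onN; fun_prop
  have hpd : ContinuousOn (partialD 0 fun y => bilinComp E S.g y A B) E.target :=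
    (ContDiffOn.partialD (h.adapted.smooth A B) E.open_target 0).continuousOn
  have hself : onN u (cross x) = x := onN_cross hx1
  obtain ⟨r, hr, hball⟩ := Metric.isOpen_iff.1 (E.open_target.preimage hcontN) (cross x)
    (by simpa [hself] using hx)
  set K : Set (Fin 2 → ℝ) := Metric.closedBall (cross x) (r / 2) with hK
  have hKE : ∀ z ∈ K, onN u z ∈ E.target := fun z hz =>
    hball (Metric.closedBall_subset_ball (by linarith) hz)
  have hKc : IsCompact K := isCompact_closedBall _ _
  -- closed generators `γ z` through each point of the disc `K`
  have hgen : ∀ z : Fin 2 → ℝ, ∃ γ : ℝ → M, z ∈ K →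
      S.IsClosedNullGenerator N γ ∧ γ 0 = E.symm (onN u z) := by
    intro z
    by_cases hz : z ∈ K
    · obtain ⟨γ, hγ, s, hs⟩ := hB.closed_generators _ ((h.symm_mem_iff (hKE z hz)).2 (onN_one u z))
      exact ⟨fun t => γ (t + s), fun _ => ⟨hγ.comp_add s, by simpa using hs⟩⟩
    · exact ⟨fun _ => E.symm x, fun hz' => absurd hz' hz⟩
  choose γ hγ using hgen
  set R : (Fin 2 → ℝ) → Set (Fin 2 → ℝ) := fun z => {w ∈ K | E.symm (onN u w) ∈ range (γ z)}
    with hR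
  have hRfin : ∀ z ∈ K, (R z).Finite := fun z hz =>
    finite_transversal_inter (hγ z hz).1 h hKc hKE
  set Q : ℕ → Set (Fin 2 → ℝ) := fun n => {z ∈ K | (R z).ncard ≤ n} with hQ
  -- the open set of discrepancy
  obtain ⟨W, hWK, hWo, hxW, hWne⟩ : ∃ W ⊆ K, IsOpen W ∧ cross x ∈ W ∧ ∀ z ∈ W, F z ≠ 0 := by
    have hc : ContinuousAt F (cross x) := by
      have h1 : ContinuousAt (partialD 0 fun y => bilinComp E S.g y A B) (onN u (cross x)) :=
        hpd.continuousAt (E.open_target.mem_nhds (by rw [hself]; exact hx))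
      exact h1.comp hcontN.continuousAt
    have h0 : F (cross x) ≠ 0 := by simp only [hF, hself]; exact hne
    obtain ⟨W, hW, hWo, hxW⟩ := eventually_nhds_iff.1
      (Filter.Eventually.and (hc.eventually_ne h0)
        (Metric.closedBall_mem_nhds (cross x) (half_pos hr)))
    exact ⟨W, fun z hz => (hW z hz).2, hWo, hxW, fun z hz => (hW z hz).1⟩
  obtain ⟨y, hyW, n, hyn⟩ : ∃ y ∈ W, ∃ n, y ∈ interior (closure (Q n)) := by
    have hd : Dense (⋃ n, interior (closure (Q n) ∪ Wᶜ)) := by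
      refine dense_iUnion_interior_of_closed (fun n => isClosed_closure.union hWo.isClosed_compl) ?_
      refine eq_univ_of_forall fun z => mem_iUnion.2 ?_
      by_cases hz : z ∈ W
      · exact ⟨(R z).ncard, Or.inl (subset_closure ⟨hWK hz, le_rfl⟩)⟩
      · exact ⟨0, Or.inr hz⟩
    obtain ⟨y, hyW, hy⟩ := hd.inter_open_nonempty W hWo ⟨_, hxW⟩
    obtain ⟨n, hn⟩ := mem_iUnion.1 hy
    refine ⟨y, hyW, n, ?_⟩
    rw [mem_interior_iff_mem_nhds] at hn ⊢
    filter_upwards [hn, hWo.mem_nhds hyW] with z hz hzW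
    exact hz.resolve_right fun hc => hc hzW
  have hyK : y ∈ K := hWK hyW
  obtain ⟨hγy, hγ0⟩ := hγ y hyK
  have hs : γ y 0 ∈ E.source := by rw [hγ0]; exact E.map_target (hKE y hyK)
  have hE0 : E (γ y 0) = onN u y := by rw [hγ0, E.right_inv (hKE y hyK)]
  obtain ⟨P, hP, hper⟩ := hγy.2.1
  have hP0 : γ y P = γ y 0 := by simpa using hper 0
  refine hWne y hyW ?_
  simp only [hF, ← hE0]
  refine partialD_eq_zero_of_det_holonomy hB.null hEinstein hDEC hγy hP hper h hs
    (fun L φ hφ => ?_) hA hB'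
  have hmapy := hφ.map_eq
  have hcd := hφ.contDiffAt
  have hsat := hφ.saturated
  have hdens := hφ.density
  rw [hP0] at hmapy hsat
  simp only [hE0, cross_onN, onN_zero] at hmapy hcd hsat hdens ⊢
  have hKn : K ∈ 𝓝 y := Filter.mem_of_superset (hWo.mem_nhds hyW) hWK
  refine det_sq_eq_one_of_finite_orbits hmapy hcd (fun h0 => ?_) (A := R) hyn
    (fun z hz => ⟨hRfin z hz.1, hz.2⟩) ?_ ?_
  · rw [h0, normalizedDensity] at hdens
    have := mul_pos (h.crossDet_pos (E.map_source hs) (hγy.coord_one h hs))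
      (Real.exp_pos (-(2 * L 0)))
    rw [hdens] at this
    simp at this
  · filter_upwards [hKn] with z hz
    exact ⟨hz, 0, (hγ z hz).2⟩
  · have hcont : ContinuousAt φ y := hcd.continuousAt
    have hφK : ∀ᶠ w in 𝓝 y, φ w ∈ K := hcont.eventually (by rw [hmapy]; exact hKn)
    filter_upwards [hsat, hφK] with w hw hwK z hz hwz
    exact ⟨hwK, hw _ (hγ z hz.1).1.isSaturated_range hwz.2⟩

end Vanishing

/-! ### The Lie derivative of the metric -/

theorem bil_add_left (A : Matrix (Fin 4) (Fin 4) ℝ) (v v' w : Coord) :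
    bil A (v + v') w = bil A v w + bil A v' w := by
  simp [bil, mul_add, add_mul, Finset.sum_add_distrib]

theorem bil_add_right (A : Matrix (Fin 4) (Fin 4) ℝ) (v w w' : Coord) :
    bil A v (w + w') = bil A v w + bil A v w' := by
  simp [bil, mul_add, Finset.sum_add_distrib]

theorem bil_smul_left (A : Matrix (Fin 4) (Fin 4) ℝ) (c : ℝ) (v w : Coord) :
    bil A (c • v) w = c * bil A v w := by
  simp only [bil, PiLp.smul_apply, smul_eq_mul, Finset.mul_sum]
  exact Finset.sum_congr rfl fun i _ => Finset.sum_congr rfl fun j _ => by ring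

theorem hasDerivAt_bil {A : ℝ → Matrix (Fin 4) (Fin 4) ℝ} {A' : Matrix (Fin 4) (Fin 4) ℝ}
    {v w : ℝ → Coord} {v' w' : Coord} {t : ℝ} (hA : ∀ i j, HasDerivAt (fun t => A t i j) (A' i j) t)
    (hv : HasDerivAt v v' t) (hw : HasDerivAt w w' t) :
    HasDerivAt (fun t => bil (A t) (v t) (w t))
      (bil A' (v t) (w t) + bil (A t) v' (w t) + bil (A t) (v t) w') t := by
  have hv' : ∀ i, HasDerivAt (fun t => v t i) (v' i) t := fun i =>
    (EuclideanSpace.proj (𝕜 := ℝ) i).hasFDerivAt.comp_hasDerivAt t hv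
  have hw' : ∀ i, HasDerivAt (fun t => w t i) (w' i) t := fun i =>
    (EuclideanSpace.proj (𝕜 := ℝ) i).hasFDerivAt.comp_hasDerivAt t hw
  have h := HasDerivAt.fun_sum (u := Finset.univ) fun i _ => HasDerivAt.fun_sum (u := Finset.univ)
    fun j _ => ((hA i j).mul (hv' i)).mul (hw' j)
  refine h.congr_deriv ?_
  simp only [bil, ← Finset.sum_add_distrib]
  exact Finset.sum_congr rfl fun i _ => Finset.sum_congr rfl fun j _ => by simp; ring

theorem hasDerivAt_line_apply {F : Coord → Coord →L[ℝ] Coord} {x : Coord} (v a : Coord)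
    (hF : DifferentiableAt ℝ F x) :
    HasDerivAt (fun t : ℝ => F (x + t • v) a) (fderiv ℝ F x v a) 0 := by
  have h1 : HasDerivAt (fun t : ℝ => x + t • v) v 0 := by
    simpa using ((hasDerivAt_id (0 : ℝ)).smul_const v).const_add x
  have h2 : HasFDerivAt F (fderiv ℝ F x) (x + (0 : ℝ) • v) := by simpa using hF.hasFDerivAt
  have h3 : HasDerivAt (fun t : ℝ => F (x + t • v)) (fderiv ℝ F x v) 0 :=
    h2.comp_hasDerivAt (0 : ℝ) h1
  exact (ContinuousLinearMap.apply ℝ Coord a).hasFDerivAt.comp_hasDerivAt (0 : ℝ) h3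

/-- The Lie derivative `(L_V g)(v, w)` at `x` of the metric with components `G`. -/
noncomputable def lieMetric (G : Coord → Matrix (Fin 4) (Fin 4) ℝ) (V : Coord → Coord)
    (x v w : Coord) : ℝ :=
  bil (Matrix.of fun i j => fderiv ℝ (fun y => G y i j) x (V x)) v w
    + bil (G x) (fderiv ℝ V x v) w + bil (G x) v (fderiv ℝ V x w)

/-- The Christoffel symbols of the first kind. -/
theorem sum_mul_christoffel {G : Coord → Matrix (Fin 4) (Fin 4) ℝ}
    (hsymm : ∀ x i j, G x i j = G x j i) {x : Coord} (hdet : IsUnit (G x).det) (j k l : Fin 4) :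
    ∑ i, G x i j * christoffel G i k l x = (1 / 2) * (partialD k (fun y => G y j l) x
      + partialD l (fun y => G y j k) x - partialD j (fun y => G y k l) x) := by
  have h1 : ∀ m, ∑ i, G x i j * (G x)⁻¹ i m = if j = m then 1 else 0 := by
    intro m
    have h2 := congrFun (congrFun (Matrix.mul_nonsing_inv (G x) hdet) j) m
    rw [Matrix.mul_apply, Matrix.one_apply] at h2
    rw [← h2]
    exact Finset.sum_congr rfl fun i _ => by rw [hsymm x i j]
  set D : Fin 4 → ℝ := fun m => partialD k (fun y => G y m l) x + partialD l (fun y => G y m k) x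
    - partialD m (fun y => G y k l) x with hD
  have h3 : ∑ i, G x i j * christoffel G i k l x =
      ∑ i, ∑ m, (1 / 2) * D m * (G x i j * (G x)⁻¹ i m) := by
    refine Finset.sum_congr rfl fun i _ => ?_
    simp only [christoffel, Finset.mul_sum]
    exact Finset.sum_congr rfl fun m _ => by simp only [hD]; ring
  rw [h3, Finset.sum_comm]
  simp only [← Finset.mul_sum, h1]
  simp [hD]

section Manifold

variable {M : Type*} [TopologicalSpace M] [ChartedSpace Coord M] {S : Spacetime M}

/-- The symmetric part of `g(∇_X K, Y)` is half the Lie derivative of the metric along `K`. -/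
theorem nullForm_add_nullForm {e : OpenPartialHomeomorph M Coord} (he : IsSmoothChart e)
    (K : VecField M) {p : M} (hp : p ∈ e.source) (X Y : TangentSpace (𝓡 4) p) :
    S.nullForm e K p X Y + S.nullForm e K p Y X =
      lieMetric (bilinComp e S.g) (fieldComp e K) (e p) (vecComp e p X) (vecComp e p Y) := by
  set G := bilinComp e S.g with hG
  set V := fieldComp e K with hV
  set x := e p
  have hsymm : ∀ x i j, G x i j = G x j i := fun x => bilinComp_symm S e x
  have hdet : IsUnit (G x).det := isUnit_det_bilinComp S he (e.map_source hp)
  have hsymm' : ∀ i j, (fun y => G y i j) = fun y => G y j i := fun i j =>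
    funext fun y => hsymm y i j
  set c : Fin 4 → Fin 4 → Fin 4 → ℝ := fun j k l => (1 / 2) * (partialD k (fun y => G y j l) x
      + partialD l (fun y => G y j k) x - partialD j (fun y => G y k l) x) with hc
  have hform : ∀ X Y : TangentSpace (𝓡 4) p, S.nullForm e K p X Y =
      bil (G x) (fderiv ℝ V x (vecComp e p X)) (vecComp e p Y)
        + ∑ j, ∑ k, ∑ l, c j k l * vecComp e p X k * V x l * vecComp e p Y j := by
    intro X Y
    simp only [Spacetime.nullForm, Spacetime.covDeriv, bil, ← hG, ← hV, mul_add, add_mul,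
      Finset.sum_add_distrib]
    congr 1
    rw [Finset.sum_comm]
    refine Finset.sum_congr rfl fun j _ => ?_
    simp only [Finset.mul_sum, Finset.sum_mul]
    rw [Finset.sum_comm]
    refine Finset.sum_congr rfl fun k _ => ?_
    rw [Finset.sum_comm]
    refine Finset.sum_congr rfl fun l _ => ?_
    rw [show c j k l = ∑ i, G x i j * christoffel G i k l x from
      (sum_mul_christoffel hsymm hdet j k l).symm, Finset.sum_mul, Finset.sum_mul, Finset.sum_mul]
    exact Finset.sum_congr rfl fun i _ => by ring
  set v := vecComp e p X
  set w := vecComp e p Y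
  have hfd : ∀ i j, fderiv ℝ (fun y => G y i j) x (V x) =
      ∑ l, V x l * partialD l (fun y => G y i j) x := by
    intro i j
    conv_lhs => rw [← sum_coordVec (V x), map_sum]
    exact Finset.sum_congr rfl fun l _ => by rw [map_smul, smul_eq_mul, partialD]
  have hsum : (∑ j, ∑ k, ∑ l, c j k l * v k * V x l * w j)
      + ∑ j, ∑ k, ∑ l, c j k l * w k * V x l * v j =
      bil (Matrix.of fun i j => fderiv ℝ (fun y => G y i j) x (V x)) v w := by
    rw [Finset.sum_comm]
    simp only [bil, Matrix.of_apply, hfd, Finset.sum_mul, ← Finset.sum_add_distrib]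
    refine Finset.sum_congr rfl fun k _ => Finset.sum_congr rfl fun j _ =>
      Finset.sum_congr rfl fun l _ => ?_
    simp only [hc, hsymm' j k, hsymm' j l]
    ring
  rw [hform X Y, hform Y X, lieMetric, ← hsum]
  have : bil (G x) (fderiv ℝ V x w) v = bil (G x) v (fderiv ℝ V x w) := bil_symm S e x _ _
  rw [this]
  ring

variable {N : Set M}

/-- If the transverse metric is constant along the generators, the Lie derivative of the metric
along a field tangent to the generators vanishes on vectors tangent to `N`. The components `V` of
the field refer to an arbitrary chart `e`; on `N` its components in the flow box `E` are `(λ,0,0,0)`,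
and only `λ ∂g/∂x⁰` and multiples of `g_0i` occur in the Lie derivative. -/
theorem lieMetric_eq_zero {e E : OpenPartialHomeomorph M Coord} (he : IsSmoothChart e)
    (h : IsFlowBox S N E) (hconst : ∀ y ∈ E.target, y 1 = 0 → ∀ A B : Fin 4, (A = 2 ∨ A = 3) →
      (B = 2 ∨ B = 3) → partialD 0 (fun y => bilinComp E S.g y A B) y = 0)
    {x : Coord} (hx : x ∈ e.target) (hx' : e.symm x ∈ E.source) (hxN : e.symm x ∈ N)
    {V : Coord → Coord} (hV : DifferentiableAt ℝ V x)
    (hVN : ∀ z ∈ e.target, e.symm z ∈ E.source → e.symm z ∈ N →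
      ∀ i, i ≠ 0 → fderiv ℝ (E ∘ e.symm) z (V z) i = 0)
    {v w : Coord} (hv : fderiv ℝ (E ∘ e.symm) x v 1 = 0) (hw : fderiv ℝ (E ∘ e.symm) x w 1 = 0) :
    lieMetric (bilinComp e S.g) V x v w = 0 := by
  set T := E ∘ e.symm with hT
  set O := e.target ∩ e.symm ⁻¹' E.source with hO
  have hOo : IsOpen O := isOpen_transition e E
  have hxO : x ∈ O := ⟨hx, hx'⟩
  have hTs : ContDiffOn ℝ ∞ T O := contDiffOn_transition he h.smooth
  have hTd : ContDiffOn ℝ ∞ (fderiv ℝ T) O := hTs.fderiv_of_isOpen hOo (by simp)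
  have hA : HasFDerivAt (fderiv ℝ T) (fderiv ℝ (fderiv ℝ T) x) x :=
    ((hTd.contDiffAt (hOo.mem_nhds hxO)).differentiableAt (by simp)).hasFDerivAt
  have hAsymm : IsSymmSndFDerivAt ℝ T x := (hTs.contDiffAt (hOo.mem_nhds hxO)).isSymmSndFDerivAt (by
    rw [minSmoothness_of_isRCLikeNormedField]; exact ENat.LEInfty.out)
  set y := E (e.symm x) with hy
  have hyt : y ∈ E.target := E.map_source hx'
  have hy1 : y 1 = 0 := (h.mem_iff _ hx').1 hxN
  have hTx : HasFDerivAt T (fderiv ℝ T x) x :=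
    ((hTs.contDiffAt (hOo.mem_nhds hxO)).differentiableAt (by simp)).hasFDerivAt
  -- the components of `V` in the flow box, as functions on the chart `e`
  set U : Coord → Coord := fun z => fderiv ℝ T z (V z) with hU
  have hUx := hA.clm_apply hV.hasFDerivAt
  set DU := fderiv ℝ U x with hDU
  have hDUv : ∀ a, DU a = fderiv ℝ T x (fderiv ℝ V x a) + fderiv ℝ (fderiv ℝ T) x a (V x) := by
    intro a
    rw [hDU, hUx.fderiv]
    simp
  have hUz : ∀ i, i ≠ 0 → U x i = 0 := fun i hi => hVN x hx hx' hxN i hi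
  have hDUt : ∀ a, fderiv ℝ T x a 1 = 0 → ∀ i, i ≠ 0 → DU a i = 0 := by
    intro a ha i hi
    set a' := fderiv ℝ T x a with ha'
    have hback : fderiv ℝ (e ∘ E.symm) y a' = a := by
      have h1 := vecComp_transition he h.smooth (e.map_target hx) hx' (chartVec e x a)
      have h2 := vecComp_transition h.smooth he hx' (e.map_target hx) (chartVec e x a)
      rw [vecComp_chartVec he hx] at h1 h2
      rw [e.right_inv hx] at h1
      rw [h1] at h2
      exact h2.symm
    have hline : HasDerivAt (fun t : ℝ => y + t • a') a' 0 := by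
      simpa using ((hasDerivAt_id (0 : ℝ)).smul_const a').const_add y
    have hcy : e (E.symm (y + (0 : ℝ) • a')) = x := by
      rw [zero_smul, add_zero, hy, E.left_inv hx', e.right_inv hx]
    have hd := differentiableAt_transition h.smooth he hx' (e.map_target hx)
    have hcurve : HasDerivAt (fun t : ℝ => (e ∘ E.symm) (y + t • a')) a 0 := by
      have h1 : HasFDerivAt (e ∘ E.symm) (fderiv ℝ (e ∘ E.symm) y) (y + (0 : ℝ) • a') := by
        simpa using hd.hasFDerivAt
      have h2 := h1.comp_hasDerivAt (0 : ℝ) hline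
      rwa [hback] at h2
    have hU' : HasFDerivAt U DU ((e ∘ E.symm) (y + (0 : ℝ) • a')) := by
      rw [Function.comp_apply, hcy]; exact hUx.differentiableAt.hasFDerivAt
    have h2 := hU'.comp_hasDerivAt (0 : ℝ) hcurve
    have h3 : HasDerivAt (fun t : ℝ => U ((e ∘ E.symm) (y + t • a')) i) (DU a i) 0 :=
      HasFDerivAt.comp_hasDerivAt (f := U ∘ fun t : ℝ => (e ∘ E.symm) (y + t • a')) (0 : ℝ)
        (EuclideanSpace.proj (𝕜 := ℝ) i).hasFDerivAt h2
    have hev : (fun t : ℝ => U ((e ∘ E.symm) (y + t • a')) i) =ᶠ[𝓝 0] fun _ => 0 := by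
      have : ∀ᶠ t : ℝ in 𝓝 0, y + t • a' ∈ E.target ∩ E.symm ⁻¹' e.source :=
        (continuous_line y a').continuousAt.eventually_mem
          ((isOpen_transition E e).mem_nhds (by
            simpa [hy, E.left_inv hx'] using ⟨hyt, e.map_target hx⟩))
      filter_upwards [this] with t ht
      have hmem : e.symm (e (E.symm (y + t • a'))) = E.symm (y + t • a') := e.left_inv ht.2
      refine hVN _ (e.map_source ht.2) ?_ ?_ i hi
      · simp only [hmem]; exact E.map_target ht.1
      · simp only [hmem]
        exact (h.symm_mem_iff ht.1).2 (by simp [hy1, ha])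
    exact h3.unique ((hasDerivAt_const (0 : ℝ) (0 : ℝ)).congr_of_eventuallyEq hev)
  have hspan : ∀ a : Coord, (∀ i, i ≠ 0 → a i = 0) → a = a 0 • coordVec 0 := by
    intro a ha
    ext i; by_cases hi : i = 0
    · subst hi; simp
    · simp [ha i hi, hi]
  set G := bilinComp e S.g with hG
  set G' := bilinComp E S.g with hG'
  set v' := fderiv ℝ T x v
  set w' := fderiv ℝ T x w
  -- differentiate the transformation law of the metric along `V`
  have hline : HasDerivAt (fun t : ℝ => x + t • V x) (V x) 0 := by
    simpa using ((hasDerivAt_id (0 : ℝ)).smul_const (V x)).const_add x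
  have hx0 : x + (0 : ℝ) • V x = x := by simp
  have hd1 : HasDerivAt (fun t : ℝ => bil (G (x + t • V x)) v w)
      (bil (Matrix.of fun i j => fderiv ℝ (fun y => G y i j) x (V x)) v w) 0 := by
    have h1 := hasDerivAt_bil (A := fun t : ℝ => G (x + t • V x))
      (A' := Matrix.of fun i j => fderiv ℝ (fun y => G y i j) x (V x)) (t := 0)
      (fun i j => hasDerivAt_line (V x) (((S.g_smooth e he i j).contDiffAt
        (e.open_target.mem_nhds hx)).differentiableAt (by simp)))
      (hasDerivAt_const (0 : ℝ) v) (hasDerivAt_const (0 : ℝ) w)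
    convert h1 using 1
    simp [bil]
  have hfd' : ∀ a, HasDerivAt (fun t : ℝ => fderiv ℝ T (x + t • V x) a)
      (fderiv ℝ (fderiv ℝ T) x (V x) a) 0 := fun a =>
    hasDerivAt_line_apply (V x) a hA.differentiableAt
  have hTl : HasDerivAt (fun t : ℝ => T (x + t • V x)) (U x) 0 := by
    have h2 : HasFDerivAt T (fderiv ℝ T x) (x + (0 : ℝ) • V x) := by rwa [hx0]
    exact h2.comp_hasDerivAt (0 : ℝ) hline
  have hGl : ∀ i j, HasDerivAt (fun t : ℝ => G' (T (x + t • V x)) i j)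
      (fderiv ℝ (fun y => G' y i j) y (U x)) 0 := by
    intro i j
    have h1 : HasFDerivAt (fun y => G' y i j) (fderiv ℝ (fun y => G' y i j) y)
        (T (x + (0 : ℝ) • V x)) := by
      rw [hx0]
      exact (h.adapted.differentiableAt_of_smooth (h.adapted.smooth i j) hyt).hasFDerivAt
    exact h1.comp_hasDerivAt (0 : ℝ) hTl
  have hd2 := hasDerivAt_bil (A := fun t : ℝ => G' (T (x + t • V x)))
    (A' := Matrix.of fun i j => fderiv ℝ (fun y => G' y i j) y (U x)) (t := 0) hGl
    (hfd' v) (hfd' w)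
  have heq : (fun t : ℝ => bil (G (x + t • V x)) v w) =ᶠ[𝓝 0] fun t : ℝ =>
      bil (G' (T (x + t • V x))) (fderiv ℝ T (x + t • V x) v) (fderiv ℝ T (x + t • V x) w) := by
    have : ∀ᶠ t : ℝ in 𝓝 0, x + t • V x ∈ O :=
      (continuous_line x (V x)).continuousAt.eventually_mem (hOo.mem_nhds (by simpa using hxO))
    filter_upwards [this] with t ht
    exact bil_transition he h.smooth S.g ht.1 ht.2 v w
  have key := hd1.unique (hd2.congr_of_eventuallyEq heq)
  have hTxy : T x = y := rfl
  simp only [hx0, hTxy] at key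
  have hsymm' : ∀ a b, bil (G' y) a b = bil (G' y) b a := bil_symm S E y
  have htrans : ∀ a b, bil (G x) a b = bil (G' y) (fderiv ℝ T x a) (fderiv ℝ T x b) :=
    bil_transition he h.smooth S.g hx hx'
  have hzero : ∀ a b, fderiv ℝ T x a 1 = 0 → fderiv ℝ T x b 1 = 0 →
      bil (G' y) (DU a) (fderiv ℝ T x b) = 0 := by
    intro a b ha hb
    rw [hspan _ (hDUt a ha), bil_smul_left, hG', h.bil_coordVec_zero hyt hy1, hb]
    simp
  have hfirst : bil (Matrix.of fun i j => fderiv ℝ (fun y => G' y i j) y (U x)) v' w' = 0 := by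
    have hpd : ∀ i j, fderiv ℝ (fun y => G' y i j) y (U x) =
        U x 0 * partialD 0 (fun y => G' y i j) y := by
      intro i j
      rw [hspan _ hUz, map_smul, smul_eq_mul, partialD]
      simp
    have h0 : ∀ j, j ≠ 1 → partialD 0 (fun y => G' y 0 j) y = 0 := by
      intro j hj
      refine h.adapted.partialD_eq_zero (h.adapted.smooth 0 j) (fun z hz hz1 => ?_) hyt hy1
        (by decide)
      fin_cases j
      · exact h.adapted.null z hz hz1
      · exact absurd rfl hj
      · exact h.adapted.orth_two z hz hz1
      · exact h.adapted.orth_three z hz hz1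
    have h0' : ∀ j, j ≠ 1 → partialD 0 (fun y => G' y j 0) y = 0 := by
      intro j hj
      have : (fun y => G' y j 0) = fun y => G' y 0 j := funext fun z => h.adapted.symm z j 0
      rw [this]; exact h0 j hj
    have hc := hconst y hyt hy1
    simp only [bil, Matrix.of_apply, hpd, Fin.sum_univ_four, hv, hw, h0 0 (by decide),
      h0 2 (by decide), h0 3 (by decide), h0' 2 (by decide), h0' 3 (by decide),
      hc 2 2 (by simp) (by simp), hc 2 3 (by simp) (by simp), hc 3 2 (by simp) (by simp),
      hc 3 3 (by simp) (by simp)]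
    ring
  rw [lieMetric, key, htrans, htrans, hfirst]
  have e1 := hzero v w hv hw
  have e2 := hzero w v hw hv
  rw [hsymm'] at e2
  rw [hDUv, bil_add_left] at e1
  rw [hDUv, bil_add_right] at e2
  rw [hAsymm.eq v (V x)] at e1
  rw [hAsymm.eq w (V x)] at e2
  linarith

/-- The null form of the horizon is skew on vectors tangent to the horizon. -/
theorem Spacetime.IsClassB.nullForm_add_nullForm_eq_zero [T2Space M] [IsManifold (𝓡 4) ∞ M]
    {T : BilinField M} (hB : S.IsClassB N) (hEinstein : S.EinsteinEquation T)
    (hDEC : S.DominantEnergyCondition T) {e : OpenPartialHomeomorph M Coord}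
    (he : IsSmoothChart e) {K : VecField M} (hK : ContDiffOn ℝ ∞ (fieldComp e K) e.target)
    (hKN : ∀ q ∈ N ∩ e.source, S.IsGeneratorVector N q (K q)) {p : M} (hp : p ∈ N ∩ e.source)
    {X Y : TangentSpace (𝓡 4) p} (hX : IsTangentTo N p X) (hY : IsTangentTo N p Y) :
    S.nullForm e K p X Y + S.nullForm e K p Y X = 0 := by
  obtain ⟨E, h, hpE⟩ := exists_isFlowBox hB.null hp.1
  have hx := e.map_source hp.2
  have hinv : e.symm (e p) = p := e.left_inv hp.2
  rw [nullForm_add_nullForm he K hp.2]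
  refine lieMetric_eq_zero he h (fun y hy hy1 A B hA hB' =>
    h.partialD_eq_zero hB hEinstein hDEC hy hy1 hA hB') hx (by rwa [hinv]) (by rw [hinv]; exact hp.1)
    ((hK.contDiffAt (e.open_target.mem_nhds hx)).differentiableAt (by simp)) ?_ ?_ ?_
  · intro z hz hzE hzN i hi
    have hz' := e.map_target hz
    obtain ⟨-, ht, hn⟩ := hKN _ ⟨hzN, hz'⟩
    have h1 := vecComp_transition he h.smooth hz' hzE (K (e.symm z))
    rw [e.right_inv hz] at h1
    have h2 := vecComp_eq_zero_of_isTangentTo h.smooth h.mem_iff hzE hzN ht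
    rw [bilinField_eq_bil h.smooth S.g hzE] at hn
    have h3 := h.eq_of_null (E.map_source hzE) ((h.mem_iff _ hzE).1 hzN) h2 hn
    rw [show fieldComp e K z = vecComp e (e.symm z) (K (e.symm z)) from rfl, ← h1]
    fin_cases i
    · exact absurd rfl hi
    · exact h2
    · exact h3.1
    · exact h3.2
  · rw [← vecComp_transition he h.smooth hp.2 hpE]
    exact vecComp_eq_zero_of_isTangentTo h.smooth h.mem_iff hpE hp.1 hX
  · rw [← vecComp_transition he h.smooth hp.2 hpE]
    exact vecComp_eq_zero_of_isTangentTo h.smooth h.mem_iff hpE hp.1 hY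

/-- A skew null form has neither trace nor symmetric trace-free part. -/
theorem Spacetime.expansion_shear_eq_zero {e : OpenPartialHomeomorph M Coord} {K : VecField M}
    {p : M} {X : Fin 2 → TangentSpace (𝓡 4) p}
    (hskew : ∀ A B, S.nullForm e K p (X A) (X B) + S.nullForm e K p (X B) (X A) = 0) :
    S.expansion e K p X = 0 ∧ ∀ A B, S.shear e K p X A B = 0 := by
  have hh : (S.crossMetric p X).transpose = S.crossMetric p X := by
    ext A B; exact S.g_symm p _ _
  have hinv : ∀ A B, (S.crossMetric p X)⁻¹ A B = (S.crossMetric p X)⁻¹ B A := by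
    intro A B
    have h1 := Matrix.transpose_nonsing_inv (S.crossMetric p X)
    rw [hh] at h1
    exact congrFun (congrFun h1 B) A
  have h0 : S.expansion e K p X = 0 := by
    have h1 := hskew 0 0
    have h2 := hskew 0 1
    have h3 := hskew 1 1
    simp only [Spacetime.expansion, Fin.sum_univ_two, hinv 1 0]
    have e0 : S.nullForm e K p (X 0) (X 0) = 0 := by linarith
    have e1 : S.nullForm e K p (X 1) (X 1) = 0 := by linarith
    rw [e0, e1]
    linear_combination (S.crossMetric p X)⁻¹ 0 1 * h2
  refine ⟨h0, fun A B => ?_⟩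
  rw [Spacetime.shear, h0, hskew]
  ring

end Manifold

/-! ### Gaussian null coordinates -/

section Gauss

variable {M : Type*} [TopologicalSpace M] [ChartedSpace Coord M] {S : Spacetime M} {N : Set M}

theorem isOpen_gaussDomain (ε : ℝ) {V : Set (ℝ × ℝ)} (hV : IsOpen V) : IsOpen (gaussDomain ε V) := by
  have h1 : Continuous fun x : Coord => x 1 := by fun_prop
  have h2 : Continuous fun x : Coord => (x 2, x 3) := by fun_prop
  exact (isOpen_Ioo.preimage h1).inter (hV.preimage h2)

/-- Gaussian null coordinates are locally a flow box. -/
theorem ElementaryNeighbourhood.exists_isFlowBox [IsManifold (𝓡 4) ∞ M]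
    (O : ElementaryNeighbourhood S N) {x : Coord} (hx : x ∈ gaussDomain O.ε O.V) :
    ∃ E : OpenPartialHomeomorph M Coord, IsFlowBox S N E ∧ x ∈ E.target ∧
      ∀ y ∈ E.target, bilinComp E S.g y = gaussMatrix O.f O.h O.q y := by
  have hD := isOpen_gaussDomain O.ε O.V_open
  obtain ⟨Φ, hxΦ, heq⟩ := O.ψ_localDiffeo ⟨x, hx⟩
  set E := (Φ.toOpenPartialHomeomorph.restrOpen _ hD).symm with hE
  have htarget : ∀ y, y ∈ E.target ↔ y ∈ Φ.source ∧ y ∈ gaussDomain O.ε O.V := fun y => Iff.rfl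
  have hψ : ∀ y ∈ E.target, E.symm y = O.ψ y := fun y hy => (heq ((htarget y).1 hy).1).symm
  have hsm : IsSmoothChart E := by
    refine E.mem_maximalAtlas_of_contMDiffOn (Φ.contMDiffOn_invFun.mono ?_)
      (Φ.contMDiffOn_toFun.mono fun y hy => ((htarget y).1 hy).1)
    intro q hq
    rw [← E.left_inv hq]
    exact Φ.map_source ((htarget _).1 (E.map_source hq)).1
  have hcomp : ∀ y ∈ E.target, bilinComp E S.g y = gaussMatrix O.f O.h O.q y := by
    intro y hy
    ext i j
    rw [← O.metric y ((htarget y).1 hy).2 i j]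
    have hd : ∀ v : Coord, (chartVec E y v : Coord) = (mfderiv (𝓡 4) (𝓡 4) O.ψ y v : Coord) := by
      intro v
      have hev : (E.symm : Coord → M) =ᶠ[𝓝 y] O.ψ := by
        filter_upwards [E.open_target.mem_nhds hy] with z hz using hψ z hz
      exact congrArg (fun L : Coord →L[ℝ] Coord => L v) hev.mfderiv_eq
    exact bilinField_congr S.g (hψ y hy) _ _ _ _ (hd _) (hd _)
  refine ⟨E, IsFlowBox.of_orthogonal hsm (fun q hq => ?_) (fun y hy hy1 => ?_), ⟨hxΦ, hx⟩, hcomp⟩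
  · have hy := E.map_source hq
    rw [← O.horizon _ ((htarget _).1 hy).2, ← hψ _ hy, E.left_inv hq]
  · simp [hcomp y hy, gaussMatrix, hy1]

/-- In Gaussian null coordinates the transverse metric on the horizon does not depend on `u`. -/
theorem ElementaryNeighbourhood.hasDerivAt_q [T2Space M] [IsManifold (𝓡 4) ∞ M] {T : BilinField M}
    (hEinstein : S.EinsteinEquation T) (hDEC : S.DominantEnergyCondition T) (hB : S.IsClassB N)
    (O : ElementaryNeighbourhood S N) {x : Coord} (hx : x ∈ gaussDomain O.ε O.V) (hx1 : x 1 = 0)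
    (A B : Fin 2) : HasDerivAt (fun t : ℝ => O.q (x + t • coordVec 0) A B) 0 0 := by
  obtain ⟨E, h, hxE, hcomp⟩ := O.exists_isFlowBox hx
  have hD := isOpen_gaussDomain O.ε O.V_open
  have hd : DifferentiableAt ℝ (fun y => O.q y A B) x :=
    ((O.q_smooth A B).contDiffAt (hD.mem_nhds hx)).differentiableAt (by simp)
  have key : ∀ i j : Fin 4, (i = 2 ∨ i = 3) → (j = 2 ∨ j = 3) →
      (∀ y, gaussMatrix O.f O.h O.q y i j = O.q y A B) →
      partialD 0 (fun y => O.q y A B) x = 0 := by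
    intro i j hi hj hij
    rw [← h.partialD_eq_zero hB hEinstein hDEC hxE hx1 hi hj]
    refine partialD_congr 0 ?_
    filter_upwards [E.open_target.mem_nhds hxE] with y hy
    rw [hcomp y hy, hij]
  have h0 : partialD 0 (fun y => O.q y A B) x = 0 := by
    fin_cases A <;> fin_cases B
    · exact key 2 2 (by simp) (by simp) fun y => rfl
    · exact key 2 3 (by simp) (by simp) fun y => rfl
    · exact key 3 2 (by simp) (by simp) fun y => rfl
    · exact key 3 3 (by simp) (by simp) fun y => rfl
  have h1 := hasDerivAt_line (coordVec 0) hd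
  rwa [show fderiv ℝ (fun y => O.q y A B) x (coordVec 0) = 0 from h0] at h1

end Gauss

theorem proposition3p1 {M : Type*} [TopologicalSpace M] [T2Space M] [ParacompactSpace M]
    [ConnectedSpace M] [ChartedSpace Coord M] [IsManifold (𝓡 4) ∞ M]
    (S : Spacetime M) (T : BilinField M)
    (hEinstein : S.EinsteinEquation T) (hDEC : S.DominantEnergyCondition T)
    (N : Set M) (hB : S.IsClassB N) :
    S.GeneratorsExpansionShearFree N ∧
      ∀ O : ElementaryNeighbourhood S N, ∀ x ∈ gaussDomain O.ε O.V, x 1 = 0 →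
        ∀ A B : Fin 2, HasDerivAt (fun t : ℝ => O.q (x + t • coordVec 0) A B) 0 0 :=
  ⟨fun _ _ he hK hKN _ hp _ hX _ => Spacetime.expansion_shear_eq_zero fun A B =>
    hB.nullForm_add_nullForm_eq_zero hEinstein hDEC he hK hKN hp (hX A) (hX B),
  fun O _ hx hx1 A B => O.hasDerivAt_q hEinstein hDEC hB hx hx1 A B⟩
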